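/- **Model.** A network is a connected undirected graph $G$ with $n$ nodes, $m$ edges and diameter $D$. Nodes are anonymous; each knows $n$, its own degree and local (arbitrary) numbers of its incident edges, and has private fair coins; local computation is free. Initially all nodes sleep. A node wakes up when the environment wakes it or when a message reaches it; on waking it draws, once and for all, an identity of $O(\log n)$ bits. Messages have $O(\log n)$ bits; in each direction of an edge they are delivered without error in FIFO order, one at a time, each taking at most one time unit from the moment the edge is free for it. An adaptive adversary, which sees all past coin flips and configurations, decides which nodes it wakes (at least one) and when, and when messages are delivered. Time is counted from the first wake-up. Leader election is solved when all nodes have irrevocably terminated, exactly one node $v$ is elected, and every node outputs the identity of $v$, which is the identity of no other node. **Theorem.** For every constant $c>0$ there exist a randomized algorithm and constants $K,\kappa,n_0$ (depending only on $c$), with messages and identities taken from sets of size at most $n^{\kappa}$, such that for all $n\ge n_0$, every connected graph $G$ with $n$ nodes, $m$ edges and diameter $D$, every edge numbering, and every adaptive adversary as above, with probability at least $1-1/n^{c}$ the algorithm solves leader election within time $K\,D\log^2 n$ and sends at most $K\,m\log^2 n$ messages in the whole execution. -/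

import Mathlib

open MeasureTheory

/-- A randomized message-passing protocol, as run by every node of an anonymous network.
A node sees only its own state, its own degree, its own coins, and the messages that arrive,
each together with the local number of the edge over which it arrives.
`wake d b` is executed once, when a node of degree `d` wakes up, with fresh fair coins `b`; it fixes
the identity of the node once and for all, its first state, and the messages to send.
`receive d s i M b` is executed when a node of degree `d` in state `s` receives the message `M` over
its `i`-th edge, with fresh fair coins `b`.
Messages to send are given as a finite list for each of the edges `0, ..., d - 1` of the node.
`output s = some (e, x)` means that the node has irrevocably terminated, that it considers itself
elected iff `e = true`, and that it takes `x` to be the identity of the leader. -/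
structure Protocol where
  Msg : Type
  Ident : Type
  State : Type
  [fintypeMsg : Fintype Msg]
  [fintypeIdent : Fintype Ident]
  coins : ℕ
  wake : ℕ → (Fin coins → Bool) → Ident × State × (ℕ → List Msg)
  receive : ℕ → State → ℕ → Msg → (Fin coins → Bool) → State × (ℕ → List Msg)
  output : State → Option (Bool × Ident)

attribute [instance] Protocol.fintypeMsg Protocol.fintypeIdent

/-- `port v w` is the local number, at `v`, of the edge from `v` to its neighbor `w`. -/
def IsPortNumbering {V : Type} [Fintype V] (G : SimpleGraph V) [DecidableRel G.Adj]
    (port : V → V → ℕ) : Prop :=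
  ∀ v, Set.BijOn (port v) (G.neighborSet v) (Set.Iio (G.degree v))

namespace Protocol

/-- The data of an awake node. `flips` lists the coins that the node has used so far, one block for
each of its activations. -/
structure Node (P : Protocol) where
  ident : P.Ident
  state : P.State
  flips : List (Fin P.coins → Bool)

/-- A configuration of the network: the current time, the nodes (`none` is a sleeping node), for
each ordered pair `(u, w)` of neighbors the queue of the messages from `u` to `w` that have been
sent and not yet delivered, the time at which the transmission of the first message in that queue
began, and the number of messages sent so far in the whole network. -/
structure Config (P : Protocol) (V : Type) where
  now : ℝ
  node : V → Option P.Node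
  queue : V → V → List P.Msg
  since : V → V → ℝ
  sent : ℕ

/-- All nodes are asleep and no message has been sent. -/
def start (P : Protocol) (V : Type) : P.Config V where
  now := 0
  node := fun _ => none
  queue := fun _ _ => []
  since := fun _ _ => 0
  sent := 0

/-- The coins of the network: coin number `i` in the `k`-th activation of the node `v`. -/
abbrev Coins (P : Protocol) (V : Type) : Type := V × ℕ × Fin P.coins → Bool

/-- All coins are fair and independent. -/
noncomputable def coinMeasure (P : Protocol) (V : Type) : Measure (P.Coins V) :=
  Measure.infinitePi fun _ => (PMF.uniformOfFintype Bool).toMeasure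

/-- What the environment can do: wake up a sleeping node, or deliver the first message that is
waiting on the edge from `u` to `w`. -/
inductive Action (V : Type) where
  | wake (v : V)
  | deliver (u w : V)

section Execution

variable {P : Protocol} {V : Type} [Fintype V] [DecidableEq V]
  (G : SimpleGraph V) [DecidableRel G.Adj] (port : V → V → ℕ)

/-- The node `v` sends the messages `out`. If an edge was free, a transmission starts on it now. -/
def emit (c : P.Config V) (v : V) (out : ℕ → List P.Msg) : P.Config V where
  now := c.now
  node := c.node
  queue := fun u w =>
    if u = v ∧ G.Adj u w then c.queue u w ++ out (port u w) else c.queue u w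
  since := fun u w => if c.queue u w = [] then c.now else c.since u w
  sent := c.sent + ∑ w ∈ G.neighborFinset v, (out (port v w)).length

/-- The node `v` wakes up if it is asleep. -/
def wakeUp (ω : P.Coins V) (c : P.Config V) (v : V) : P.Config V :=
  match c.node v with
  | some _ => c
  | none =>
    let b : Fin P.coins → Bool := fun i => ω (v, 0, i)
    let r := P.wake (G.degree v) b
    emit G port { c with node := Function.update c.node v (some ⟨r.1, r.2.1, [b]⟩) } v r.2.2

/-- The awake node `w` receives the message `M` from its neighbor `u`; a node that has terminated
ignores it. -/
def accept (ω : P.Coins V) (c : P.Config V) (u w : V) (M : P.Msg) : P.Config V :=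
  match c.node w with
  | none => c
  | some x =>
    if (P.output x.state).isSome then c
    else
      let b : Fin P.coins → Bool := fun i => ω (w, x.flips.length, i)
      let r := P.receive (G.degree w) x.state (port w u) M b
      emit G port
        { c with node := Function.update c.node w (some ⟨x.ident, r.1, x.flips ++ [b]⟩) } w r.2

/-- The first message waiting on the edge from `u` to `w` arrives (and wakes `w` up if `w` is
asleep); then the transmission of the next message in the queue, if any, begins. -/
def arrive (ω : P.Coins V) (c : P.Config V) (u w : V) : P.Config V :=
  match c.queue u w with
  | [] => c
  | M :: rest =>
    accept G port ω
      (wakeUp G port ω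
        { c with
          queue := fun a b => if a = u ∧ b = w then rest else c.queue a b
          since := fun a b => if a = u ∧ b = w then c.now else c.since a b } w) u w M

/-- One step of the execution; `some (t, a)` means that the action `a` happens at time `t`, and
`none` that nothing happens. -/
def step (ω : P.Coins V) (c : P.Config V) : Option (ℝ × Action V) → P.Config V
  | none => c
  | some (t, .wake v) => wakeUp G port ω { c with now := t } v
  | some (t, .deliver u w) => arrive G port ω { c with now := t } u w

/-- What the environment is allowed to do in the configuration `c`. The clock starts when the first
node is woken up, and some node has to be woken up. Time does not run backwards, and it does not
run past the moment at which some message has been crossing an edge for one time unit. The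
environment may be inactive only if no message is waiting for delivery. -/
def Allowed (c : P.Config V) : Option (ℝ × Action V) → Prop
  | none => (∃ v, c.node v ≠ none) ∧ ∀ u w, c.queue u w = []
  | some (t, a) =>
    c.now ≤ t ∧ ((∀ v, c.node v = none) → t = 0) ∧
    (∀ u w, c.queue u w ≠ [] → t ≤ c.since u w + 1) ∧
    match a with
    | .wake v => c.node v = none
    | .deliver u w => c.queue u w ≠ []

/-- An adaptive adversary chooses its next action on the basis of all earlier configurations (latest
first) and of the current configuration, hence of all coins that have been flipped so far. -/
abbrev Adversary (P : Protocol) (V : Type) : Type :=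
  List (P.Config V) → P.Config V → Option (ℝ × Action V)

/-- The first `k` configurations of the execution (latest first), and the one after `k` steps. -/
def trace (adv : Adversary P V) (ω : P.Coins V) : ℕ → List (P.Config V) × P.Config V
  | 0 => ([], P.start V)
  | k + 1 =>
    let h := trace adv ω k
    (h.2 :: h.1, step G port ω h.2 (adv h.1 h.2))

/-- The configuration after `k` steps. -/
def config (adv : Adversary P V) (ω : P.Coins V) (k : ℕ) : P.Config V :=
  (trace G port adv ω k).2

/-- The adversary respects the rules, whatever the coins are. -/
def Adversary.IsLegal (adv : Adversary P V) : Prop :=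
  ∀ (ω : P.Coins V) (k : ℕ),
    Allowed (config G port adv ω k) (adv (trace G port adv ω k).1 (trace G port adv ω k).2)

/-- All nodes have terminated, exactly one of them, `v`, is elected, and all nodes know the identity
of `v`, which is the identity of no other node. -/
def LeaderElected (c : P.Config V) : Prop :=
  ∃ (v : V) (x : P.Node), c.node v = some x ∧ P.output x.state = some (true, x.ident) ∧
    ∀ u, u ≠ v → ∃ y : P.Node, c.node u = some y ∧ y.ident ≠ x.ident ∧
      P.output y.state = some (false, x.ident)

/-- All nodes terminate, at time at most `T`, with a leader elected. -/
def SolvesWithin (adv : Adversary P V) (ω : P.Coins V) (T : ℝ) : Prop :=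
  ∃ k, LeaderElected (config G port adv ω k) ∧ (config G port adv ω k).now ≤ T

/-- At most `B` messages are sent in the whole execution. -/
def SendsAtMost (adv : Adversary P V) (ω : P.Coins V) (B : ℝ) : Prop :=
  ∀ k, ((config G port adv ω k).sent : ℝ) ≤ B

end Execution

end Protocol

/-!
Every node keeps a log of facts and forwards each new fact exactly once, in log order, over each of
its edges; the coins a node flips on waking are its label, and a lucky label makes it a candidate.
A node hearing of a candidate becomes, with small probability, a witness for it. A candidate with
sufficiently many witnesses announces how many candidates it knew at that moment, and once all
candidates known to a node have announced, the one with the smallest count is elected.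

If two candidates finish unaware of each other, then their witnesses come from two disjoint sets of
draws. One of these sets comprises at most half of the nodes, but contains about three quarters of
the hits expected from all nodes together, which is unlikely. So of any two finished candidates one
knew of the other, and the one with the smallest count is known to all who decide. The adversary
chooses the order of the draws adaptively; the exponential supermartingale that bounds the tails
does not depend on this order.

The log has `O(log² n)` entries, so at most `O(m log² n)` messages are sent. Since the edges are
FIFO, a fact spreads through the network in time `O(D log² n)`, and constantly many such floodings
lead to the election.
-/

section Lists

/-- `g` occurs in the list `l` before the first occurrence of `f`. -/
def Precedes {α : Type*} [DecidableEq α] (l : List α) (g f : α) : Prop :=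
  f ∈ l ∧ l.idxOf g < l.idxOf f

namespace Precedes

variable {α : Type*} [DecidableEq α] {l e p : List α} {f g h : α}

theorem mem_left (H : Precedes l g f) : g ∈ l :=
  List.idxOf_lt_length_iff.1 (H.2.trans (List.idxOf_lt_length_iff.2 H.1))

theorem trans (H : Precedes l h g) (H' : Precedes l g f) : Precedes l h f :=
  ⟨H'.1, H.2.trans H'.2⟩

theorem irrefl : ¬ Precedes l f f := fun H => lt_irrefl _ H.2

theorem append_of_mem (hf : f ∈ l) : Precedes (l ++ e) g f ↔ Precedes l g f := by
  have hlt := List.idxOf_lt_length_iff.2 hf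
  by_cases hg : g ∈ l
  · simp [Precedes, hf, List.idxOf_append_of_mem hf, List.idxOf_append_of_mem hg]
  · simp only [Precedes, List.mem_append, hf, true_or, true_and, List.idxOf_append_of_mem hf,
      List.idxOf_append_of_notMem hg, List.idxOf_eq_length hg]
    omega

theorem append_cons_self (hf : f ∉ l) : Precedes (l ++ f :: e) g f ↔ g ∈ l := by
  by_cases hg : g ∈ l
  · simp [Precedes, hg, List.idxOf_append_of_notMem hf, List.idxOf_append_of_mem hg,
      List.idxOf_lt_length_iff.2 hg]
  · simp [Precedes, hg, List.idxOf_append_of_notMem hf, List.idxOf_append_of_notMem hg]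

theorem append_singleton (hf : f ∉ l) :
    Precedes (l ++ [f]) g h ↔ Precedes l g h ∨ (h = f ∧ g ∈ l) := by
  by_cases hh : h ∈ l
  · have hne : h ≠ f := ne_of_mem_of_not_mem hh hf
    simp [append_of_mem hh, hne]
  · obtain rfl | hne := eq_or_ne h f
    · rw [append_cons_self hf]
      simp [Precedes, hf]
    · simp [Precedes, hh, hne]

theorem mem_of_append_cons {q : List α} (H : Precedes (p ++ f :: q) g f) : g ∈ p := by
  by_contra hg
  have hle : (p ++ f :: q).idxOf f ≤ p.length := by
    by_cases hf : f ∈ p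
    · exact (List.idxOf_append_of_mem hf).trans_le (List.idxOf_lt_length_iff.2 hf).le
    · simp [List.idxOf_append_of_notMem hf]
  have hge : p.length ≤ (p ++ f :: q).idxOf g := by
    rw [List.idxOf_append_of_notMem hg]
    omega
  exact absurd H.2 (by omega)

end Precedes

end Lists

/-! ### Adaptive sampling with fair coins -/

open scoped ENNReal

section FairCoins

variable {ι : Type*}

/-- Independent fair coins indexed by `ι`. -/
noncomputable def fairCoins (ι : Type*) : Measure (ι → Bool) :=
  Measure.infinitePi fun _ => (PMF.uniformOfFintype Bool).toMeasure

instance : IsProbabilityMeasure (fairCoins ι) := by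
  unfold fairCoins
  infer_instance

theorem measurable_of_dependsOn {β : Type*} [MeasurableSpace β] {f : (ι → Bool) → β}
    {S : Finset ι} (h : DependsOn f S) : Measurable f := by
  have : Nonempty β := ⟨f fun _ => true⟩
  obtain ⟨g, rfl⟩ := dependsOn_iff_exists_comp.1 h
  exact (measurable_of_countable g).comp (Finset.measurable_restrict S)

theorem measurableSet_of_dependsOn {A : Set (ι → Bool)} {S : Finset ι}
    (h : DependsOn (· ∈ A) S) : MeasurableSet A :=
  measurableSet_setOfPred.2 (measurable_of_dependsOn h)

/-- The event that the coins in `S` show the values given by `f`. -/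
def Shows (S : Finset ι) (f : ι → Bool) : Set (ι → Bool) := {ω | ∀ i ∈ S, ω i = f i}

theorem dependsOn_shows (S : Finset ι) (f : ι → Bool) : DependsOn (· ∈ Shows S f) S :=
  fun _ _ h => propext (forall₂_congr fun i hi => by rw [h i hi])

theorem measurableSet_shows (S : Finset ι) (f : ι → Bool) : MeasurableSet (Shows S f) :=
  measurableSet_of_dependsOn (dependsOn_shows S f)

theorem fairCoins_shows (S : Finset ι) (f : ι → Bool) :
    fairCoins ι (Shows S f) = 2⁻¹ ^ S.card := by
  have hpi : Shows S f = Set.pi S fun i => {f i} := by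
    ext ω
    simp [Shows]
  have hcoin (b : Bool) : (PMF.uniformOfFintype Bool).toMeasure {b} = 2⁻¹ := by
    simp [PMF.toMeasure_apply_singleton _ _ (measurableSet_singleton b)]
  rw [hpi, fairCoins, Measure.infinitePi_pi _ fun _ _ => measurableSet_singleton _]
  simp [hcoin]

theorem iIndepFun_fairCoins :
    ProbabilityTheory.iIndepFun (fun i (ω : ι → Bool) => ω i) (fairCoins ι) :=
  ProbabilityTheory.iIndepFun_infinitePi (fun _ => measurable_id)

theorem fairCoins_inter_shows {A : Set (ι → Bool)} {S B : Finset ι} (hA : DependsOn (· ∈ A) S)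
    (hB : Disjoint S B) (f : ι → Bool) :
    fairCoins ι (A ∩ Shows B f) = fairCoins ι A * 2⁻¹ ^ B.card := by
  have hAS : S.restrict ⁻¹' (S.restrict '' A) = A :=
    Set.Subset.antisymm (fun _ ⟨_, hω, h⟩ => (hA fun i hi => congrFun h ⟨i, hi⟩).mp hω)
      (Set.subset_preimage_image _ _)
  have hfB : B.restrict ⁻¹' ({B.restrict f} : Set (B → Bool)) = Shows B f := by
    ext ω
    simp [Shows, funext_iff]
  have hind := iIndepFun_fairCoins.indepFun_finset S B hB fun i => measurable_pi_apply i
  rw [← fairCoins_shows B f, ← hAS, ← hfB]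
  exact hind.measure_inter_preimage_eq_mul _ _ (Set.toFinite _).measurableSet
    (Set.toFinite _).measurableSet

theorem fairCoins_diff_shows {A : Set (ι → Bool)} {S B : Finset ι} (hA : DependsOn (· ∈ A) S)
    (hB : Disjoint S B) (f : ι → Bool) :
    fairCoins ι (A \ Shows B f) = fairCoins ι A * (1 - 2⁻¹ ^ B.card) := by
  rw [← Set.sdiff_self_inter, measure_sdiff Set.inter_subset_left
    ((measurableSet_of_dependsOn hA).inter (measurableSet_shows B f)).nullMeasurableSet
    (measure_ne_top _ _), fairCoins_inter_shows hA hB,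
    ENNReal.mul_sub fun _ _ => measure_ne_top _ _, mul_one]

end FairCoins

theorem measure_exists_le_card_mul {Ω α : Type*} [MeasurableSpace Ω] (μ : Measure Ω) [Fintype α]
    {p : α → Ω → Prop} {b : ℝ≥0∞} (h : ∀ a, μ {x | p a x} ≤ b) :
    μ {x | ∃ a, p a x} ≤ Fintype.card α * b := by
  rw [Set.ofPred_exists]
  refine (measure_iUnion_fintype_le μ _).trans ((Finset.sum_le_sum fun a _ => h a).trans_eq ?_)
  rw [Finset.sum_const, nsmul_eq_mul, Finset.card_univ]

theorem measure_exists_le_of_forall_succ {Ω : Type*} [MeasurableSpace Ω] (μ : Measure Ω)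
    {p : ℕ → Ω → Prop} (hp : ∀ k x, p k x → p (k + 1) x) {b : ℝ≥0∞}
    (h : ∀ k, μ {x | p k x} ≤ b) : μ {x | ∃ k, p k x} ≤ b := by
  have hmono : Monotone fun k => {x | p k x} := monotone_nat_of_le_succ hp
  rw [Set.ofPred_exists, hmono.measure_iUnion]
  exact iSup_le h

theorem lintegral_le_lintegral_of_fibers {Ω H : Type*} [MeasurableSpace Ω] (μ : Measure Ω)
    {φ : Ω → H} (hfin : (Set.range φ).Finite) (hmeas : ∀ h, MeasurableSet (φ ⁻¹' {h}))
    {f g : Ω → ℝ≥0∞}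
    (hle : ∀ x, ∫⁻ y in φ ⁻¹' {φ x}, f y ∂μ ≤ ∫⁻ y in φ ⁻¹' {φ x}, g y ∂μ) :
    ∫⁻ y, f y ∂μ ≤ ∫⁻ y, g y ∂μ := by
  have huniv : (Set.univ : Set Ω) = ⋃ h ∈ hfin.toFinset, φ ⁻¹' {h} := by
    ext y
    simp
  have hdisj : Set.PairwiseDisjoint (hfin.toFinset : Set H) fun h => φ ⁻¹' {h} :=
    fun _ _ _ _ hne => (Set.disjoint_singleton.2 hne).preimage φ
  rw [← setLIntegral_univ f, ← setLIntegral_univ g, huniv,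
    lintegral_biUnion_finset hdisj fun h _ => hmeas h,
    lintegral_biUnion_finset hdisj fun h _ => hmeas h]
  refine Finset.sum_le_sum fun h hh => ?_
  obtain ⟨x, rfl⟩ := hfin.mem_toFinset.1 hh
  exact hle x

theorem two_inv_pow_eq_ofReal (t : ℕ) : (2⁻¹ : ℝ≥0∞) ^ t = ENNReal.ofReal (2⁻¹ ^ t) := by
  rw [ENNReal.ofReal_pow (by norm_num), ENNReal.ofReal_inv_of_pos two_pos, ENNReal.ofReal_ofNat]

/-- Coins are flipped in an order that may depend on earlier outcomes: `hist k` is what is known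
after `k` steps, and is determined by the coins `seen k`. In each step, at most one set of `t` new
coins, `ask k`, is inspected, which is a hit if all of them show heads; `tries k` and `hits k`
count the inspections and the hits, provided that the event `good` occurs. -/
structure AdaptiveSampling (ι H : Type*) (t : ℕ) where
  hist : ℕ → (ι → Bool) → H
  bound : ℕ → Finset ι
  dependsOn_hist : ∀ k, DependsOn (hist k) (bound k)
  seen : ℕ → (ι → Bool) → Finset ι
  hist_eq_of_seen : ∀ k ω ω', (∀ i ∈ seen k ω, ω i = ω' i) → hist k ω' = hist k ω
  seen_congr : ∀ k, (seen k).FactorsThrough (hist k)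
  ask : ℕ → (ι → Bool) → Option (Finset ι)
  ask_congr : ∀ k, (ask k).FactorsThrough (hist k)
  disjoint_ask : ∀ k ω B, ask k ω = some B → Disjoint (seen k ω) B
  card_ask : ∀ k ω B, ask k ω = some B → B.card = t
  good : Set (ι → Bool)
  good_congr : ∀ k, Function.FactorsThrough (· ∈ good) (hist k)
  tries : ℕ → (ι → Bool) → ℕ
  tries_congr : ∀ k, (tries k).FactorsThrough (hist k)
  hits : ℕ → (ι → Bool) → ℕ
  hits_congr : ∀ k, (hits k).FactorsThrough (hist k)
  tries_zero : ∀ ω, tries 0 ω = 0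
  hits_zero : ∀ ω, hits 0 ω = 0
  tries_of_idle : ∀ k ω, ω ∈ good → ask k ω = none → tries (k + 1) ω = tries k ω
  hits_of_idle : ∀ k ω, ω ∈ good → ask k ω = none → hits (k + 1) ω = hits k ω
  tries_of_ask : ∀ k ω B, ω ∈ good → ask k ω = some B → tries (k + 1) ω = tries k ω + 1
  hits_of_heads : ∀ k ω B, ω ∈ good → ask k ω = some B → ω ∈ Shows B (fun _ => true) →
    hits (k + 1) ω = hits k ω + 1
  hits_of_not_heads : ∀ k ω B, ω ∈ good → ask k ω = some B → ω ∉ Shows B (fun _ => true) →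
    hits (k + 1) ω = hits k ω

namespace AdaptiveSampling

variable {ι H : Type*} {t : ℕ} (X : AdaptiveSampling ι H t)

theorem tries_and_hits_succ {ω : ι → Bool} (hω : ω ∈ X.good) (k : ℕ) :
    (X.tries (k + 1) ω = X.tries k ω ∧ X.hits (k + 1) ω = X.hits k ω) ∨
      (X.tries (k + 1) ω = X.tries k ω + 1 ∧ X.hits k ω ≤ X.hits (k + 1) ω) := by
  cases hask : X.ask k ω with
  | none => exact Or.inl ⟨X.tries_of_idle k ω hω hask, X.hits_of_idle k ω hω hask⟩
  | some B =>
    refine Or.inr ⟨X.tries_of_ask k ω B hω hask, ?_⟩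
    by_cases hB : ω ∈ Shows B (fun _ => true)
    · exact (Nat.le_succ _).trans_eq (X.hits_of_heads k ω B hω hask hB).symm
    · exact (X.hits_of_not_heads k ω B hω hask hB).ge

theorem hits_mono {ω : ι → Bool} (hω : ω ∈ X.good) : Monotone fun k => X.hits k ω :=
  monotone_nat_of_le_succ fun k => by
    rcases X.tries_and_hits_succ hω k with h | h
    · exact h.2.ge
    · exact h.2

/-- The mean of `a ^ h`, where `h` is `1` if `t` fair coins all show heads and `0` otherwise. -/
noncomputable def mean (t : ℕ) (a : ℝ) : ℝ := 1 + 2⁻¹ ^ t * (a - 1)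

theorem two_inv_pow_le_one (t : ℕ) : (2⁻¹ : ℝ) ^ t ≤ 1 :=
  pow_le_one₀ (by norm_num) (by norm_num)

theorem mean_pos (t : ℕ) {a : ℝ} (ha : 0 < a) : 0 < mean t a := by
  have hpos : (0 : ℝ) < 2⁻¹ ^ t := by positivity
  rw [mean]
  nlinarith [mul_pos hpos ha, two_inv_pow_le_one t]

theorem mean_le_exp (t : ℕ) (a : ℝ) : mean t a ≤ Real.exp (2⁻¹ ^ t * (a - 1)) := by
  rw [mean, add_comm]
  exact Real.add_one_le_exp _

theorem mean_split (t : ℕ) {a : ℝ} (ha : 0 < a) :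
    ENNReal.ofReal (a / mean t a) * 2⁻¹ ^ t + ENNReal.ofReal (mean t a)⁻¹ * (1 - 2⁻¹ ^ t) = 1 := by
  have hg := mean_pos t ha
  have hreal : a / mean t a * 2⁻¹ ^ t + (mean t a)⁻¹ * (1 - 2⁻¹ ^ t) = 1 := by
    field_simp
    rw [mean]
    ring
  have hq' : (0 : ℝ) ≤ 1 - 2⁻¹ ^ t := sub_nonneg.2 (two_inv_pow_le_one t)
  rw [two_inv_pow_eq_ofReal, ← ENNReal.ofReal_one, ← ENNReal.ofReal_sub _ (by positivity),
    ← ENNReal.ofReal_mul (by positivity), ← ENNReal.ofReal_mul (by positivity),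
    ← ENNReal.ofReal_add (by positivity) (by positivity), hreal]

open Classical in
/-- The exponential weight of the outcome of `k` steps, a supermartingale in `k`. -/
noncomputable def weight (a : ℝ) (k : ℕ) (ω : ι → Bool) : ℝ≥0∞ :=
  if ω ∈ X.good then ENNReal.ofReal (a ^ X.hits k ω * (mean t a)⁻¹ ^ X.tries k ω) else 0

variable {X} in
theorem weight_of_good {ω : ι → Bool} (hω : ω ∈ X.good) (a : ℝ) (k : ℕ) :
    X.weight a k ω = ENNReal.ofReal (a ^ X.hits k ω * (mean t a)⁻¹ ^ X.tries k ω) :=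
  if_pos hω

theorem weight_congr (a : ℝ) (k : ℕ) : (X.weight a k).FactorsThrough (X.hist k) :=
  fun ω ω' h => by
    have hgood : ω ∈ X.good ↔ ω' ∈ X.good := iff_of_eq (X.good_congr k h)
    by_cases hω : ω ∈ X.good
    · rw [weight_of_good hω, weight_of_good (hgood.1 hω), X.hits_congr k h, X.tries_congr k h]
    · simp only [weight, if_neg hω, if_neg (hgood.not.1 hω)]

theorem measurable_weight (a : ℝ) (k : ℕ) : Measurable (X.weight a k) :=
  measurable_of_dependsOn (S := X.bound k) fun _ _ h => X.weight_congr a k (X.dependsOn_hist k h)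

theorem weight_zero_le (a : ℝ) (ω : ι → Bool) : X.weight a 0 ω ≤ 1 := by
  rw [weight, X.tries_zero, X.hits_zero]
  split_ifs <;> simp

theorem weight_succ_of_idle (a : ℝ) {k : ℕ} {ω : ι → Bool} (hask : X.ask k ω = none) :
    X.weight a (k + 1) ω = X.weight a k ω := by
  by_cases hω : ω ∈ X.good
  · simp only [weight, X.tries_of_idle k ω hω hask, X.hits_of_idle k ω hω hask]
  · simp only [weight, if_neg hω]

theorem weight_succ_of_heads {a : ℝ} (ha : 0 < a) {k : ℕ} {ω : ι → Bool} {B : Finset ι}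
    (hask : X.ask k ω = some B) (hB : ω ∈ Shows B fun _ => true) :
    X.weight a (k + 1) ω = X.weight a k ω * ENNReal.ofReal (a / mean t a) := by
  by_cases hω : ω ∈ X.good
  · have hg := mean_pos t ha
    rw [weight_of_good hω, weight_of_good hω, ← ENNReal.ofReal_mul (by positivity),
      X.tries_of_ask k ω B hω hask, X.hits_of_heads k ω B hω hask hB]
    ring_nf
  · simp only [weight, if_neg hω, zero_mul]

theorem weight_succ_of_not_heads {a : ℝ} (ha : 0 < a) {k : ℕ} {ω : ι → Bool} {B : Finset ι}
    (hask : X.ask k ω = some B) (hB : ω ∉ Shows B fun _ => true) :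
    X.weight a (k + 1) ω = X.weight a k ω * ENNReal.ofReal (mean t a)⁻¹ := by
  by_cases hω : ω ∈ X.good
  · have hg := mean_pos t ha
    rw [weight_of_good hω, weight_of_good hω, ← ENNReal.ofReal_mul (by positivity),
      X.tries_of_ask k ω B hω hask, X.hits_of_not_heads k ω B hω hask hB]
    ring_nf
  · simp only [weight, if_neg hω, zero_mul]

theorem finite_range_hist (k : ℕ) : (Set.range (X.hist k)).Finite := by
  classical
  have hsub : Set.range (X.hist k) ⊆ Set.range fun a : X.bound k → Bool =>
      X.hist k fun i => if h : i ∈ X.bound k then a ⟨i, h⟩ else true := by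
    rintro _ ⟨ω, rfl⟩
    refine ⟨fun i => ω i, X.dependsOn_hist k fun i hi => ?_⟩
    simp [Finset.mem_coe.1 hi]
  exact (Set.finite_range _).subset hsub

theorem measurableSet_hist (k : ℕ) (h : H) : MeasurableSet (X.hist k ⁻¹' {h}) :=
  measurableSet_of_dependsOn (S := X.bound k) fun _ _ hω =>
    congrArg (· = h) (X.dependsOn_hist k hω)

theorem dependsOn_hist_eq (k : ℕ) (ω₀ : ι → Bool) :
    DependsOn (· ∈ X.hist k ⁻¹' {X.hist k ω₀}) (X.seen k ω₀) := by
  have hmem {ω ω' : ι → Bool} (h : ∀ i ∈ X.seen k ω₀, ω i = ω' i)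
      (hω : X.hist k ω = X.hist k ω₀) : X.hist k ω' = X.hist k ω₀ := by
    rw [← X.seen_congr k hω] at h
    exact (X.hist_eq_of_seen k ω ω' h).trans hω
  exact fun ω ω' h => propext ⟨hmem h, hmem fun i hi => (h i hi).symm⟩

theorem setLIntegral_weight_succ (k : ℕ) {a : ℝ} (ha : 0 < a) (ω₀ : ι → Bool) :
    ∫⁻ ω in X.hist k ⁻¹' {X.hist k ω₀}, X.weight a (k + 1) ω ∂fairCoins ι =
      ∫⁻ ω in X.hist k ⁻¹' {X.hist k ω₀}, X.weight a k ω ∂fairCoins ι := by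
  set A := X.hist k ⁻¹' {X.hist k ω₀}
  have hA : MeasurableSet A := X.measurableSet_hist k _
  have hask {ω} (hω : ω ∈ A) : X.ask k ω = X.ask k ω₀ := X.ask_congr k hω
  have hconst {ω} (hω : ω ∈ A) : X.weight a k ω = X.weight a k ω₀ := X.weight_congr a k hω
  cases hask₀ : X.ask k ω₀ with
  | none =>
    exact setLIntegral_congr_fun hA fun ω hω =>
      X.weight_succ_of_idle a ((hask hω).trans hask₀)
  | some B =>
    set E := Shows B fun _ => true
    have hE : MeasurableSet E := measurableSet_shows B _
    have hheads : ∀ ω ∈ A ∩ E, X.weight a (k + 1) ω =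
        X.weight a k ω₀ * ENNReal.ofReal (a / mean t a) := fun ω hω => by
      rw [X.weight_succ_of_heads ha ((hask hω.1).trans hask₀) hω.2, hconst hω.1]
    have hnot : ∀ ω ∈ A \ E, X.weight a (k + 1) ω =
        X.weight a k ω₀ * ENNReal.ofReal (mean t a)⁻¹ := fun ω hω => by
      rw [X.weight_succ_of_not_heads ha ((hask hω.1).trans hask₀) hω.2, hconst hω.1]
    have hdisj := X.disjoint_ask k ω₀ B hask₀
    rw [setLIntegral_congr_fun hA fun ω hω => hconst hω, setLIntegral_const,
      ← lintegral_inter_add_sdiff _ A hE, setLIntegral_congr_fun (hA.inter hE) hheads,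
      setLIntegral_congr_fun (hA.diff hE) hnot, setLIntegral_const, setLIntegral_const,
      fairCoins_inter_shows (X.dependsOn_hist_eq k ω₀) hdisj,
      fairCoins_diff_shows (X.dependsOn_hist_eq k ω₀) hdisj, X.card_ask k ω₀ B hask₀]
    calc _ = X.weight a k ω₀ * fairCoins ι A * (ENNReal.ofReal (a / mean t a) * 2⁻¹ ^ t +
          ENNReal.ofReal (mean t a)⁻¹ * (1 - 2⁻¹ ^ t)) := by ring
      _ = _ := by rw [mean_split t ha, mul_one]

theorem lintegral_weight_le_one {a : ℝ} (ha : 0 < a) (k : ℕ) :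
    ∫⁻ ω, X.weight a k ω ∂fairCoins ι ≤ 1 := by
  induction k with
  | zero => exact (lintegral_mono (X.weight_zero_le a)).trans_eq (by simp)
  | succ k ih =>
    exact (lintegral_le_lintegral_of_fibers _ (X.finite_range_hist k) (X.measurableSet_hist k)
      fun ω => (X.setLIntegral_weight_succ k ha ω).le).trans ih

theorem exp_le_weight {a : ℝ} (ha : 0 < a) {k : ℕ} {ω : ι → Bool} (hω : ω ∈ X.good) :
    ENNReal.ofReal (Real.exp (Real.log a * X.hits k ω - 2⁻¹ ^ t * (a - 1) * X.tries k ω)) ≤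
      X.weight a k ω := by
  have hexp : Real.exp (Real.log a * X.hits k ω - 2⁻¹ ^ t * (a - 1) * X.tries k ω) =
      a ^ X.hits k ω * (Real.exp (2⁻¹ ^ t * (a - 1)))⁻¹ ^ X.tries k ω := by
    rw [sub_eq_add_neg, Real.exp_add, mul_comm (Real.log a), Real.exp_nat_mul, Real.exp_log ha,
      Real.exp_neg, mul_comm _ (X.tries k ω : ℝ), Real.exp_nat_mul, inv_pow (Real.exp _)]
  have := mean_pos t ha
  have := mean_le_exp t a
  rw [weight_of_good hω, hexp]
  gcongr

theorem measure_le_exp_neg {a : ℝ} (ha : 0 < a) (δ : ℝ) (k : ℕ) :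
    fairCoins ι (X.good ∩ {ω | δ ≤ Real.log a * X.hits k ω -
      2⁻¹ ^ t * (a - 1) * X.tries k ω}) ≤ ENNReal.ofReal (Real.exp (-δ)) := by
  have hsub : X.good ∩ {ω | δ ≤ Real.log a * X.hits k ω - 2⁻¹ ^ t * (a - 1) * X.tries k ω} ⊆
      {ω | ENNReal.ofReal (Real.exp δ) ≤ X.weight a k ω} := fun ω ⟨hgood, hδ⟩ =>
    (ENNReal.ofReal_le_ofReal (Real.exp_le_exp.2 hδ)).trans (X.exp_le_weight ha hgood)
  have hpos : ENNReal.ofReal (Real.exp δ) ≠ 0 := by simp [Real.exp_pos]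
  calc fairCoins ι _ ≤ fairCoins ι {ω | ENNReal.ofReal (Real.exp δ) ≤ X.weight a k ω} :=
        measure_mono hsub
    _ ≤ (∫⁻ ω, X.weight a k ω ∂fairCoins ι) / ENNReal.ofReal (Real.exp δ) :=
        meas_ge_le_lintegral_div (X.measurable_weight a k).aemeasurable hpos ENNReal.ofReal_ne_top
    _ ≤ 1 / ENNReal.ofReal (Real.exp δ) := by gcongr; exact X.lintegral_weight_le_one ha k
    _ = ENNReal.ofReal (Real.exp (-δ)) := by
        rw [one_div, Real.exp_neg, ENNReal.ofReal_inv_of_pos (Real.exp_pos δ)]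

end AdaptiveSampling

namespace AdaptiveSampling

variable {ι : Type*} {t : ℕ} {l : List (Finset ι)}

open Classical in
/-- The blocks of coins in the list `l` are inspected one after the other. -/
noncomputable def ofList (l : List (Finset ι)) (hcard : ∀ B ∈ l, B.card = t)
    (hdisj : l.Pairwise Disjoint) : AdaptiveSampling ι (ι → Bool) t where
  hist k ω i := if ∃ B ∈ l.take k, i ∈ B then ω i else true
  bound k := (l.take k).toFinset.biUnion id
  dependsOn_hist k ω ω' h := funext fun i => by
    dsimp only
    split_ifs with hi
    · exact h i (by simpa using hi)
    · rfl
  seen k _ := (l.take k).toFinset.biUnion id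
  hist_eq_of_seen k ω ω' h := funext fun i => by
    split_ifs with hi
    · exact (h i (by simpa using hi)).symm
    · rfl
  seen_congr _ _ _ _ := rfl
  ask k _ := l[k]?
  ask_congr _ _ _ _ := rfl
  disjoint_ask k _ B hB := by
    obtain ⟨hk, rfl⟩ := List.getElem?_eq_some_iff.1 hB
    rw [Finset.disjoint_biUnion_left]
    intro A hA
    obtain ⟨j, hj, rfl⟩ := List.mem_take_iff_getElem.1 (List.mem_toFinset.1 hA)
    exact List.pairwise_iff_getElem.1 hdisj _ _ _ _ (lt_min_iff.1 hj).1
  card_ask k _ B hB := hcard B (List.mem_of_getElem? hB)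
  good := Set.univ
  good_congr _ _ _ _ := rfl
  tries k _ := (l.take k).length
  tries_congr _ _ _ _ := rfl
  hits k ω := (l.take k).countP fun B => ω ∈ Shows B fun _ => true
  hits_congr k ω ω' h := List.countP_congr fun B hB => by
    simp only [decide_eq_true_eq]
    refine forall₂_congr fun i hi => ?_
    have hi' : ∃ B ∈ l.take k, i ∈ B := ⟨B, hB, hi⟩
    have heq : ω i = ω' i := by simpa only [if_pos hi'] using congrFun h i
    rw [heq]
  tries_zero _ := by simp
  hits_zero _ := by simp
  tries_of_idle k _ _ h := by rw [List.take_add_one, h, Option.toList_none, List.append_nil]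
  hits_of_idle k _ _ h := by rw [List.take_add_one, h, Option.toList_none, List.append_nil]
  tries_of_ask k _ B _ h := by rw [List.take_add_one, h]; simp
  hits_of_heads k _ B _ h hB := by rw [List.take_add_one, h]; simp [hB]
  hits_of_not_heads k _ B _ h hB := by rw [List.take_add_one, h]; simp [hB]

end AdaptiveSampling

open Classical in
theorem fairCoins_card_heads_le_exp_neg {ι κ : Type*} [Fintype κ] {t : ℕ} {B : κ → Finset ι}
    (hcard : ∀ x, (B x).card = t) (hdisj : Pairwise fun x y => Disjoint (B x) (B y)) {a : ℝ}
    (ha : 0 < a) (δ : ℝ) :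
    fairCoins ι {ω | δ ≤ Real.log a *
        (Finset.univ.filter fun x => ω ∈ Shows (B x) fun _ => true).card -
        2⁻¹ ^ t * (a - 1) * Fintype.card κ} ≤ ENNReal.ofReal (Real.exp (-δ)) := by
  let l := (Finset.univ : Finset κ).toList.map B
  have hl : l.Pairwise Disjoint :=
    List.pairwise_map.2 ((Finset.nodup_toList _).imp fun hxy => hdisj hxy)
  let X := AdaptiveSampling.ofList (t := t) l (by simp [l, hcard]) hl
  have hlen : l.length = Fintype.card κ := by simp [l]
  have htries (ω) : X.tries l.length ω = Fintype.card κ := by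
    simp [X, AdaptiveSampling.ofList, hlen]
  have hhits (ω) : X.hits l.length ω =
      (Finset.univ.filter fun x => ω ∈ Shows (B x) fun _ => true).card := by
    simp only [X, AdaptiveSampling.ofList, List.take_length, l, List.countP_map]
    conv_rhs => rw [← Finset.toList_toFinset Finset.univ]
    exact (List.Nodup.card_eq_countP (Finset.nodup_toList _)).symm
  have hgood : X.good = Set.univ := rfl
  simpa only [htries, hhits, hgood, Set.univ_inter] using X.measure_le_exp_neg ha δ l.length

/-! ### The gossip protocol -/

namespace Gossip

open Protocol

/-- The label of a node: the coins flipped on waking up. -/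
abbrev Label (T : ℕ) : Type := Fin T → Bool

/-- The facts that spread through the network: some node is awake; `x` is a candidate; `w` is a
witness for `x`; `x` has enough witnesses, and knew `s` candidates when that happened; `x` is
elected. -/
inductive Rumor (T : ℕ) : Type
  | hello
  | cand (x : Label T)
  | wit (x w : Label T)
  | done (x : Label T) (s : Fin (2 ^ T + 1))
  | elect (x : Label T)
  deriving DecidableEq

namespace Rumor

variable {T : ℕ}

/-- The label of the node that a fact originates from, if it can be read off from the fact. -/
def owner : Rumor T → Option (Label T)
  | hello => none
  | cand x => some x
  | wit _ w => some w
  | done x _ => some x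
  | elect _ => none

/-- A code for facts in a type of evident cardinality. -/
def code : Rumor T → Fin 5 × Label T × Label T × Fin (2 ^ T + 1)
  | hello => (0, fun _ => true, fun _ => true, 0)
  | cand x => (1, x, fun _ => true, 0)
  | wit x w => (2, x, w, 0)
  | done x s => (3, x, fun _ => true, s)
  | elect x => (4, x, fun _ => true, 0)

theorem code_injective : Function.Injective (code (T := T)) := by
  intro a b h
  cases a <;> cases b <;> simp_all [code]

noncomputable instance : Fintype (Rumor T) := Fintype.ofInjective code code_injective

theorem card_le : Fintype.card (Rumor T) ≤ 5 * (2 ^ T * (2 ^ T * (2 ^ T + 1))) :=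
  (Fintype.card_le_of_injective code code_injective).trans_eq (by simp)

end Rumor

/-- A block of coins is lucky if its first `t` coins are all heads. -/
def Lucky {T : ℕ} (t : ℕ) (b : Label T) : Prop := ∀ i : Fin T, i.val < t → b i = true

section Rules

variable {T : ℕ}

open Classical in
/-- The candidates known from the log `l`. -/
noncomputable def cands (l : List (Rumor T)) : Finset (Label T) :=
  Finset.univ.filter fun x => Rumor.cand x ∈ l

open Classical in
/-- The witnesses for `x` known from the log `l`. -/
noncomputable def wits (x : Label T) (l : List (Rumor T)) : Finset (Label T) :=
  Finset.univ.filter fun w => Rumor.wit x w ∈ l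

theorem mem_cands {x : Label T} {l : List (Rumor T)} : x ∈ cands l ↔ Rumor.cand x ∈ l := by
  simp [cands]

theorem mem_wits {x w : Label T} {l : List (Rumor T)} : w ∈ wits x l ↔ Rumor.wit x w ∈ l := by
  simp [wits]

theorem card_cands_lt (l : List (Rumor T)) : (cands l).card < 2 ^ T + 1 :=
  Nat.lt_succ_of_le ((Finset.card_le_univ _).trans (by simp))

/-- The number of candidates known from `l`. -/
noncomputable def candCount (l : List (Rumor T)) : Fin (2 ^ T + 1) :=
  ⟨(cands l).card, card_cands_lt l⟩

open Classical in
/-- The number of candidates that `x` has announced, according to `l` (`0` if there is no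
announcement). -/
noncomputable def announcedCount (l : List (Rumor T)) (x : Label T) : ℕ :=
  if h : ∃ s, Rumor.done x s ∈ l then h.choose.val else 0

/-- An element of `K` at which `σ` is minimal. The choice depends only on the set of all such
elements, so nodes with different `K` and `σ` but the same minimizers agree on it. -/
noncomputable def leaderOf (K : Finset (Label T)) (σ : Label T → ℕ) : Label T :=
  Classical.epsilon fun x => x ∈ K ∧ ∀ y ∈ K, σ x ≤ σ y

/-- The leader elected on the basis of the log `l`. -/
noncomputable def leader (l : List (Rumor T)) : Label T := leaderOf (cands l) (announcedCount l)

/-- According to the log `l`, no leader has been elected. -/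
def Undecided (l : List (Rumor T)) : Prop := ∀ x, Rumor.elect x ∉ l

/-- The condition under which the candidate `me` announces that it has collected `τ` witnesses. -/
def DoneRule (τ : ℕ) (me : Label T) (l : List (Rumor T)) : Prop :=
  Rumor.cand me ∈ l ∧ (∀ s, Rumor.done me s ∉ l) ∧ τ ≤ (wits me l).card

/-- The condition under which a node elects a leader: all candidates that it knows have made their
announcements. -/
def ElectRule (l : List (Rumor T)) : Prop :=
  Undecided l ∧ (∃ x, Rumor.cand x ∈ l) ∧ ∀ x, Rumor.cand x ∈ l → ∃ s, Rumor.done x s ∈ l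

open Classical in
/-- The log of a node that has just woken up and drawn the label `b`. -/
noncomputable def initLog (t : ℕ) (b : Label T) : List (Rumor T) :=
  (if Lucky t b then [Rumor.cand b] else []) ++ [Rumor.hello]

open Classical in
/-- On hearing of a candidate, the node `me` becomes a witness if its new coins `b` are lucky. -/
noncomputable def witNews (t : ℕ) (me b : Label T) : Rumor T → List (Rumor T)
  | .cand x => if Lucky t b then [Rumor.wit x me] else []
  | _ => []

open Classical in
/-- The announcement that the node `me` makes on the basis of the log `l`, if any. -/
noncomputable def doneNews (τ : ℕ) (me : Label T) (l : List (Rumor T)) : List (Rumor T) :=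
  if DoneRule τ me l then [Rumor.done me (candCount l)] else []

open Classical in
/-- The election that is carried out on the basis of the log `l`, if any. -/
noncomputable def electNews (l : List (Rumor T)) : List (Rumor T) :=
  if ElectRule l then [Rumor.elect (leader l)] else []

/-- What the node `me` adds to its log `l` when the new fact `f` arrives. -/
noncomputable def learnNews (t τ : ℕ) (me : Label T) (l : List (Rumor T)) (f : Rumor T)
    (b : Label T) : List (Rumor T) :=
  let e₁ := f :: witNews t me b f
  let e₂ := doneNews τ me (l ++ e₁)
  e₁ ++ e₂ ++ electNews (l ++ e₁ ++ e₂)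

/-- What the node `me` adds to its log `l` when the message `f` arrives. -/
noncomputable def news (t τ : ℕ) (me : Label T) (l : List (Rumor T)) (f : Rumor T)
    (b : Label T) : List (Rumor T) :=
  if f ∈ l then [] else learnNews t τ me l f b

end Rules

/-- The state of a node: its label and the facts it knows, in the order in which it learnt them. -/
structure GossipState (T : ℕ) where
  me : Label T
  log : List (Rumor T)

open Classical in
/-- The protocol: every node forwards every new fact once over each of its edges. The label of a
node has `T` coins, luck has probability `2⁻¹ ^ t`, and a candidate waits for `τ` witnesses. -/
noncomputable abbrev gossip (T t τ : ℕ) : Protocol where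
  Msg := Rumor T
  Ident := Label T
  State := GossipState T
  coins := T
  wake _ b := (b, ⟨b, initLog t b⟩, fun _ => initLog t b)
  receive _ s _ f b :=
    (⟨s.me, s.log ++ news t τ s.me s.log f b⟩, fun _ => news t τ s.me s.log f b)
  output s := if h : ∃ x, Rumor.elect x ∈ s.log then some (decide (h.choose = s.me), h.choose)
    else none

section Rules

variable {T t τ : ℕ} {me b : Label T} {l : List (Rumor T)} {f : Rumor T}

theorem doneNews_eq (τ : ℕ) (me : Label T) (l : List (Rumor T)) :
    (DoneRule τ me l ∧ doneNews τ me l = [.done me (candCount l)]) ∨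
      (¬ DoneRule τ me l ∧ doneNews τ me l = []) := by
  by_cases h : DoneRule τ me l <;> simp [doneNews, h]

theorem electNews_eq (l : List (Rumor T)) :
    (ElectRule l ∧ electNews l = [.elect (leader l)]) ∨ (¬ ElectRule l ∧ electNews l = []) := by
  by_cases h : ElectRule l <;> simp [electNews, h]

theorem witNews_eq (t : ℕ) (me b : Label T) (f : Rumor T) :
    (∃ x, f = .cand x ∧ Lucky t b ∧ witNews t me b f = [.wit x me]) ∨
      (witNews t me b f = [] ∧ ∀ x, f = .cand x → ¬ Lucky t b) := by
  by_cases h : Lucky t b <;> cases f <;> simp [witNews, h]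

theorem learnNews_eq_cons (t τ : ℕ) (me b : Label T) (l : List (Rumor T)) (f : Rumor T) :
    ∃ e, learnNews t τ me l f b = f :: e := ⟨_, rfl⟩

theorem news_of_mem (h : f ∈ l) : news t τ me l f b = [] := if_pos h

theorem news_of_notMem (h : f ∉ l) : news t τ me l f b = learnNews t τ me l f b := if_neg h

theorem mem_witNews {g : Rumor T} :
    g ∈ witNews t me b f ↔ ∃ x, f = .cand x ∧ Lucky t b ∧ g = .wit x me := by
  rcases witNews_eq t me b f with ⟨x, rfl, hb, he⟩ | ⟨he, hb⟩
  · simp [he, hb]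
  · simp only [he, List.not_mem_nil, false_iff]
    rintro ⟨x, hf, hb', -⟩
    exact hb x hf hb'

theorem exists_eq_done_of_mem_doneNews {g : Rumor T} (h : g ∈ doneNews τ me l) :
    ∃ s, g = .done me s := by
  rcases doneNews_eq τ me l with ⟨-, he⟩ | ⟨-, he⟩
  · exact ⟨_, List.mem_singleton.1 (he ▸ h)⟩
  · simp [he] at h

theorem exists_eq_elect_of_mem_electNews {g : Rumor T} (h : g ∈ electNews l) :
    ∃ x, g = .elect x := by
  rcases electNews_eq l with ⟨-, he⟩ | ⟨-, he⟩
  · exact ⟨_, List.mem_singleton.1 (he ▸ h)⟩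
  · simp [he] at h

theorem cand_mem_learnNews {x : Label T} :
    Rumor.cand x ∈ learnNews t τ me l f b ↔ f = .cand x := by
  have hdone {l' : List (Rumor T)} : Rumor.cand x ∉ doneNews τ me l' := fun h => by
    simpa using exists_eq_done_of_mem_doneNews h
  have helect {l' : List (Rumor T)} : Rumor.cand x ∉ electNews l' := fun h => by
    simpa using exists_eq_elect_of_mem_electNews h
  simp [learnNews, hdone, helect, mem_witNews, eq_comm]

theorem wit_mem_learnNews {x y : Label T} :
    Rumor.wit x y ∈ learnNews t τ me l f b ↔
      f = .wit x y ∨ (f = .cand x ∧ Lucky t b ∧ y = me) := by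
  have hdone {l' : List (Rumor T)} : Rumor.wit x y ∉ doneNews τ me l' := fun h => by
    simpa using exists_eq_done_of_mem_doneNews h
  have helect {l' : List (Rumor T)} : Rumor.wit x y ∉ electNews l' := fun h => by
    simpa using exists_eq_elect_of_mem_electNews h
  simp [learnNews, hdone, helect, mem_witNews, eq_comm]

theorem mem_initLog {g : Rumor T} :
    g ∈ initLog t b ↔ g = .hello ∨ (Lucky t b ∧ g = .cand b) := by
  by_cases h : Lucky t b <;> simp [initLog, h, or_comm]

/-- No rule is applicable to the log `l` of the node `me`. -/
def Settled (τ : ℕ) (me : Label T) (l : List (Rumor T)) : Prop := ¬ DoneRule τ me l ∧ ¬ ElectRule l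

theorem settled_initLog (hτ : 1 ≤ τ) (b : Label T) : Settled τ b (initLog t b) := by
  constructor
  · rintro ⟨-, -, hwits⟩
    obtain ⟨w, hw⟩ := Finset.card_pos.1 (hτ.trans hwits)
    simpa [mem_initLog] using mem_wits.1 hw
  · rintro ⟨-, ⟨x, hx⟩, hdone⟩
    obtain ⟨s, hs⟩ := hdone x hx
    simp [mem_initLog] at hs

theorem not_doneRule_append_doneNews : ¬ DoneRule τ me (l ++ doneNews τ me l) := by
  rcases doneNews_eq τ me l with ⟨-, he⟩ | ⟨hnot, he⟩
  · rintro ⟨-, hnone, -⟩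
    exact hnone (candCount l) (by simp [he])
  · rwa [he, List.append_nil]

theorem doneRule_append_electNews : DoneRule τ me (l ++ electNews l) ↔ DoneRule τ me l := by
  have hmem {g : Rumor T} (hg : ∀ x, g ≠ .elect x) : g ∈ l ++ electNews l ↔ g ∈ l := by
    refine List.mem_append.trans (or_iff_left fun h => ?_)
    obtain ⟨x, rfl⟩ := exists_eq_elect_of_mem_electNews h
    exact hg x rfl
  have hwits : wits me (l ++ electNews l) = wits me l := by
    ext w
    rw [mem_wits, mem_wits, hmem (by simp)]
  simp only [DoneRule, hwits, hmem (g := .cand me) (by simp),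
    fun s => hmem (g := .done me s) (by simp)]

theorem not_electRule_append_electNews : ¬ ElectRule (l ++ electNews l) := by
  rcases electNews_eq l with ⟨-, he⟩ | ⟨hnot, he⟩
  · exact fun h => h.1 (leader l) (by simp [he])
  · rwa [he, List.append_nil]

theorem settled_learn (me b : Label T) (l : List (Rumor T)) :
    Settled τ me (l ++ learnNews t τ me l f b) := by
  simp only [learnNews, ← List.append_assoc]
  exact ⟨doneRule_append_electNews.not.2 not_doneRule_append_doneNews,
    not_electRule_append_electNews⟩

end Rules

/-! ### Sound logs -/

section Sound

variable {V : Type*} {T : ℕ}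

section PushLog

variable [DecidableEq V] {L : V → List (Rumor T)} {v w : V} {e : List (Rumor T)}
  {f g h : Rumor T}

/-- The logs after the node `w` has added `e` to its log. -/
def pushLog (L : V → List (Rumor T)) (w : V) (e : List (Rumor T)) : V → List (Rumor T) :=
  Function.update L w (L w ++ e)

theorem pushLog_self (L : V → List (Rumor T)) (w : V) (e : List (Rumor T)) :
    pushLog L w e w = L w ++ e := by
  simp [pushLog]

theorem pushLog_of_ne (h : v ≠ w) (e : List (Rumor T)) : pushLog L w e v = L v := by
  simp [pushLog, h]

theorem pushLog_nil : pushLog L w [] = L := by simp [pushLog]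

theorem pushLog_pushLog (e e' : List (Rumor T)) :
    pushLog (pushLog L w e) w e' = pushLog L w (e ++ e') := by
  simp [pushLog]

theorem mem_pushLog : g ∈ pushLog L w e v ↔ g ∈ L v ∨ (v = w ∧ g ∈ e) := by
  by_cases h : v = w
  · simp [h, pushLog_self]
  · simp [h, pushLog_of_ne h]

theorem mem_pushLog_singleton : g ∈ pushLog L w [f] v ↔ g ∈ L v ∨ (v = w ∧ g = f) := by
  rw [mem_pushLog, List.mem_singleton]

theorem mem_pushLog_of_mem (hg : g ∈ L v) : g ∈ pushLog L w e v := mem_pushLog.2 (Or.inl hg)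

theorem precedes_pushLog_singleton (hf : f ∉ L w) :
    Precedes (pushLog L w [f] v) g h ↔ Precedes (L v) g h ∨ (v = w ∧ h = f ∧ g ∈ L w) := by
  by_cases hv : v = w
  · simp [hv, pushLog_self, Precedes.append_singleton hf]
  · simp [hv, pushLog_of_ne hv]

theorem precedes_pushLog_of_mem (hh : h ∈ L v) :
    Precedes (pushLog L w e v) g h ↔ Precedes (L v) g h := by
  by_cases hv : v = w
  · subst hv
    rw [pushLog_self, Precedes.append_of_mem hh]
  · rw [pushLog_of_ne hv]

end PushLog

/-- `K` is a set of candidates that have announced the counts `σ` and, when doing so, knew no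
candidate outside of `K`. -/
structure IsCertificate (lab : V → Label T) (L : V → List (Rumor T)) (K : Finset (Label T))
    (σ : Label T → ℕ) : Prop where
  nonempty : K.Nonempty
  exists_done : ∀ y ∈ K, ∃ u s, lab u = y ∧ Rumor.done y s ∈ L u ∧ σ y = s.val ∧
    ∀ x, Precedes (L u) (Rumor.cand x) (Rumor.done y s) → x ∈ K

/-- `x` is elected on the basis of some certificate. -/
def Certified (lab : V → Label T) (L : V → List (Rumor T)) (x : Label T) : Prop :=
  ∃ K σ, IsCertificate lab L K σ ∧ x = leaderOf K σ

variable (lab : V → Label T) (t τ : ℕ)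

open Classical in
/-- What holds for the logs of all nodes at all times; `causal` says that facts arrive in causal
order. -/
structure Sound (L : V → List (Rumor T)) : Prop where
  nodup : ∀ v, (L v).Nodup
  owned : ∀ v f x, f ∈ L v → f.owner = some x → ∃ u, lab u = x ∧ f ∈ L u
  causal : ∀ v u f g, f ∈ L v → f.owner = some (lab u) → Precedes (L u) g f → Precedes (L v) g f
  lucky_of_cand : ∀ v, Rumor.cand (lab v) ∈ L v → Lucky t (lab v)
  cand_of_lucky : ∀ v, Rumor.hello ∈ L v → Lucky t (lab v) → Rumor.cand (lab v) ∈ L v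
  wit_spec : ∀ z x, Rumor.wit x (lab z) ∈ L z → Rumor.cand x ∈ L z ∧ x ≠ lab z ∧
    ∀ g, Precedes (L z) g (Rumor.cand x) → Precedes (L z) g (Rumor.wit x (lab z))
  done_unique : ∀ u s s', Rumor.done (lab u) s ∈ L u → Rumor.done (lab u) s' ∈ L u → s = s'
  done_spec : ∀ u s, Rumor.done (lab u) s ∈ L u →
    (Finset.univ.filter fun x => Precedes (L u) (Rumor.cand x) (Rumor.done (lab u) s)).card = s ∧
    Precedes (L u) (Rumor.cand (lab u)) (Rumor.done (lab u) s) ∧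
    τ ≤ (Finset.univ.filter fun w =>
      Precedes (L u) (Rumor.wit (lab u) w) (Rumor.done (lab u) s)).card
  elect_unique : ∀ v x x', Rumor.elect x ∈ L v → Rumor.elect x' ∈ L v → x = x'
  elect_spec : ∀ v x, Rumor.elect x ∈ L v → Certified lab L x

/-- The ways in which a fact can be added to the log of the node `w`. -/
inductive Push (L : V → List (Rumor T)) (w : V) : Rumor T → Prop
  | relay {a f} : f ∈ L a → (∀ g, Precedes (L a) g f → g ∈ L w) → f ∉ L w → f ≠ .hello →
      Undecided (L w) → Push L w f
  | cand : L w = [] → Lucky t (lab w) → Push L w (.cand (lab w))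
  | hello : Rumor.hello ∉ L w → (Lucky t (lab w) → Rumor.cand (lab w) ∈ L w) → Push L w .hello
  | wit {x} : Rumor.cand x ∈ L w → x ≠ lab w → Rumor.wit x (lab w) ∉ L w →
      Push L w (.wit x (lab w))
  | done : DoneRule τ (lab w) (L w) → Push L w (.done (lab w) (candCount (L w)))
  | elect : ElectRule (L w) → Push L w (.elect (leader (L w)))

variable {lab t τ} {L : V → List (Rumor T)} {v w : V} {f : Rumor T} {x : Label T}

theorem Push.notMem (h : Push lab t τ L w f) : f ∉ L w := by
  cases h with
  | relay _ _ h => exact h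
  | cand h => simp [h]
  | hello h => exact h
  | wit _ _ h => exact h
  | done h => exact h.2.1 _
  | elect h => exact h.1 _

theorem Push.own_or_relay (h : Push lab t τ L w f) : (∀ x, f.owner = some x → lab w = x) ∨
    ∃ a, f ∈ L a ∧ ∀ g, Precedes (L a) g f → g ∈ L w := by
  cases h with
  | relay ha hpre => exact Or.inr ⟨_, ha, hpre⟩
  | hello => exact Or.inl fun x hx => nomatch hx
  | elect => exact Or.inl fun x hx => nomatch hx
  | _ => exact Or.inl fun x hx => Option.some.inj hx

theorem Certified.push [DecidableEq V] (h : Certified lab L x) (e : List (Rumor T)) :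
    Certified lab (pushLog L w e) x := by
  obtain ⟨K, σ, hK, hx⟩ := h
  refine ⟨K, σ, ⟨hK.nonempty, fun y hy => ?_⟩, hx⟩
  obtain ⟨u, s, hlab, hdone, hσ, hknown⟩ := hK.exists_done y hy
  exact ⟨u, s, hlab, mem_pushLog_of_mem hdone, hσ,
    fun x hx => hknown x ((precedes_pushLog_of_mem hdone).1 hx)⟩

theorem unique_pushLog [DecidableEq V] {α : Type*} {φ : α → Rumor T} (hφ : Function.Injective φ)
    (hold : ∀ a b, φ a ∈ L v → φ b ∈ L v → a = b)
    (hnew : ∀ a, v = w → φ a = f → ∀ b, φ b ∉ L v) (a b : α)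
    (ha : φ a ∈ pushLog L w [f] v) (hb : φ b ∈ pushLog L w [f] v) : a = b := by
  rcases mem_pushLog_singleton.1 ha with ha | ⟨hv, ha⟩ <;>
    rcases mem_pushLog_singleton.1 hb with hb | ⟨hv', hb⟩
  · exact hold a b ha hb
  · exact absurd ha (hnew b hv' hb a)
  · exact absurd hb (hnew a hv ha b)
  · exact hφ (ha.trans hb.symm)

namespace Sound

theorem notMem_of_own (S : Sound lab t τ L) (hlab : Function.Injective lab) (hf : f ∉ L w)
    (hown : f.owner = some (lab w)) (v : V) : f ∉ L v := fun hv => by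
  obtain ⟨u, hu, hfu⟩ := S.owned v f _ hv hown
  exact hf (hlab hu ▸ hfu)

theorem done_unique_of_mem (S : Sound lab t τ L) (hlab : Function.Injective lab) {v v' : V}
    {s s' : Fin (2 ^ T + 1)} (h : Rumor.done x s ∈ L v) (h' : Rumor.done x s' ∈ L v') :
    s = s' := by
  obtain ⟨u, rfl, hu⟩ := S.owned _ _ _ h rfl
  obtain ⟨u', hlab_eq, hu'⟩ := S.owned _ _ _ h' rfl
  rw [hlab hlab_eq] at hu'
  exact S.done_unique _ _ _ hu hu'

theorem announcedCount_eq (S : Sound lab t τ L) (hlab : Function.Injective lab)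
    {s : Fin (2 ^ T + 1)} (h : Rumor.done x s ∈ L v) : announcedCount (L v) x = s.val := by
  have hex : ∃ s, Rumor.done x s ∈ L v := ⟨s, h⟩
  rw [announcedCount, dif_pos hex, S.done_unique_of_mem hlab hex.choose_spec h]

theorem isCertificate_of_electRule (S : Sound lab t τ L) (hlab : Function.Injective lab)
    (h : ElectRule (L v)) : IsCertificate lab L (cands (L v)) (announcedCount (L v)) where
  nonempty := h.2.1.imp fun _ => mem_cands.2
  exists_done y hy := by
    obtain ⟨s, hs⟩ := h.2.2 y (mem_cands.1 hy)
    obtain ⟨u, rfl, hu⟩ := S.owned _ _ _ hs rfl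
    exact ⟨u, s, rfl, hu, S.announcedCount_eq hlab hs,
      fun x hx => mem_cands.2 (S.causal v u _ _ hs rfl hx).mem_left⟩

section Push

variable [DecidableEq V]

theorem nodup_push (S : Sound lab t τ L) (h : Push lab t τ L w f) (v : V) :
    (pushLog L w [f] v).Nodup := by
  by_cases hv : v = w
  · subst hv
    rw [pushLog_self]
    exact (S.nodup _).append (by simp) (by simpa using h.notMem)
  · rw [pushLog_of_ne hv]
    exact S.nodup v

theorem owned_push (S : Sound lab t τ L) (h : Push lab t τ L w f) (v : V) (g : Rumor T)
    (x : Label T) (hg : g ∈ pushLog L w [f] v) (hx : g.owner = some x) :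
    ∃ u, lab u = x ∧ g ∈ pushLog L w [f] u := by
  have hold {v : V} (hg : g ∈ L v) : ∃ u, lab u = x ∧ g ∈ pushLog L w [f] u :=
    (S.owned v g x hg hx).imp fun u hu => ⟨hu.1, mem_pushLog_of_mem hu.2⟩
  rcases mem_pushLog_singleton.1 hg with hgv | ⟨rfl, rfl⟩
  · exact hold hgv
  · rcases h.own_or_relay with hown | ⟨a, ha, -⟩
    · exact ⟨v, hown x hx, hg⟩
    · exact hold ha

theorem causal_push (S : Sound lab t τ L) (hlab : Function.Injective lab)
    (h : Push lab t τ L w f) (v u : V) (p g : Rumor T) (hp : p ∈ pushLog L w [f] v)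
    (hown : p.owner = some (lab u)) (hg : Precedes (pushLog L w [f] u) g p) :
    Precedes (pushLog L w [f] v) g p := by
  rw [mem_pushLog_singleton] at hp
  rw [precedes_pushLog_singleton h.notMem] at hg ⊢
  rcases hg with hg | ⟨rfl, rfl, hg⟩
  · by_cases hpv : p ∈ L v
    · exact Or.inl (S.causal v u p g hpv hown hg)
    · obtain ⟨rfl, rfl⟩ := hp.resolve_left hpv
      rcases h.own_or_relay with hself | ⟨a, ha, hpre⟩
      · obtain rfl := hlab (hself _ hown)
        exact absurd hg.1 hpv
      · exact Or.inr ⟨rfl, rfl, hpre g (S.causal a u p g ha hown hg)⟩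
  · exact Or.inr ⟨(hp.resolve_left (S.notMem_of_own hlab h.notMem hown v)).1, rfl, hg⟩

theorem lucky_of_cand_push (S : Sound lab t τ L) (hlab : Function.Injective lab)
    (h : Push lab t τ L w f) (v : V) (hv : Rumor.cand (lab v) ∈ pushLog L w [f] v) :
    Lucky t (lab v) := by
  rcases mem_pushLog_singleton.1 hv with hv | ⟨rfl, rfl⟩
  · exact S.lucky_of_cand v hv
  · cases h with
    | relay ha _ hnot => exact absurd ha (S.notMem_of_own hlab hnot rfl _)
    | cand _ hl => exact hl

theorem cand_of_lucky_push (S : Sound lab t τ L) (h : Push lab t τ L w f) (v : V)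
    (hv : Rumor.hello ∈ pushLog L w [f] v) (hl : Lucky t (lab v)) :
    Rumor.cand (lab v) ∈ pushLog L w [f] v := by
  refine mem_pushLog_of_mem ?_
  rcases mem_pushLog_singleton.1 hv with hv | ⟨rfl, rfl⟩
  · exact S.cand_of_lucky v hv hl
  · cases h with
    | relay _ _ _ hne => exact absurd rfl hne
    | hello _ hcand => exact hcand hl

theorem wit_spec_push (S : Sound lab t τ L) (hlab : Function.Injective lab)
    (h : Push lab t τ L w f) (z : V) (x : Label T)
    (hz : Rumor.wit x (lab z) ∈ pushLog L w [f] z) :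
    Rumor.cand x ∈ pushLog L w [f] z ∧ x ≠ lab z ∧
      ∀ g, Precedes (pushLog L w [f] z) g (Rumor.cand x) →
        Precedes (pushLog L w [f] z) g (Rumor.wit x (lab z)) := by
  rcases mem_pushLog_singleton.1 hz with hz | ⟨rfl, rfl⟩
  · obtain ⟨hcand, hne, hpre⟩ := S.wit_spec z x hz
    refine ⟨mem_pushLog_of_mem hcand, hne, fun g hg => ?_⟩
    rw [precedes_pushLog_of_mem hcand] at hg
    rw [precedes_pushLog_of_mem hz]
    exact hpre g hg
  · cases h with
    | relay ha _ hnot => exact absurd ha (S.notMem_of_own hlab hnot rfl _)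
    | wit hcand hne hnot =>
      refine ⟨mem_pushLog_of_mem hcand, hne, fun g hg => ?_⟩
      rw [precedes_pushLog_of_mem hcand] at hg
      exact (precedes_pushLog_singleton hnot).2 (Or.inr ⟨rfl, rfl, hg.mem_left⟩)

theorem done_unique_push (S : Sound lab t τ L) (hlab : Function.Injective lab)
    (h : Push lab t τ L w f) (u : V) (s s' : Fin (2 ^ T + 1)) :
    Rumor.done (lab u) s ∈ pushLog L w [f] u → Rumor.done (lab u) s' ∈ pushLog L w [f] u →
      s = s' := by
  refine unique_pushLog (fun _ _ => by simp) (S.done_unique u) ?_ s s'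
  rintro s rfl rfl s'
  cases h with
  | relay ha _ hnot => exact absurd ha (S.notMem_of_own hlab hnot rfl _)
  | done hrule => exact hrule.2.1 s'

theorem elect_unique_push (S : Sound lab t τ L) (h : Push lab t τ L w f) (v : V)
    (x x' : Label T) :
    Rumor.elect x ∈ pushLog L w [f] v → Rumor.elect x' ∈ pushLog L w [f] v → x = x' := by
  refine unique_pushLog (fun _ _ => by simp) (S.elect_unique v) ?_ x x'
  rintro x rfl rfl x'
  cases h with
  | relay _ _ _ _ hund => exact hund x'
  | elect hrule => exact hrule.1 x'

open Classical in
theorem done_spec_push (S : Sound lab t τ L) (hlab : Function.Injective lab)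
    (h : Push lab t τ L w f) (u : V) (s : Fin (2 ^ T + 1))
    (hs : Rumor.done (lab u) s ∈ pushLog L w [f] u) :
    (Finset.univ.filter fun x =>
        Precedes (pushLog L w [f] u) (Rumor.cand x) (Rumor.done (lab u) s)).card = s ∧
      Precedes (pushLog L w [f] u) (Rumor.cand (lab u)) (Rumor.done (lab u) s) ∧
      τ ≤ (Finset.univ.filter fun w' =>
        Precedes (pushLog L w [f] u) (Rumor.wit (lab u) w') (Rumor.done (lab u) s)).card := by
  rcases mem_pushLog_singleton.1 hs with hs | ⟨rfl, rfl⟩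
  · simpa only [precedes_pushLog_of_mem hs] using S.done_spec u s hs
  · have hprec (g : Rumor T) :
        Precedes (pushLog L u [Rumor.done (lab u) s] u) g (Rumor.done (lab u) s) ↔ g ∈ L u := by
      rw [pushLog_self, Precedes.append_cons_self h.notMem]
    simp only [hprec]
    cases h with
    | relay ha _ hnot => exact absurd ha (S.notMem_of_own hlab hnot rfl _)
    | done hrule => exact ⟨rfl, hrule.1, hrule.2.2⟩

theorem elect_spec_push (S : Sound lab t τ L) (hlab : Function.Injective lab)
    (h : Push lab t τ L w f) (v : V) (x : Label T) (hx : Rumor.elect x ∈ pushLog L w [f] v) :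
    Certified lab (pushLog L w [f]) x := by
  rcases mem_pushLog_singleton.1 hx with hx | ⟨rfl, rfl⟩
  · exact (S.elect_spec v x hx).push _
  · cases h with
    | relay ha => exact (S.elect_spec _ x ha).push _
    | elect hrule =>
      exact Certified.push ⟨_, _, S.isCertificate_of_electRule hlab hrule, rfl⟩ _

theorem push (S : Sound lab t τ L) (hlab : Function.Injective lab) (h : Push lab t τ L w f) :
    Sound lab t τ (pushLog L w [f]) where
  nodup := S.nodup_push h
  owned := S.owned_push h
  causal := S.causal_push hlab h
  lucky_of_cand := S.lucky_of_cand_push hlab h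
  cand_of_lucky := S.cand_of_lucky_push h
  wit_spec := S.wit_spec_push hlab h
  done_unique := S.done_unique_push hlab h
  done_spec := S.done_spec_push hlab h
  elect_unique := S.elect_unique_push h
  elect_spec := S.elect_spec_push hlab h

theorem push_initLog (S : Sound lab t τ L) (hlab : Function.Injective lab) (hw : L w = []) :
    Sound lab t τ (pushLog L w (initLog t (lab w))) := by
  rw [initLog, ← pushLog_pushLog]
  by_cases h : Lucky t (lab w)
  · rw [if_pos h]
    refine (S.push hlab (.cand hw h)).push hlab (.hello ?_ fun _ => ?_)
    · simp [pushLog_self, hw]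
    · simp [pushLog_self]
  · rw [if_neg h, pushLog_nil]
    exact S.push hlab (.hello (by simp [hw]) fun h' => absurd h' h)

theorem push_doneNews (S : Sound lab t τ L) (hlab : Function.Injective lab) :
    Sound lab t τ (pushLog L w (doneNews τ (lab w) (L w))) := by
  rcases doneNews_eq τ (lab w) (L w) with ⟨hrule, he⟩ | ⟨-, he⟩
  · exact he ▸ S.push hlab (.done hrule)
  · rwa [he, pushLog_nil]

theorem push_electNews (S : Sound lab t τ L) (hlab : Function.Injective lab) :
    Sound lab t τ (pushLog L w (electNews (L w))) := by
  rcases electNews_eq (L w) with ⟨hrule, he⟩ | ⟨-, he⟩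
  · exact he ▸ S.push hlab (.elect hrule)
  · rwa [he, pushLog_nil]

theorem push_witNews (S : Sound lab t τ L) (hlab : Function.Injective lab) {a : V} (b : Label T)
    (hhello : Rumor.hello ∈ L w) (ha : f ∈ L a) (hpre : ∀ g, Precedes (L a) g f → g ∈ L w)
    (hf : f ∉ L w) (hund : Undecided (L w)) :
    Sound lab t τ (pushLog L w (f :: witNews t (lab w) b f)) := by
  have hrelay := S.push hlab (.relay ha hpre hf (fun h => hf (h ▸ hhello)) hund)
  rw [← List.singleton_append, ← pushLog_pushLog]
  rcases witNews_eq t (lab w) b f with ⟨x, rfl, -, he⟩ | ⟨he, -⟩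
  · rw [he]
    refine hrelay.push hlab (.wit ?_ ?_ ?_)
    · simp [pushLog_self]
    · rintro rfl
      exact S.notMem_of_own hlab hf rfl a ha
    · simp only [pushLog_self, List.mem_append, List.mem_singleton, reduceCtorEq, or_false]
      exact fun h => hf (S.wit_spec w x h).1
  · rwa [he, pushLog_nil]

theorem push_learnNews (S : Sound lab t τ L) (hlab : Function.Injective lab) {a : V}
    (b : Label T) (hhello : Rumor.hello ∈ L w) (ha : f ∈ L a)
    (hpre : ∀ g, Precedes (L a) g f → g ∈ L w) (hf : f ∉ L w) (hund : Undecided (L w)) :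
    Sound lab t τ (pushLog L w (learnNews t τ (lab w) (L w) f b)) := by
  have h := ((S.push_witNews hlab b hhello ha hpre hf hund).push_doneNews
    (w := w) hlab).push_electNews (w := w) hlab
  simpa only [learnNews, pushLog_pushLog, pushLog_self, List.append_assoc] using h

end Push

end Sound

end Sound

/-! ### Uniqueness of the leader -/

section Uniqueness

variable {V : Type*} [Fintype V] {T t τ : ℕ} {lab : V → Label T} {L : V → List (Rumor T)}
  {u v z : V} {K K' : Finset (Label T)} {σ σ' : Label T → ℕ}

open Classical in
/-- The nodes that have learnt that `u` is a candidate, before having heard the same of `v`. -/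
noncomputable def draws (lab : V → Label T) (L : V → List (Rumor T)) (u v : V) : Finset V :=
  Finset.univ.filter fun z => z ≠ u ∧ Rumor.cand (lab u) ∈ L z ∧
    ¬ Precedes (L z) (Rumor.cand (lab v)) (Rumor.cand (lab u))

open Classical in
/-- The nodes in `draws lab L u v` that have become witnesses for `u`. -/
noncomputable def hits (lab : V → Label T) (L : V → List (Rumor T)) (u v : V) : Finset V :=
  (draws lab L u v).filter fun z => Rumor.wit (lab u) (lab z) ∈ L z

theorem mem_draws : z ∈ draws lab L u v ↔ z ≠ u ∧ Rumor.cand (lab u) ∈ L z ∧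
    ¬ Precedes (L z) (Rumor.cand (lab v)) (Rumor.cand (lab u)) := by
  simp [draws]

theorem mem_hits : z ∈ hits lab L u v ↔
    z ∈ draws lab L u v ∧ Rumor.wit (lab u) (lab z) ∈ L z := by
  simp [hits]

theorem disjoint_draws (hlab : Function.Injective lab) (h : u ≠ v) :
    Disjoint (draws lab L u v) (draws lab L v u) := by
  refine Finset.disjoint_left.2 fun z hu hv => h ?_
  obtain ⟨-, hu, hvu⟩ := mem_draws.1 hu
  obtain ⟨-, hv, huv⟩ := mem_draws.1 hv
  have hidx : (L z).idxOf (Rumor.cand (lab u)) = (L z).idxOf (Rumor.cand (lab v)) :=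
    le_antisymm (not_lt.1 fun hlt => hvu ⟨hu, hlt⟩) (not_lt.1 fun hlt => huv ⟨hv, hlt⟩)
  exact hlab (Rumor.cand.inj ((List.idxOf_inj hu).1 hidx))

/-- No two candidates have collected their witnesses without hearing of each other. -/
def NoSplit (lab : V → Label T) (τ : ℕ) (L : V → List (Rumor T)) : Prop :=
  ∀ u v, u ≠ v → ¬ (τ ≤ (hits lab L u v).card ∧ τ ≤ (hits lab L v u).card)

theorem Sound.le_card_hits (S : Sound lab t τ L) {s : Fin (2 ^ T + 1)}
    (h : Rumor.done (lab u) s ∈ L u)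
    (hv : ¬ Precedes (L u) (Rumor.cand (lab v)) (Rumor.done (lab u) s)) :
    τ ≤ (hits lab L u v).card := by
  classical
  refine (S.done_spec u s h).2.2.trans ((Finset.card_le_card fun x hx => ?_).trans
    (Finset.card_image_le (f := lab)))
  have hx : Precedes (L u) (Rumor.wit (lab u) x) (Rumor.done (lab u) s) := by simpa using hx
  obtain ⟨z, rfl, hz⟩ := S.owned u _ _ hx.mem_left rfl
  obtain ⟨hcand, hne, hpre⟩ := S.wit_spec z _ hz
  refine Finset.mem_image_of_mem _ (mem_hits.2
    ⟨mem_draws.2 ⟨fun hzu => hne (hzu ▸ rfl), hcand, fun hc => hv ?_⟩, hz⟩)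
  exact (S.causal u z _ _ hx.mem_left rfl (hpre _ hc)).trans hx

namespace IsCertificate

omit [Fintype V] in
theorem apply_eq (S : Sound lab t τ L) (hlab : Function.Injective lab)
    (hK : IsCertificate lab L K σ) (hK' : IsCertificate lab L K' σ') {y : Label T} (hy : y ∈ K)
    (hy' : y ∈ K') : σ y = σ' y := by
  obtain ⟨u, s, -, hu, hσ, -⟩ := hK.exists_done y hy
  obtain ⟨u', s', -, hu', hσ', -⟩ := hK'.exists_done y hy'
  rw [hσ, hσ', S.done_unique_of_mem hlab hu hu']

omit [Fintype V] in
theorem apply_le_card (S : Sound lab t τ L) (hK : IsCertificate lab L K σ) {y : Label T}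
    (hy : y ∈ K) : σ y ≤ K.card := by
  classical
  obtain ⟨u, s, rfl, hu, hσ, hknown⟩ := hK.exists_done y hy
  rw [hσ, ← (S.done_spec u s hu).1]
  exact Finset.card_le_card fun x hx => hknown x (by simpa using hx)

/-- A candidate outside of a certificate `K` knew all of `K` and itself when it made its
announcement, hence it announced more than the members of `K`. -/
theorem mem_of_forall_le (S : Sound lab t τ L) (hN : NoSplit lab τ L)
    (hK : IsCertificate lab L K σ) (hK' : IsCertificate lab L K' σ') {m : Label T} (hm : m ∈ K')
    (hmin : ∀ y ∈ K, σ' m ≤ σ y) : m ∈ K := by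
  classical
  by_contra hmK
  obtain ⟨v, s, rfl, hv, hσ', -⟩ := hK'.exists_done m hm
  have hsub : insert (lab v) K ⊆
      Finset.univ.filter fun x => Precedes (L v) (Rumor.cand x) (Rumor.done (lab v) s) := by
    refine Finset.insert_subset (by simpa using (S.done_spec v s hv).2.1) fun z hz => ?_
    obtain ⟨u, s', rfl, hu, -, hknown⟩ := hK.exists_done z hz
    have huv : u ≠ v := fun h => hmK (h ▸ hz)
    by_contra hc
    exact hN u v huv ⟨S.le_card_hits hu fun h => hmK (hknown _ h),
      S.le_card_hits hv (by simpa using hc)⟩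
  have hlarge := Finset.card_le_card hsub
  rw [(S.done_spec v s hv).1, Finset.card_insert_of_notMem hmK] at hlarge
  obtain ⟨y, hy⟩ := hK.nonempty
  have := hmin y hy
  have := hK.apply_le_card S hy
  omega

theorem minimizer (S : Sound lab t τ L) (hlab : Function.Injective lab) (hN : NoSplit lab τ L)
    (hK : IsCertificate lab L K σ) (hK' : IsCertificate lab L K' σ') {x : Label T} (hx : x ∈ K)
    (hmin : ∀ y ∈ K, σ x ≤ σ y) : x ∈ K' ∧ ∀ y ∈ K', σ' x ≤ σ' y := by
  obtain ⟨m, hm, hm_min⟩ := K'.exists_min_image σ' hK'.nonempty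
  have hle : σ x ≤ σ' m := by
    by_contra! hlt
    have hmK := mem_of_forall_le S hN hK hK' hm fun y hy => hlt.le.trans (hmin y hy)
    have := hmin m hmK
    have := apply_eq S hlab hK hK' hmK hm
    omega
  have hxK' := mem_of_forall_le S hN hK' hK hx fun y hy => hle.trans (hm_min y hy)
  refine ⟨hxK', fun y hy => ?_⟩
  rw [← apply_eq S hlab hK hK' hx hxK']
  exact hle.trans (hm_min y hy)

end IsCertificate

theorem Sound.certified_unique (S : Sound lab t τ L) (hlab : Function.Injective lab)
    (hN : NoSplit lab τ L) {x x' : Label T} (hx : Certified lab L x)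
    (hx' : Certified lab L x') : x = x' := by
  obtain ⟨K, σ, hK, rfl⟩ := hx
  obtain ⟨K', σ', hK', rfl⟩ := hx'
  unfold leaderOf
  congr 1
  ext x
  exact ⟨fun h => hK.minimizer S hlab hN hK' h.1 h.2, fun h => hK'.minimizer S hlab hN hK h.1 h.2⟩

end Uniqueness

section Samples

variable {V : Type*} [Fintype V] {T t τ : ℕ} {lab : V → Label T} {L : V → List (Rumor T)}
  {u v w z : V} {f : Rumor T}

/-- When `f` arrives, the node `w` with the log `l` draws whether to become a witness for `u`, and
has not heard of `v`. -/
def Samples (lab : V → Label T) (l : List (Rumor T)) (u v w : V) (f : Rumor T) : Prop :=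
  f = .cand (lab u) ∧ w ≠ u ∧ f ∉ l ∧ Rumor.cand (lab v) ∉ l

theorem Samples.notMem_draws (h : Samples lab (L w) u v w f) : w ∉ draws lab L u v := by
  obtain ⟨rfl, -, hnot, -⟩ := h
  exact fun hw => hnot (mem_draws.1 hw).2.1

theorem Samples.notMem_hits (h : Samples lab (L w) u v w f) : w ∉ hits lab L u v :=
  fun hw => h.notMem_draws (mem_hits.1 hw).1

variable [DecidableEq V]

theorem mem_draws_pushLog_of_ne (e : List (Rumor T)) (hz : z ≠ w) :
    z ∈ draws lab (pushLog L w e) u v ↔ z ∈ draws lab L u v := by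
  simp only [mem_draws, pushLog_of_ne hz]

theorem mem_hits_pushLog_of_ne (e : List (Rumor T)) (hz : z ≠ w) :
    z ∈ hits lab (pushLog L w e) u v ↔ z ∈ hits lab L u v := by
  simp only [mem_hits, mem_draws, pushLog_of_ne hz]

theorem draws_initLog (hlab : Function.Injective lab) (hw : L w = []) (u v : V) :
    draws lab (pushLog L w (initLog t (lab w))) u v = draws lab L u v := by
  ext z
  obtain rfl | hz := eq_or_ne z w
  · have hcand : z ≠ u → Rumor.cand (lab u) ∉ initLog t (lab z) := fun hne h => by
      simp only [mem_initLog, reduceCtorEq, false_or, Rumor.cand.injEq] at h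
      exact hne (hlab h.2.symm)
    simp only [mem_draws, pushLog_self, hw, List.nil_append, List.not_mem_nil, false_and, and_false,
      iff_false, not_and]
    exact fun hne h => absurd h (hcand hne)
  · exact mem_draws_pushLog_of_ne _ hz

theorem hits_initLog (hlab : Function.Injective lab) (hw : L w = []) (u v : V) :
    hits lab (pushLog L w (initLog t (lab w))) u v = hits lab L u v := by
  ext z
  obtain rfl | hz := eq_or_ne z w
  · rw [mem_hits, mem_hits, draws_initLog hlab hw]
    simp [mem_draws, hw]
  · exact mem_hits_pushLog_of_ne _ hz

theorem Samples.draws_news {me b : Label T} (h : Samples lab (L w) u v w f) :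
    draws lab (pushLog L w (news t τ me (L w) f b)) u v = insert w (draws lab L u v) := by
  obtain ⟨rfl, hne, hnot, hv⟩ := h
  ext z
  obtain rfl | hz := eq_or_ne z w
  · obtain ⟨e, he⟩ := learnNews_eq_cons t τ me b (L z) (.cand (lab u))
    rw [mem_draws, pushLog_self, news_of_notMem hnot, he, Precedes.append_cons_self hnot]
    simp [hne, hv]
  · simp [mem_draws_pushLog_of_ne _ hz, hz]

open Classical in
theorem Samples.hits_news (S : Sound lab t τ L) {b : Label T} (h : Samples lab (L w) u v w f) :
    hits lab (pushLog L w (news t τ (lab w) (L w) f b)) u v =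
      if Lucky t b then insert w (hits lab L u v) else hits lab L u v := by
  have hw := h.notMem_hits
  have hdraws := h.draws_news (t := t) (τ := τ) (me := lab w) (b := b)
  obtain ⟨rfl, -, hnot, -⟩ := h
  ext z
  obtain rfl | hz := eq_or_ne z w
  · have hwit : Rumor.wit (lab u) (lab z) ∉ L z := fun h => hnot (S.wit_spec z _ h).1
    rw [mem_hits, hdraws, pushLog_self, news_of_notMem hnot, List.mem_append, wit_mem_learnNews]
    by_cases hb : Lucky t b <;> simp [hb, hwit, hw]
  · rw [mem_hits_pushLog_of_ne _ hz]
    split_ifs <;> simp [hz]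

theorem draws_news_of_not_samples {me b : Label T} (h : ¬ Samples lab (L w) u v w f) :
    draws lab (pushLog L w (news t τ me (L w) f b)) u v = draws lab L u v := by
  by_cases hf : f ∈ L w
  · rw [news_of_mem hf, pushLog_nil]
  rw [news_of_notMem hf]
  ext z
  obtain rfl | hz := eq_or_ne z w
  · rw [mem_draws, mem_draws]
    refine and_congr_right fun hzu => ?_
    by_cases hc : Rumor.cand (lab u) ∈ L z
    · simp only [mem_pushLog_of_mem hc, precedes_pushLog_of_mem hc, hc]
    · simp only [hc, false_and, iff_false, not_and, not_not, pushLog_self]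
      intro hc'
      obtain rfl := cand_mem_learnNews.1 ((List.mem_append.1 hc').resolve_left hc)
      obtain ⟨e, he⟩ := learnNews_eq_cons t τ me b (L z) (.cand (lab u))
      rw [he, Precedes.append_cons_self hc]
      by_contra hv
      exact h ⟨rfl, hzu, hf, hv⟩
  · exact mem_draws_pushLog_of_ne _ hz

theorem hits_news_of_not_samples (S : Sound lab t τ L) (hlab : Function.Injective lab) {a : V}
    {b : Label T} (ha : f ∈ L a) (h : ¬ Samples lab (L w) u v w f) :
    hits lab (pushLog L w (news t τ (lab w) (L w) f b)) u v = hits lab L u v := by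
  by_cases hf : f ∈ L w
  · rw [news_of_mem hf, pushLog_nil]
  have hdraws := draws_news_of_not_samples (t := t) (τ := τ) (me := lab w) (b := b) h
  ext z
  obtain rfl | hz := eq_or_ne z w
  · rw [mem_hits, mem_hits, hdraws]
    refine and_congr_right fun hzd => ?_
    rw [pushLog_self, news_of_notMem hf, List.mem_append, wit_mem_learnNews]
    refine or_iff_left ?_
    rintro (rfl | ⟨rfl, -⟩)
    · exact S.notMem_of_own hlab hf rfl a ha
    · exact hf (mem_draws.1 hzd).2.1
  · exact mem_hits_pushLog_of_ne _ hz

end Samples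

/-! ### Queues -/

section Queue

variable {V : Type*} [DecidableEq V] {α : Type*} (G : SimpleGraph V) [DecidableRel G.Adj]

/-- The queues after the node `w` has sent `e` over all of its edges. -/
def pushQueue (Q : V → V → List α) (w : V) (e : List α) : V → V → List α :=
  fun a b => if a = w ∧ G.Adj a b then Q a b ++ e else Q a b

/-- The queues after the queue from `u` to `w` has been replaced by `r`. -/
def setQueue (Q : V → V → List α) (u w : V) (r : List α) : V → V → List α :=
  fun a b => if a = u ∧ b = w then r else Q a b

variable {Q : V → V → List α} {a b u w : V}

theorem pushQueue_of_ne (h : a ≠ w) (e : List α) : pushQueue G Q w e a b = Q a b :=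
  if_neg fun h' => h h'.1

theorem pushQueue_nil : pushQueue G Q w [] = Q := by
  funext a b
  simp [pushQueue]

theorem pushQueue_setQueue (h : u ≠ w) (r e : List α) :
    pushQueue G (setQueue Q u w r) w e = setQueue (pushQueue G Q w e) u w r := by
  funext a b
  by_cases ha : a = u
  · subst ha
    simp only [setQueue, pushQueue_of_ne G h]
  · simp [pushQueue, setQueue, ha]

end Queue

section Fifo

variable {V : Type*} {T : ℕ} {G : SimpleGraph V} {L : V → List (Rumor T)}
  {Q : V → V → List (Rumor T)} {u w : V} {f : Rumor T} {r : List (Rumor T)}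

/-- Every queue holds the end of the log of the sender; what has been delivered before is known to
the receiver, unless it has terminated. -/
structure Fifo (G : SimpleGraph V) (L : V → List (Rumor T)) (Q : V → V → List (Rumor T)) :
    Prop where
  adj : ∀ u w, Q u w ≠ [] → G.Adj u w
  exists_delivered : ∀ u w, G.Adj u w →
    ∃ p, L u = p ++ Q u w ∧ (Undecided (L w) → ∀ f ∈ p, f ∈ L w)

namespace Fifo

theorem mem_sender (F : Fifo G L Q) (h : Q u w = f :: r) : f ∈ L u := by
  obtain ⟨p, hp, -⟩ := F.exists_delivered u w (F.adj u w (by simp [h]))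
  simp [hp, h]

theorem mem_receiver_of_precedes (F : Fifo G L Q) (h : Q u w = f :: r) (hund : Undecided (L w))
    {g : Rumor T} (hg : Precedes (L u) g f) : g ∈ L w := by
  obtain ⟨p, hp, hknown⟩ := F.exists_delivered u w (F.adj u w (by simp [h]))
  rw [hp, h] at hg
  exact hknown hund g hg.mem_of_append_cons

variable [DecidableEq V]

theorem push [DecidableRel G.Adj] (F : Fifo G L Q) (w : V) (e : List (Rumor T)) :
    Fifo G (pushLog L w e) (pushQueue G Q w e) where
  adj a b h := by
    by_contra hadj
    exact hadj (F.adj a b (by simpa only [pushQueue, hadj, and_false, if_false] using h))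
  exists_delivered a b h := by
    obtain ⟨p, hp, hknown⟩ := F.exists_delivered a b h
    refine ⟨p, ?_, fun hund f hf =>
      mem_pushLog_of_mem (hknown (fun x hx => hund x (mem_pushLog_of_mem hx)) f hf)⟩
    obtain rfl | ha := eq_or_ne a w
    · simp [pushQueue, h, pushLog_self, hp]
    · rw [pushQueue_of_ne G ha, pushLog_of_ne ha, hp]

theorem pop (F : Fifo G L Q) (h : Q u w = f :: r) (hf : Undecided (L w) → f ∈ L w) :
    Fifo G L (setQueue Q u w r) where
  adj a b hab := by
    by_cases heq : a = u ∧ b = w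
    · obtain ⟨rfl, rfl⟩ := heq
      exact F.adj a b (by simp [h])
    · exact F.adj a b (by simpa only [setQueue, if_neg heq] using hab)
  exists_delivered a b hadj := by
    obtain ⟨p, hp, hknown⟩ := F.exists_delivered a b hadj
    by_cases heq : a = u ∧ b = w
    · obtain ⟨rfl, rfl⟩ := heq
      refine ⟨p ++ [f], by simp [setQueue, hp, h], fun hund g hg => ?_⟩
      rcases List.mem_append.1 hg with hg | hg
      · exact hknown hund g hg
      · exact List.mem_singleton.1 hg ▸ hf hund
    · exact ⟨p, by rwa [setQueue, if_neg heq], hknown⟩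

end Fifo

end Fifo

/-! ### The effect of a single action -/

section AnyProtocol

variable {P : Protocol} {V : Type} [Fintype V] [DecidableEq V] {G : SimpleGraph V}
  [DecidableRel G.Adj] {port : V → V → ℕ} {ω : P.Coins V} {c : P.Config V} {a b u v w : V}
  {M : P.Msg}

theorem wakeUp_of_awake (h : c.node v ≠ none) : wakeUp G port ω c v = c := by
  obtain ⟨x, hx⟩ := Option.ne_none_iff_exists'.1 h
  simp [wakeUp, hx]

theorem node_wakeUp_of_ne (h : a ≠ v) : (wakeUp G port ω c v).node a = c.node a := by
  unfold wakeUp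
  split
  · rfl
  · simp [emit, h]

theorem node_wakeUp_ne_none : (wakeUp G port ω c v).node v ≠ none := by
  unfold wakeUp
  split
  · simp_all
  · simp [emit]

theorem now_wakeUp : (wakeUp G port ω c v).now = c.now := by
  unfold wakeUp
  split <;> rfl

theorem queue_wakeUp_of_ne (h : a ≠ v) : (wakeUp G port ω c v).queue a b = c.queue a b := by
  unfold wakeUp
  split
  · rfl
  · simp [emit, h]

theorem queue_emit_ne_nil {out : ℕ → List P.Msg} (h : c.queue a b ≠ []) :
    (emit G port c v out).queue a b ≠ [] := by
  unfold emit
  dsimp only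
  split_ifs <;> simp [h]

theorem queue_wakeUp_ne_nil (h : c.queue a b ≠ []) :
    (wakeUp G port ω c v).queue a b ≠ [] := by
  unfold wakeUp
  split
  · exact h
  · exact queue_emit_ne_nil h

theorem since_emit {out : ℕ → List P.Msg} (h : c.queue a b = [] → c.since a b = c.now) :
    (emit G port c v out).since a b = c.since a b := by
  by_cases hq : c.queue a b = []
  · simp [emit, hq, h hq]
  · simp [emit, hq]

theorem since_wakeUp (h : c.queue a b ≠ []) :
    (wakeUp G port ω c v).since a b = c.since a b := by
  unfold wakeUp
  split
  · rfl
  · exact since_emit fun hq => absurd hq h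

theorem node_accept_of_ne (h : a ≠ w) : (accept G port ω c u w M).node a = c.node a := by
  unfold accept
  split
  · rfl
  · split_ifs
    · rfl
    · simp [emit, h]

theorem now_accept : (accept G port ω c u w M).now = c.now := by
  unfold accept
  split
  · rfl
  · split_ifs <;> rfl

theorem since_accept (h : c.queue a b = [] → c.since a b = c.now) :
    (accept G port ω c u w M).since a b = c.since a b := by
  unfold accept
  split
  · rfl
  · split_ifs
    · rfl
    · exact since_emit h

theorem now_arrive : (arrive G port ω c u w).now = c.now := by
  unfold arrive
  split
  · rfl
  · rw [now_accept, now_wakeUp]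

theorem now_step_le {act : Option (ℝ × Action V)} (h : Allowed c act) (hq : c.queue a b ≠ []) :
    (step G port ω c act).now ≤ c.since a b + 1 := by
  obtain _ | ⟨s, v | ⟨u, w⟩⟩ := act
  · exact absurd (h.2 a b) hq
  · exact now_wakeUp.trans_le (h.2.2.1 a b hq)
  · exact now_arrive.trans_le (h.2.2.1 a b hq)

/-- The configuration `c` after the first message has been taken from the queue from `u` to `w`,
leaving `r`. -/
def pop (c : P.Config V) (u w : V) (r : List P.Msg) : P.Config V :=
  { c with
    queue := setQueue c.queue u w r
    since := fun a b => if a = u ∧ b = w then c.now else c.since a b }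

/-- The configuration `c` with new data for the node `v`. -/
def setNode (c : P.Config V) (v : V) (x : P.Node) : P.Config V :=
  { c with node := Function.update c.node v (some x) }

omit [Fintype V] in
theorem since_pop_of_ne (r : List P.Msg) (h : ¬ (a = u ∧ b = w)) :
    (pop c u w r).since a b = c.since a b := if_neg h

omit [Fintype V] in
theorem since_pop_self (r : List P.Msg) : (pop c u w r).since u w = c.now := if_pos ⟨rfl, rfl⟩

/-- Taking a message from a queue commutes with the receiver waking up, because the receiver sends
over other queues. -/
theorem wakeUp_pop {r : List P.Msg} (huw : u ≠ w) :
    wakeUp G port ω (pop c u w r) w = pop (wakeUp G port ω c w) u w r := by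
  by_cases hw : c.node w = none
  · simp only [wakeUp, pop, hw, emit, Config.mk.injEq, true_and, and_true]
    constructor
    · funext a b
      by_cases hab : a = u ∧ b = w
      · obtain ⟨rfl, rfl⟩ := hab
        simp [setQueue, huw]
      · simp [setQueue, hab]
    · funext a b
      by_cases hab : a = u ∧ b = w
      · simp [hab]
      · simp [setQueue, hab]
  · rw [wakeUp_of_awake hw, wakeUp_of_awake (c := pop c u w r) hw]

theorem arrive_eq {r : List P.Msg} (h : c.queue u w = M :: r) (huw : u ≠ w) :
    arrive G port ω c u w = accept G port ω (pop (wakeUp G port ω c w) u w r) u w M := by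
  rw [← wakeUp_pop huw, arrive, h]
  rfl

end AnyProtocol

section Effect

variable {V : Type} {T t τ : ℕ} {ω : (gossip T t τ).Coins V} {c c' : (gossip T t τ).Config V}
  {v w : V} {x : (gossip T t τ).Node} {f : Rumor T}

/-- The `j`-th block of coins of the node `v`. -/
def block (ω : (gossip T t τ).Coins V) (v : V) (j : ℕ) : Label T := fun i => ω (v, j, i)

/-- The label that the node `v` gets when it wakes up. -/
def label (ω : (gossip T t τ).Coins V) (v : V) : Label T := block ω v 0

/-- The log of the node `v`, empty while `v` is asleep. -/
def logs (c : (gossip T t τ).Config V) (v : V) : List (Rumor T) :=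
  (c.node v).elim [] fun x => GossipState.log x.state

/-- The number of blocks of coins that the node `v` has used. -/
def flipCount {P : Protocol} (c : P.Config V) (v : V) : ℕ :=
  (c.node v).elim 0 fun x => x.flips.length

open Classical in
/-- What the node `w` adds to its log when the message `f` arrives: nothing, if it has
terminated. -/
noncomputable def arrivalNews (ω : (gossip T t τ).Coins V) (c : (gossip T t τ).Config V) (w : V)
    (f : Rumor T) : List (Rumor T) :=
  if Undecided (logs c w) then
    news t τ (label ω w) (logs c w) f (block ω w (flipCount c w))
  else []

theorem logs_of_some (h : c.node v = some x) : logs c v = GossipState.log x.state := by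
  simp [logs, h]

theorem logs_of_none (h : c.node v = none) : logs c v = [] := by simp [logs, h]

theorem flipCount_of_some (h : c.node v = some x) : flipCount c v = x.flips.length := by
  simp [flipCount, h]

theorem flipCount_of_none (h : c.node v = none) : flipCount c v = 0 := by simp [flipCount, h]

theorem awake_of_mem (h : f ∈ logs c v) : c.node v ≠ none := fun h' => by
  simp [logs_of_none h'] at h

theorem arrivalNews_cases (ω : (gossip T t τ).Coins V) (c : (gossip T t τ).Config V) (w : V)
    (f : Rumor T) :
    ((Undecided (logs c w) → f ∈ logs c w) ∧ arrivalNews ω c w f = []) ∨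
      (Undecided (logs c w) ∧ f ∉ logs c w ∧ arrivalNews ω c w f =
        learnNews t τ (label ω w) (logs c w) f (block ω w (flipCount c w))) := by
  by_cases hund : Undecided (logs c w)
  · by_cases hf : f ∈ logs c w
    · exact Or.inl ⟨fun _ => hf, by rw [arrivalNews, if_pos hund, news_of_mem hf]⟩
    · exact Or.inr ⟨hund, hf, by rw [arrivalNews, if_pos hund, news_of_notMem hf]⟩
  · exact Or.inl ⟨fun h => absurd h hund, if_neg hund⟩

theorem isSome_output (s : GossipState T) :
    ((gossip T t τ).output s).isSome = true ↔ ¬ Undecided s.log := by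
  simp only [Undecided, not_forall, not_not]
  split_ifs with h
  · simpa using h
  · simpa using h

variable [Fintype V] [DecidableEq V] {G : SimpleGraph V} [DecidableRel G.Adj]
  {port : V → V → ℕ}

theorem wakeUp_of_asleep (h : c.node v = none) :
    wakeUp G port ω c v =
      emit G port (setNode c v ⟨label ω v, ⟨label ω v, initLog t (label ω v)⟩, [label ω v]⟩) v
        (fun _ => initLog t (label ω v)) := by
  simp only [wakeUp, h]
  rfl

theorem accept_of_undecided (u : V) (hx : c.node w = some x)
    (hme : GossipState.me x.state = label ω w) (hund : Undecided (logs c w)) (f : Rumor T) :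
    accept G port ω c u w f = emit G port (setNode c w
      ⟨x.ident, ⟨label ω w, logs c w ++ arrivalNews ω c w f⟩,
        x.flips ++ [block ω w x.flips.length]⟩) w (fun _ => arrivalNews ω c w f) := by
  rw [arrivalNews, if_pos hund, flipCount_of_some hx]
  rw [logs_of_some hx] at hund ⊢
  have hout : ¬ ((gossip T t τ).output x.state).isSome = true :=
    fun h => (isSome_output _).1 h hund
  rw [← hme]
  simp only [accept, hx, if_neg hout]
  rfl

theorem accept_of_not_undecided (u : V) (hx : c.node w = some x)
    (hund : ¬ Undecided (logs c w)) (f : Rumor T) : accept G port ω c u w f = c := by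
  rw [logs_of_some hx] at hund
  have hout : ((gossip T t τ).output x.state).isSome = true := (isSome_output _).2 hund
  simp only [accept, hx, if_pos hout]

/-- The configuration `c'` arises from `c` by the node `v` adding `e` to its log and sending it over
all of its edges; `Q` are the queues of `c'`. -/
structure Effect (G : SimpleGraph V) [DecidableRel G.Adj] (c c' : (gossip T t τ).Config V) (v : V)
    (e : List (Rumor T)) (Q : V → V → List (Rumor T)) : Prop where
  now : c'.now = c.now
  logs : logs c' = pushLog (logs c) v e
  queue : c'.queue = Q
  since : ∀ a b, c'.since a b = c.since a b ∨ c'.since a b = c.now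
  sent : c'.sent = c.sent + G.degree v * e.length
  node_ne : ∀ a, a ≠ v → c'.node a = c.node a

theorem effect_emit {e : List (Rumor T)} (hx : GossipState.log x.state = logs c v ++ e) :
    Effect G c (emit G port (setNode c v x) v fun _ => e) v e (pushQueue G c.queue v e) where
  now := rfl
  logs := by
    funext a
    obtain rfl | ha := eq_or_ne a v
    · simp only [pushLog_self, ← hx]
      simp [logs, emit, setNode]
    · simp [logs, emit, setNode, pushLog_of_ne ha, ha]
  queue := rfl
  since a b := by
    by_cases hq : c.queue a b = []
    · simp [emit, setNode, hq]
    · simp [emit, setNode, hq]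
  sent := by simp [emit, setNode]
  node_ne a ha := by simp [emit, setNode, ha]

theorem effect_wakeUp (h : c.node v = none) :
    Effect G c (wakeUp G port ω c v) v (initLog t (label ω v))
      (pushQueue G c.queue v (initLog t (label ω v))) := by
  rw [wakeUp_of_asleep h]
  exact effect_emit (by simp [logs_of_none h])

theorem node_wakeUp (h : c.node v = none) : (wakeUp G port ω c v).node v =
    some ⟨label ω v, ⟨label ω v, initLog t (label ω v)⟩, [label ω v]⟩ := by
  simp [wakeUp_of_asleep h, emit, setNode]

theorem effect_accept (u : V) (hx : c.node w = some x)
    (hme : GossipState.me x.state = label ω w) (f : Rumor T) :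
    Effect G c (accept G port ω c u w f) w (arrivalNews ω c w f)
      (pushQueue G c.queue w (arrivalNews ω c w f)) := by
  by_cases hund : Undecided (logs c w)
  · rw [accept_of_undecided u hx hme hund]
    exact effect_emit rfl
  · rw [accept_of_not_undecided u hx hund, arrivalNews, if_neg hund, pushQueue_nil]
    exact ⟨rfl, pushLog_nil.symm, rfl, fun _ _ => Or.inl rfl, by simp, fun _ _ => rfl⟩

theorem exists_node_accept (u : V) (hx : c.node w = some x)
    (hme : GossipState.me x.state = label ω w) (f : Rumor T) :
    ∃ y : (gossip T t τ).Node, (accept G port ω c u w f).node w = some y ∧ y.ident = x.ident ∧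
      GossipState.me y.state = label ω w ∧ x.flips.length ≤ y.flips.length := by
  by_cases hund : Undecided (logs c w)
  · rw [accept_of_undecided u hx hme hund]
    exact ⟨_, Function.update_self _ _ _, rfl, rfl, by simp⟩
  · rw [accept_of_not_undecided u hx hund]
    exact ⟨x, hx, rfl, hme, le_rfl⟩

theorem Effect.of_pop {u : V} {r : List (Rumor T)} {e : List (Rumor T)}
    {Q : V → V → List (Rumor T)} (E : Effect G (pop c u w r) c' v e Q) : Effect G c c' v e Q where
  now := E.now
  logs := E.logs
  queue := E.queue
  since a b := by
    rcases E.since a b with h | h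
    · by_cases hab : a = u ∧ b = w
      · exact Or.inr (h.trans (if_pos hab))
      · exact Or.inl (h.trans (if_neg hab))
    · exact Or.inr h
  sent := E.sent
  node_ne := E.node_ne

end Effect

/-! ### Invariants of an execution -/

section Invariants

section Logs

variable {V : Type*} [DecidableEq V] {T : ℕ}

theorem prefix_pushLog (L : V → List (Rumor T)) (w : V) (e : List (Rumor T)) (v : V) :
    L v <+: pushLog L w e v := by
  obtain rfl | h := eq_or_ne v w
  · exact pushLog_self L v e ▸ List.prefix_append _ _
  · rw [pushLog_of_ne h]

theorem sum_degree_pushLog [Fintype V] (G : SimpleGraph V) [DecidableRel G.Adj]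
    (L : V → List (Rumor T)) (w : V) (e : List (Rumor T)) :
    ∑ v, G.degree v * (pushLog L w e v).length =
      ∑ v, G.degree v * (L v).length + G.degree w * e.length := by
  have hother : ∀ v ∈ Finset.univ.erase w, G.degree v * (pushLog L w e v).length =
      G.degree v * (L v).length := fun v hv => by
    rw [pushLog_of_ne (Finset.ne_of_mem_erase hv)]
  rw [← Finset.add_sum_erase _ _ (Finset.mem_univ w),
    ← Finset.add_sum_erase _ (fun v => G.degree v * (L v).length) (Finset.mem_univ w),
    Finset.sum_congr rfl hother, pushLog_self, List.length_append]
  ring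

theorem length_pushLog_sub_length_pushQueue (G : SimpleGraph V) [DecidableRel G.Adj]
    (L : V → List (Rumor T)) (Q : V → V → List (Rumor T)) (w : V) (e : List (Rumor T)) {a b : V}
    (h : G.Adj a b) :
    ((pushLog L w e a).length : ℝ) - (pushQueue G Q w e a b).length =
      (L a).length - (Q a b).length := by
  obtain rfl | ha := eq_or_ne a w
  · simp [pushLog_self, pushQueue, h]
  · rw [pushLog_of_ne ha, pushQueue_of_ne G ha]

end Logs

variable {V : Type} {T t τ : ℕ}

/-- The data `x` of a node that has woken up as the node `v`. -/
structure Initialized (ω : (gossip T t τ).Coins V) (v : V) (x : (gossip T t τ).Node) : Prop where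
  ident_eq : x.ident = label ω v
  me_eq : GossipState.me x.state = label ω v
  flips_pos : 1 ≤ x.flips.length
  hello_mem : Rumor.hello ∈ GossipState.log x.state

/-- The number of messages from `a` to `b` that have been delivered. -/
def delivered (c : (gossip T t τ).Config V) (a b : V) : ℝ :=
  (logs c a).length - (c.queue a b).length

variable [Fintype V] [DecidableEq V]

/-- What holds in all configurations of an execution with the coins `ω`. -/
structure Valid (G : SimpleGraph V) [DecidableRel G.Adj] (ω : (gossip T t τ).Coins V)
    (c : (gossip T t τ).Config V) : Prop where
  node : ∀ v x, c.node v = some x → Initialized ω v x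
  sound : Sound (label ω) t τ (logs c)
  fifo : Fifo G (logs c) c.queue
  settled : ∀ v, Settled τ (label ω v) (logs c v)
  since_le : ∀ a b, c.since a b ≤ c.now
  sent_eq : c.sent = ∑ v, G.degree v * (logs c v).length

/-- How a configuration `c` develops into a later one. By `delay`, the time at which the current
transmission on an edge began grows at most as fast as the number of messages delivered over that
edge, as long as the edge is busy. -/
structure Advance (G : SimpleGraph V) (c c' : (gossip T t τ).Config V) : Prop where
  log : ∀ v, logs c v <+: logs c' v
  now : c.now ≤ c'.now
  awake : ∀ v, c.node v ≠ none → c'.node v ≠ none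
  flips : ∀ v, flipCount c v ≤ flipCount c' v
  delivered : ∀ a b, G.Adj a b → delivered c a b ≤ delivered c' a b
  delay : ∀ a b, c.queue a b ≠ [] → c'.queue a b ≠ [] →
    c'.since a b - Gossip.delivered c' a b ≤ c.since a b - Gossip.delivered c a b

variable {G : SimpleGraph V} [DecidableRel G.Adj] {port : V → V → ℕ}
  {ω : (gossip T t τ).Coins V} {c c' c₁ c₂ c₃ : (gossip T t τ).Config V} {u v w : V}
  {x : (gossip T t τ).Node} {f : Rumor T} {r : List (Rumor T)}

omit [Fintype V] [DecidableEq V] [DecidableRel G.Adj] in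
theorem Advance.refl (c : (gossip T t τ).Config V) : Advance G c c :=
  ⟨fun _ => List.prefix_refl _, le_rfl, fun _ => id, fun _ => le_rfl, fun _ _ _ => le_rfl,
    fun _ _ _ _ => le_rfl⟩

omit [Fintype V] [DecidableEq V] [DecidableRel G.Adj] in
theorem Advance.trans_of_queue (A : Advance G c₁ c₂) (B : Advance G c₂ c₃)
    (h : ∀ a b, c₁.queue a b ≠ [] → c₂.queue a b ≠ []) : Advance G c₁ c₃ where
  log v := (A.log v).trans (B.log v)
  now := A.now.trans B.now
  awake v hv := B.awake v (A.awake v hv)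
  flips v := (A.flips v).trans (B.flips v)
  delivered a b hab := (A.delivered a b hab).trans (B.delivered a b hab)
  delay a b h₁ h₃ := (B.delay a b (h a b h₁) h₃).trans (A.delay a b h₁ (h a b h₁))

omit [DecidableEq V] in
theorem Valid.start (ω : (gossip T t τ).Coins V) : Valid G ω ((gossip T t τ).start V) where
  node v x h := by simp [Protocol.start] at h
  sound := by
    change Sound _ _ _ fun _ => []
    constructor <;> simp
  fifo := ⟨fun _ _ h => absurd rfl h, fun _ _ _ => ⟨[], rfl, by simp⟩⟩
  settled v := ⟨fun h => List.not_mem_nil h.1, fun h => List.not_mem_nil h.2.1.choose_spec⟩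
  since_le _ _ := le_rfl
  sent_eq := by simp [Protocol.start, logs]

omit [DecidableEq V] in
theorem Valid.hello_mem (I : Valid G ω c) (h : c.node v ≠ none) : Rumor.hello ∈ logs c v := by
  obtain ⟨x, hx⟩ := Option.ne_none_iff_exists'.1 h
  exact logs_of_some hx ▸ (I.node v x hx).hello_mem

theorem Effect.valid {e : List (Rumor T)} {Q : V → V → List (Rumor T)} (E : Effect G c c' v e Q)
    (I : Valid G ω c) (hnode : ∀ x, c'.node v = some x → Initialized ω v x)
    (hsound : Sound (label ω) t τ (pushLog (Gossip.logs c) v e))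
    (hfifo : Fifo G (pushLog (Gossip.logs c) v e) Q)
    (hsettled : Settled τ (label ω v) (Gossip.logs c v ++ e)) : Valid G ω c' where
  node a x hx := by
    obtain rfl | ha := eq_or_ne a v
    · exact hnode x hx
    · exact I.node a x (E.node_ne a ha ▸ hx)
  sound := E.logs ▸ hsound
  fifo := by rwa [E.logs, E.queue]
  settled a := by
    rw [E.logs]
    obtain rfl | ha := eq_or_ne a v
    · rwa [pushLog_self]
    · exact pushLog_of_ne ha e ▸ I.settled a
  since_le a b := by
    rw [E.now]
    rcases E.since a b with h | h
    · exact h ▸ I.since_le a b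
    · exact h.le
  sent_eq := by rw [E.sent, I.sent_eq, E.logs, sum_degree_pushLog]

theorem Effect.advance {e : List (Rumor T)} {Q : V → V → List (Rumor T)}
    (E : Effect G c c' v e Q) (hawake : c'.node v ≠ none)
    (hflips : flipCount c v ≤ flipCount c' v)
    (hdelivered : ∀ a b, G.Adj a b → delivered c a b ≤ delivered c' a b)
    (hdelay : ∀ a b, c.queue a b ≠ [] →
      c'.since a b - delivered c' a b ≤ c.since a b - delivered c a b) : Advance G c c' where
  log a := E.logs ▸ prefix_pushLog _ _ _ _
  now := E.now.ge
  awake a ha := by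
    obtain rfl | hav := eq_or_ne a v
    · exact hawake
    · rwa [E.node_ne a hav]
  flips a := by
    obtain rfl | hav := eq_or_ne a v
    · exact hflips
    · simp only [flipCount, E.node_ne a hav, le_refl]
  delivered := hdelivered
  delay a b h _ := hdelay a b h

omit [DecidableEq V] in
theorem Valid.tick (I : Valid G ω c) {s : ℝ} (hs : c.now ≤ s) : Valid G ω { c with now := s } :=
  ⟨I.node, I.sound, I.fifo, I.settled, fun a b => (I.since_le a b).trans hs, I.sent_eq⟩

omit [Fintype V] [DecidableEq V] [DecidableRel G.Adj] in
theorem Advance.tick {s : ℝ} (hs : c.now ≤ s) : Advance G c { c with now := s } :=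
  ⟨fun _ => List.prefix_refl _, hs, fun _ => id, fun _ => le_rfl, fun _ _ _ => le_rfl,
    fun _ _ _ _ => le_rfl⟩

/-! ### Waking up and receiving a message -/

theorem Valid.wakeUp (I : Valid G ω c) (hlab : Function.Injective (label ω)) (hτ : 1 ≤ τ)
    (v : V) : Valid G ω (wakeUp G port ω c v) := by
  by_cases h : c.node v = none
  · refine (effect_wakeUp h).valid I (fun x hx => ?_) (I.sound.push_initLog hlab (logs_of_none h))
      (I.fifo.push _ _) ?_
    · obtain rfl := Option.some.inj ((node_wakeUp h).symm.trans hx)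
      exact ⟨rfl, rfl, by simp, by simp [mem_initLog]⟩
    · rw [logs_of_none h, List.nil_append]
      exact settled_initLog hτ _
  · rwa [wakeUp_of_awake h]

theorem Valid.advance_wakeUp (I : Valid G ω c) (v : V) :
    Advance G c (Protocol.wakeUp G port ω c v) := by
  by_cases h : c.node v = none
  · have E := effect_wakeUp (G := G) (port := port) (ω := ω) h
    have hdelivered (a b : V) (hab : G.Adj a b) :
        delivered (Protocol.wakeUp G port ω c v) a b = delivered c a b := by
      rw [delivered, E.logs, E.queue, length_pushLog_sub_length_pushQueue G _ _ _ _ hab, delivered]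
    refine E.advance node_wakeUp_ne_none (by simp [flipCount_of_none h])
      (fun a b hab => (hdelivered a b hab).ge) fun a b hq => ?_
    rw [hdelivered a b (I.fifo.adj a b hq), since_wakeUp hq]
  · rw [wakeUp_of_awake h]
    exact Advance.refl c

theorem Valid.sound_arrivalNews (I : Valid G ω c) (hlab : Function.Injective (label ω))
    (hw : c.node w ≠ none) (hq : c.queue u w = f :: r) :
    Sound (label ω) t τ (pushLog (logs c) w (arrivalNews ω c w f)) := by
  rcases arrivalNews_cases ω c w f with ⟨-, he⟩ | ⟨hund, hf, he⟩
  · rw [he, pushLog_nil]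
    exact I.sound
  · rw [he]
    exact I.sound.push_learnNews hlab _ (I.hello_mem hw) (I.fifo.mem_sender hq)
      (fun g => I.fifo.mem_receiver_of_precedes hq hund) hf hund

omit [DecidableEq V] in
theorem Valid.settled_arrivalNews (I : Valid G ω c) (w : V) (f : Rumor T) :
    Settled τ (label ω w) (logs c w ++ arrivalNews ω c w f) := by
  rcases arrivalNews_cases ω c w f with ⟨-, he⟩ | ⟨-, -, he⟩
  · rw [he, List.append_nil]
    exact I.settled w
  · exact he ▸ settled_learn _ _ _

omit [Fintype V] in
theorem mem_pushLog_arrivalNews (h : Undecided (pushLog (logs c) w (arrivalNews ω c w f) w)) :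
    f ∈ pushLog (logs c) w (arrivalNews ω c w f) w := by
  rcases arrivalNews_cases ω c w f with ⟨hf, -⟩ | ⟨-, -, he⟩
  · exact mem_pushLog_of_mem (hf fun x hx => h x (mem_pushLog_of_mem hx))
  · rw [pushLog_self, he]
    exact List.mem_append_right _ List.mem_cons_self

theorem Valid.fifo_arrivalNews (I : Valid G ω c) (hq : c.queue u w = f :: r) (huw : u ≠ w) :
    Fifo G (pushLog (logs c) w (arrivalNews ω c w f))
      (setQueue (pushQueue G c.queue w (arrivalNews ω c w f)) u w r) :=
  (I.fifo.push w _).pop ((pushQueue_of_ne G huw _).trans hq) mem_pushLog_arrivalNews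

theorem Valid.effect_accept_pop (I : Valid G ω c) (hx : c.node w = some x) (huw : u ≠ w)
    (f : Rumor T) (r : List (Rumor T)) :
    Effect G c (accept G port ω (pop c u w r) u w f) w (arrivalNews ω c w f)
      (setQueue (pushQueue G c.queue w (arrivalNews ω c w f)) u w r) :=
  pushQueue_setQueue (Q := c.queue) G huw r (arrivalNews ω c w f) ▸
    (effect_accept (c := pop c u w r) u hx (I.node w x hx).me_eq f).of_pop

theorem Valid.accept (I : Valid G ω c) (hlab : Function.Injective (label ω)) (huw : u ≠ w)
    (hw : c.node w ≠ none) (hq : c.queue u w = f :: r) :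
    Valid G ω (accept G port ω (pop c u w r) u w f) := by
  obtain ⟨x, hx⟩ := Option.ne_none_iff_exists'.1 hw
  have E := I.effect_accept_pop (port := port) hx huw f r
  refine E.valid I (fun y hy => ?_) (I.sound_arrivalNews hlab hw hq) (I.fifo_arrivalNews hq huw)
    (I.settled_arrivalNews w f)
  have hxI := I.node w x hx
  obtain ⟨y', hy', hident, hme, hflips⟩ := exists_node_accept (G := G) (port := port)
    (c := pop c u w r) u hx hxI.me_eq f
  obtain rfl := Option.some.inj (hy'.symm.trans hy)
  refine ⟨hident.trans hxI.ident_eq, hme, hxI.flips_pos.trans hflips, ?_⟩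
  rw [← logs_of_some hy, E.logs]
  exact mem_pushLog_of_mem (I.hello_mem hw)

theorem Valid.delivered_accept (I : Valid G ω c) (huw : u ≠ w) (hw : c.node w ≠ none)
    (hq : c.queue u w = f :: r) :
    delivered (Protocol.accept G port ω (pop c u w r) u w f) u w = delivered c u w + 1 := by
  obtain ⟨x, hx⟩ := Option.ne_none_iff_exists'.1 hw
  have E := I.effect_accept_pop (port := port) hx huw f r
  rw [delivered, E.logs, E.queue, pushLog_of_ne huw, delivered, hq]
  simp only [setQueue, and_self, if_true, List.length_cons]
  push_cast
  ring

theorem Valid.delivered_accept_of_ne (I : Valid G ω c) (huw : u ≠ w) (hw : c.node w ≠ none)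
    (f : Rumor T) (r : List (Rumor T)) {a b : V} (hab : G.Adj a b) (hne : ¬ (a = u ∧ b = w)) :
    delivered (Protocol.accept G port ω (pop c u w r) u w f) a b = delivered c a b := by
  obtain ⟨x, hx⟩ := Option.ne_none_iff_exists'.1 hw
  have E := I.effect_accept_pop (port := port) hx huw f r
  rw [delivered, E.logs, E.queue, setQueue, if_neg hne,
    length_pushLog_sub_length_pushQueue G _ _ _ _ hab, delivered]

theorem Valid.advance_accept (I : Valid G ω c) (huw : u ≠ w) (hw : c.node w ≠ none)
    (hq : c.queue u w = f :: r) (hnow : c.now ≤ c.since u w + 1) :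
    Advance G c (Protocol.accept G port ω (pop c u w r) u w f) := by
  obtain ⟨x, hx⟩ := Option.ne_none_iff_exists'.1 hw
  obtain ⟨y, hy, -, -, hflips⟩ := exists_node_accept (G := G) (port := port)
    (c := pop c u w r) u hx (I.node w x hx).me_eq f
  refine (I.effect_accept_pop hx huw f r).advance (by simp [hy]) ?_ ?_ ?_
  · rwa [flipCount_of_some hx, flipCount_of_some hy]
  · intro a b hab
    by_cases hne : a = u ∧ b = w
    · obtain ⟨rfl, rfl⟩ := hne
      linarith [I.delivered_accept (port := port) huw hw hq]
    · exact (I.delivered_accept_of_ne huw hw f r hab hne).ge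
  · intro a b hqab
    by_cases hne : a = u ∧ b = w
    · obtain ⟨rfl, rfl⟩ := hne
      rw [I.delivered_accept huw hw hq, since_accept fun _ => since_pop_self r, since_pop_self]
      linarith
    · have hpop : (pop c u w r).queue a b ≠ [] := by
        simpa only [pop, setQueue, if_neg hne] using hqab
      rw [I.delivered_accept_of_ne huw hw f r (I.fifo.adj a b hqab) hne,
        since_accept fun h => absurd h hpop, since_pop_of_ne (P := gossip T t τ) (c := c) r hne]

/-! ### One step of the execution -/

theorem Valid.step_wake (I : Valid G ω c) (hlab : Function.Injective (label ω)) (hτ : 1 ≤ τ)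
    {s : ℝ} (hs : c.now ≤ s) (v : V) :
    Valid G ω (step G port ω c (some (s, .wake v))) ∧
      Advance G c (step G port ω c (some (s, .wake v))) :=
  ⟨(I.tick hs).wakeUp hlab hτ v,
    (Advance.tick hs).trans_of_queue ((I.tick hs).advance_wakeUp v) fun _ _ h => h⟩

theorem Valid.step_deliver (I : Valid G ω c) (hlab : Function.Injective (label ω)) (hτ : 1 ≤ τ)
    {s : ℝ} (hs : c.now ≤ s) (hq : c.queue u w ≠ []) (hsince : s ≤ c.since u w + 1) :
    Valid G ω (step G port ω c (some (s, .deliver u w))) ∧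
      Advance G c (step G port ω c (some (s, .deliver u w))) ∧
      delivered c u w + 1 ≤ delivered (step G port ω c (some (s, .deliver u w))) u w := by
  obtain ⟨f, r, hfr⟩ := List.exists_cons_of_ne_nil hq
  have hadj : G.Adj u w := I.fifo.adj u w hq
  have huw := hadj.ne
  let c₀ : (gossip T t τ).Config V := { c with now := s }
  let c₁ := Protocol.wakeUp G port ω c₀ w
  have I₀ : Valid G ω c₀ := I.tick hs
  have I₁ : Valid G ω c₁ := I₀.wakeUp hlab hτ w
  have hq₁ : c₁.queue u w = f :: r := (queue_wakeUp_of_ne huw).trans hfr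
  have hw₁ : c₁.node w ≠ none := node_wakeUp_ne_none
  have hnow₁ : c₁.now ≤ c₁.since u w + 1 := by
    rw [now_wakeUp, since_wakeUp (c := c₀) hq]
    exact hsince
  have A₁ : Advance G c c₁ :=
    (Advance.tick hs).trans_of_queue (I₀.advance_wakeUp w) fun _ _ h => h
  have hstep : Protocol.step G port ω c (some (s, .deliver u w)) =
      Protocol.accept G port ω (pop c₁ u w r) u w f := arrive_eq (c := c₀) hfr huw
  rw [hstep, I₁.delivered_accept huw hw₁ hq₁]
  exact ⟨I₁.accept hlab huw hw₁ hq₁,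
    A₁.trans_of_queue (I₁.advance_accept huw hw₁ hq₁ hnow₁)
      fun _ _ h => queue_wakeUp_ne_nil (c := c₀) h,
    add_le_add_left (A₁.delivered u w hadj) 1⟩

theorem Valid.step (I : Valid G ω c) (hlab : Function.Injective (label ω)) (hτ : 1 ≤ τ)
    {act : Option (ℝ × Action V)} (h : Allowed c act) :
    Valid G ω (step G port ω c act) ∧ Advance G c (step G port ω c act) := by
  obtain _ | ⟨s, v | ⟨u, w⟩⟩ := act
  · exact ⟨I, Advance.refl c⟩
  · exact I.step_wake hlab hτ h.1 v
  · have hdeliver := I.step_deliver (port := port) hlab hτ h.1 h.2.2.2 (h.2.2.1 u w h.2.2.2)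
    exact ⟨hdeliver.1, hdeliver.2.1⟩

end Invariants

/-! ### Time -/

section Time

variable {V : Type} {T t τ : ℕ} [Fintype V] {G : SimpleGraph V} [DecidableRel G.Adj]
  {port : V → V → ℕ} {ω : (gossip T t τ).Coins V} {c c' : (gossip T t τ).Config V} {u v w : V}

/-- The number of nodes awake and of messages delivered, which grows whenever the environment is
active. -/
noncomputable def progress (G : SimpleGraph V) [DecidableRel G.Adj] (c : (gossip T t τ).Config V) :
    ℝ :=
  {v | c.node v ≠ none}.ncard + ∑ d : G.Dart, delivered c d.fst d.snd

omit [Fintype V] [DecidableRel G.Adj] in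
theorem Advance.awake_subset (A : Advance G c c') :
    {v | c.node v ≠ none} ⊆ {v | c'.node v ≠ none} := A.awake

theorem Advance.progress_of_wake (A : Advance G c c') (h : c.node v = none)
    (h' : c'.node v ≠ none) : progress G c + 1 ≤ progress G c' := by
  have hawake : {v | c.node v ≠ none}.ncard < {v | c'.node v ≠ none}.ncard :=
    Set.ncard_lt_ncard (A.awake_subset.ssubset_of_mem_notMem (a := v) h' (not_not.2 h))
  have hdelivered : ∑ d : G.Dart, Gossip.delivered c d.fst d.snd ≤
      ∑ d : G.Dart, Gossip.delivered c' d.fst d.snd :=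
    Finset.sum_le_sum fun d _ => A.delivered _ _ d.adj
  have := Nat.cast_le (α := ℝ).2 (Nat.succ_le_of_lt hawake)
  push_cast at this
  unfold progress
  linarith

theorem Advance.progress_of_delivered (A : Advance G c c') (hadj : G.Adj u w)
    (h : Gossip.delivered c u w + 1 ≤ Gossip.delivered c' u w) :
    progress G c + 1 ≤ progress G c' := by
  have hawake := Nat.cast_le (α := ℝ).2 (Set.ncard_le_ncard A.awake_subset)
  have hdelivered := Finset.single_le_sum
    (f := fun d : G.Dart => Gossip.delivered c' d.fst d.snd - Gossip.delivered c d.fst d.snd)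
    (fun d _ => sub_nonneg.2 (A.delivered _ _ d.adj)) (Finset.mem_univ ⟨(u, w), hadj⟩)
  rw [Finset.sum_sub_distrib] at hdelivered
  unfold progress
  linarith

theorem Valid.delivered_nonneg (I : Valid G ω c) (hadj : G.Adj u w) : 0 ≤ delivered c u w := by
  obtain ⟨p, hp, -⟩ := I.fifo.exists_delivered u w hadj
  rw [delivered, hp, List.length_append, Nat.cast_add, add_sub_cancel_right]
  exact Nat.cast_nonneg _

theorem Valid.progress_nonneg (I : Valid G ω c) : 0 ≤ progress G c :=
  add_nonneg (Nat.cast_nonneg _) (Finset.sum_nonneg fun d _ => I.delivered_nonneg d.adj)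

theorem progress_le {B : ℕ} (hB : ∀ v, (logs c v).length ≤ B) :
    progress G c ≤ Fintype.card V + Fintype.card G.Dart * B := by
  refine add_le_add ?_ ?_
  · rw [← Nat.card_eq_fintype_card]
    exact_mod_cast Set.ncard_le_card _
  · rw [← nsmul_eq_mul]
    refine Finset.sum_le_card_nsmul _ _ _ fun d _ => (sub_le_self _ (Nat.cast_nonneg _)).trans ?_
    exact_mod_cast hB d.fst

theorem Valid.queue_ne_nil (I : Valid G ω c) (hadj : G.Adj u w) {f : Rumor T}
    (hf : f ∈ logs c u) (hnew : f ∉ logs c w) (hund : Undecided (logs c w)) :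
    c.queue u w ≠ [] := by
  intro hq
  obtain ⟨p, hp, hmem⟩ := I.fifo.exists_delivered u w hadj
  rw [hq, List.append_nil] at hp
  exact hnew (hmem hund f (hp ▸ hf))

variable [DecidableEq V]

theorem Valid.progress_step (I : Valid G ω c) (hlab : Function.Injective (label ω)) (hτ : 1 ≤ τ)
    {act : Option (ℝ × Action V)} (h : Allowed c act) (hact : act ≠ none) :
    progress G c + 1 ≤ progress G (Protocol.step G port ω c act) := by
  obtain _ | ⟨s, v | ⟨u, w⟩⟩ := act
  · exact absurd rfl hact
  · exact (I.step_wake hlab hτ h.1 v).2.progress_of_wake h.2.2.2 node_wakeUp_ne_none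
  · obtain ⟨-, A, hdelivered⟩ := I.step_deliver (port := port) hlab hτ h.1 h.2.2.2
      (h.2.2.1 u w h.2.2.2)
    exact A.progress_of_delivered (I.fifo.adj u w h.2.2.2) hdelivered

section Execution

variable {adv : Adversary (gossip T t τ) V} (hadv : adv.IsLegal G port)
  (hlab : Function.Injective (label ω)) (hτ : 1 ≤ τ)
include hadv hlab hτ

theorem valid_config (k : ℕ) : Valid G ω (config G port adv ω k) := by
  induction k with
  | zero => exact Valid.start ω
  | succ k ih => exact (ih.step hlab hτ (hadv ω k)).1

theorem advance_config (k : ℕ) :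
    Advance G (config G port adv ω k) (config G port adv ω (k + 1)) :=
  ((valid_config hadv hlab hτ k).step hlab hτ (hadv ω k)).2

theorem stable_config {X : (gossip T t τ).Config V → Prop}
    (hX : ∀ c c', Advance G c c' → X c → X c') {j k : ℕ} (hjk : j ≤ k)
    (h : X (config G port adv ω j)) : X (config G port adv ω k) := by
  induction k, hjk using Nat.le_induction with
  | base => exact h
  | succ k _ ih => exact hX _ _ (advance_config hadv hlab hτ k) ih

theorem le_progress_of_busy {j : ℕ}
    (hbusy : ∀ k, j ≤ k → ∃ a b, (config G port adv ω k).queue a b ≠ []) (i : ℕ) :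
    (i : ℝ) ≤ progress G (config G port adv ω (j + i)) := by
  induction i with
  | zero => exact_mod_cast (valid_config hadv hlab hτ j).progress_nonneg
  | succ i ih =>
    obtain ⟨a, b, hab⟩ := hbusy (j + i) (Nat.le_add_right j i)
    have hallowed := hadv ω (j + i)
    have hact : adv (trace G port adv ω (j + i)).1 (trace G port adv ω (j + i)).2 ≠ none :=
      fun hnone => hab ((hnone ▸ hallowed).2 a b)
    push_cast
    exact (add_le_add_left ih 1).trans
      ((valid_config hadv hlab hτ (j + i)).progress_step hlab hτ hallowed hact)

theorem since_sub_delivered_le {j k : ℕ} (hadj : G.Adj u w) (hjk : j ≤ k)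
    (hbusy : ∀ i, j ≤ i → i ≤ k → (config G port adv ω i).queue u w ≠ []) :
    (config G port adv ω k).since u w - delivered (config G port adv ω k) u w ≤
      (config G port adv ω j).now := by
  induction k, hjk using Nat.le_induction with
  | base =>
    have hvalid := valid_config hadv hlab hτ j
    linarith [hvalid.since_le u w, hvalid.delivered_nonneg hadj]
  | succ k hjk ih =>
    exact ((advance_config hadv hlab hτ k).delay u w (hbusy k hjk k.le_succ)
      (hbusy (k + 1) (hjk.trans k.le_succ) le_rfl)).trans
        (ih fun i hi hik => hbusy i hi (hik.trans k.le_succ))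

variable {B : ℕ} (hB : ∀ k v, (logs (config G port adv ω k) v).length ≤ B)
include hB

theorem exists_idle (j : ℕ) : ∃ k, j ≤ k ∧ ∀ a b, (config G port adv ω k).queue a b = [] := by
  by_contra! hbusy
  obtain ⟨i, hi⟩ := exists_nat_gt ((Fintype.card V : ℝ) + Fintype.card G.Dart * B)
  exact (hi.trans_le (le_progress_of_busy hadv hlab hτ hbusy i)).not_ge
    (progress_le (hB (j + i)))

theorem now_le_of_busy {j k : ℕ} (hadj : G.Adj u w) (hjk : j ≤ k)
    (hbusy : ∀ i, j ≤ i → i ≤ k → (config G port adv ω i).queue u w ≠ []) :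
    (config G port adv ω (k + 1)).now ≤ (config G port adv ω j).now + B := by
  have hq := hbusy k hjk le_rfl
  have hsince := since_sub_delivered_le hadv hlab hτ hadj hjk hbusy
  have hnow : (config G port adv ω (k + 1)).now ≤ (config G port adv ω k).since u w + 1 :=
    now_step_le (hadv ω k) hq
  have hqueue : (1 : ℝ) ≤ ((config G port adv ω k).queue u w).length := by
    exact_mod_cast List.length_pos_iff.2 hq
  have hlog : ((logs (config G port adv ω k) u).length : ℝ) ≤ B := by exact_mod_cast hB k u
  unfold delivered at hsince
  linarith

theorem spread_edge (hadj : G.Adj u w) {f : Rumor T} {j : ℕ}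
    (hf : f ∈ logs (config G port adv ω j) u) :
    ∃ k, (config G port adv ω k).now ≤ (config G port adv ω j).now + B ∧
      (f ∈ logs (config G port adv ω k) w ∨ ¬ Undecided (logs (config G port adv ω k) w)) := by
  classical
  have hbusy (k : ℕ) (hk : j ≤ k) (h : ¬ (f ∈ logs (config G port adv ω k) w ∨
      ¬ Undecided (logs (config G port adv ω k) w))) : (config G port adv ω k).queue u w ≠ [] := by
    push Not at h
    exact (valid_config hadv hlab hτ k).queue_ne_nil hadj
      (stable_config (X := fun c => f ∈ logs c u) hadv hlab hτ (fun _ _ A h => (A.log u).subset h)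
        hk hf) h.1 h.2
  have hex : ∃ k, j ≤ k ∧ (f ∈ logs (config G port adv ω k) w ∨
      ¬ Undecided (logs (config G port adv ω k) w)) := by
    obtain ⟨k, hk, hq⟩ := exists_idle hadv hlab hτ hB j
    exact ⟨k, hk, by_contra fun h => hbusy k hk h (hq u w)⟩
  obtain ⟨hle, hspec⟩ := Nat.find_spec hex
  refine ⟨Nat.find hex, ?_, hspec⟩
  obtain hj | hlt := hle.eq_or_lt
  · exact hj ▸ le_add_of_nonneg_right B.cast_nonneg
  · obtain ⟨k, hk⟩ := Nat.exists_eq_add_one_of_ne_zero (Nat.ne_zero_of_lt hlt)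
    rw [hk]
    exact now_le_of_busy hadv hlab hτ hB hadj (by lia) fun i hi hik =>
      hbusy i hi fun h => Nat.find_min hex (by lia) ⟨hi, h⟩

end Execution

/-- The configuration has the property `X` at time `s` at the latest. -/
def By (G : SimpleGraph V) [DecidableRel G.Adj] (port : V → V → ℕ)
    (adv : Adversary (gossip T t τ) V) (ω : (gossip T t τ).Coins V)
    (X : (gossip T t τ).Config V → Prop) (s : ℝ) : Prop :=
  ∃ k, X (config G port adv ω k) ∧ (config G port adv ω k).now ≤ s

omit [Fintype V] [DecidableEq V] in
/-- Some node has learned whom to elect. -/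
def SomeDecided (c : (gossip T t τ).Config V) : Prop := ∃ v, ¬ Undecided (logs c v)

omit [Fintype V] [DecidableEq V] [DecidableRel G.Adj] in
theorem Advance.not_undecided (A : Advance G c c') (h : ¬ Undecided (logs c v)) :
    ¬ Undecided (logs c' v) :=
  fun h' => h fun x hx => h' x ((A.log v).subset hx)

omit [Fintype V] [DecidableEq V] [DecidableRel G.Adj] in
theorem SomeDecided.advance (A : Advance G c c') (h : SomeDecided c) : SomeDecided c' :=
  h.imp fun _ => A.not_undecided

variable {adv : Adversary (gossip T t τ) V}

theorem By.mono {X Y : (gossip T t τ).Config V → Prop} {s s' : ℝ} (h : By G port adv ω X s)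
    (hs : s ≤ s') (hXY : ∀ k, X (config G port adv ω k) → Y (config G port adv ω k)) :
    By G port adv ω Y s' :=
  h.imp fun k hk => ⟨hXY k hk.1, hk.2.trans hs⟩

section Spread

variable (hadv : adv.IsLegal G port) (hlab : Function.Injective (label ω)) (hτ : 1 ≤ τ)
include hadv hlab hτ

theorem by_forall {ι : Type*} [Finite ι] {X : ι → (gossip T t τ).Config V → Prop} {s : ℝ}
    (hs : 0 ≤ s) (hX : ∀ i c c', Advance G c c' → X i c → X i c')
    (h : ∀ i, By G port adv ω (X i) s) : By G port adv ω (fun c => ∀ i, X i c) s := by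
  choose k hk hnow using h
  obtain _ | _ := isEmpty_or_nonempty ι
  · exact ⟨0, isEmptyElim, hs⟩
  · obtain ⟨i, hi⟩ := Finite.exists_max k
    exact ⟨k i, fun j => stable_config hadv hlab hτ (hX j) (hi j) (hk j), hnow i⟩

theorem by_forall_or_someDecided {ι : Type*} [Finite ι]
    {X : ι → (gossip T t τ).Config V → Prop} {s : ℝ}
    (hs : 0 ≤ s) (hX : ∀ i c c', Advance G c c' → X i c → X i c')
    (h : ∀ i, By G port adv ω (fun c => X i c ∨ SomeDecided c) s) :
    By G port adv ω (fun c => (∀ i, X i c) ∨ SomeDecided c) s :=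
  (by_forall hadv hlab hτ hs (X := fun i c => X i c ∨ SomeDecided c)
    (fun i c c' A h => h.imp (hX i c c' A) (SomeDecided.advance A)) h).mono le_rfl
    fun _ h => forall_or_right.1 h

variable {B : ℕ} (hB : ∀ k v, (logs (config G port adv ω k) v).length ≤ B)
include hB

theorem spread_walk (p : G.Walk u w) {f : Rumor T} {s : ℝ}
    (h : By G port adv ω (fun c => f ∈ logs c u ∨ SomeDecided c) s) :
    By G port adv ω (fun c => f ∈ logs c w ∨ SomeDecided c) (s + B * p.length) := by
  induction p generalizing s with
  | nil => simpa using h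
  | @cons u v w hadj p ih =>
    have hnext : By G port adv ω (fun c => f ∈ logs c v ∨ SomeDecided c) (s + B) := by
      obtain ⟨j, hj | hj, hjs⟩ := h
      · obtain ⟨k, hk, hfk⟩ := spread_edge hadv hlab hτ hB hadj hj
        exact ⟨k, hfk.imp_right fun h => ⟨v, h⟩, by linarith⟩
      · exact ⟨j, Or.inr hj, hjs.trans (le_add_of_nonneg_right B.cast_nonneg)⟩
    refine (ih hnext).mono (le_of_eq ?_) fun _ h => h
    rw [SimpleGraph.Walk.length_cons]
    push_cast
    ring

theorem not_undecided_walk (p : G.Walk u w) {s : ℝ}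
    (h : By G port adv ω (fun c => ¬ Undecided (logs c u)) s) :
    By G port adv ω (fun c => ¬ Undecided (logs c w)) (s + B * p.length) := by
  induction p generalizing s with
  | nil => simpa using h
  | @cons u v w hadj p ih =>
    have hnext : By G port adv ω (fun c => ¬ Undecided (logs c v)) (s + B) := by
      obtain ⟨j, hj, hjs⟩ := h
      simp only [Undecided, not_forall, not_not] at hj
      obtain ⟨x, hx⟩ := hj
      obtain ⟨k, hk, hxk⟩ := spread_edge hadv hlab hτ hB hadj hx
      exact ⟨k, hxk.elim (fun hx hund => hund x hx) id, by linarith⟩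
    refine (ih hnext).mono (le_of_eq ?_) fun _ h => h
    rw [SimpleGraph.Walk.length_cons]
    push_cast
    ring

omit [Fintype V] [DecidableEq V] [DecidableRel G.Adj] hadv hlab hτ hB in
theorem exists_walk_length_le_diam [Finite V] (hG : G.Connected) (u w : V) :
    ∃ p : G.Walk u w, p.length ≤ G.diam := by
  have := hG.nonempty
  obtain ⟨p, hp⟩ := hG.exists_walk_length_eq_dist u w
  exact ⟨p, hp.trans_le (SimpleGraph.dist_le_diam (SimpleGraph.connected_iff_ediam_ne_top.1 hG))⟩

variable (hG : G.Connected)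
include hG

theorem spread (u : V) {f : Rumor T} {s : ℝ}
    (h : By G port adv ω (fun c => f ∈ logs c u ∨ SomeDecided c) s) (w : V) :
    By G port adv ω (fun c => f ∈ logs c w ∨ SomeDecided c) (s + B * G.diam) := by
  obtain ⟨p, hp⟩ := exists_walk_length_le_diam hG u w
  exact (spread_walk hadv hlab hτ hB p h).mono (by gcongr) fun _ h => h

theorem not_undecided_of_someDecided {s : ℝ} (h : By G port adv ω SomeDecided s) (w : V) :
    By G port adv ω (fun c => ¬ Undecided (logs c w)) (s + B * G.diam) := by
  obtain ⟨k, ⟨u, hu⟩, hk⟩ := h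
  obtain ⟨p, hp⟩ := exists_walk_length_le_diam hG u w
  exact (not_undecided_walk hadv hlab hτ hB p ⟨k, hu, hk⟩).mono (by gcongr) fun _ h => h

end Spread

end Time

/-! ### Sizes of logs and numbers of messages -/

section Size

variable {V : Type} {T t τ : ℕ} [Fintype V] {ω : (gossip T t τ).Coins V}
  {L : V → List (Rumor T)} {v : V}

open Classical in
/-- The nodes that are candidates once they are awake. -/
noncomputable def luckyNodes (ω : (gossip T t τ).Coins V) : Finset V :=
  Finset.univ.filter fun v => Lucky t (label ω v)

theorem mem_luckyNodes : v ∈ luckyNodes ω ↔ Lucky t (label ω v) := by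
  simp [luckyNodes]

theorem Sound.exists_lucky_of_cand_mem (S : Sound (label ω) t τ L) {x : Label T}
    (h : Rumor.cand x ∈ L v) : ∃ u ∈ luckyNodes ω, label ω u = x := by
  obtain ⟨u, rfl, hu⟩ := S.owned v _ _ h rfl
  exact ⟨u, mem_luckyNodes.2 (S.lucky_of_cand u hu), rfl⟩

theorem Sound.rumor_cases (S : Sound (label ω) t τ L) {f : Rumor T} (hf : f ∈ L v) :
    f = .hello ∨ (∃ u ∈ luckyNodes ω, f = .cand (label ω u)) ∨
      (∃ u ∈ luckyNodes ω, ∃ z ∈ hits (label ω) L u u, f = .wit (label ω u) (label ω z)) ∨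
      (∃ u ∈ luckyNodes ω, ∃ s, f = .done (label ω u) s) ∨ ∃ x, f = .elect x := by
  cases f with
  | hello => simp
  | cand x =>
    obtain ⟨u, hu, rfl⟩ := S.exists_lucky_of_cand_mem hf
    exact Or.inr (Or.inl ⟨u, hu, rfl⟩)
  | wit x w =>
    obtain ⟨z, rfl, hz⟩ := S.owned v _ _ hf rfl
    obtain ⟨hcand, hne, -⟩ := S.wit_spec z x hz
    obtain ⟨u, hu, rfl⟩ := S.exists_lucky_of_cand_mem hcand
    exact Or.inr (Or.inr (Or.inl ⟨u, hu, z,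
      mem_hits.2 ⟨mem_draws.2 ⟨fun h => hne (h ▸ rfl), hcand, Precedes.irrefl⟩, hz⟩, rfl⟩))
  | done x s =>
    obtain ⟨u, rfl, hu⟩ := S.owned v _ _ hf rfl
    have hlucky := S.lucky_of_cand u (S.done_spec u s hu).2.1.mem_left
    exact Or.inr (Or.inr (Or.inr (Or.inl ⟨u, mem_luckyNodes.2 hlucky, s, rfl⟩)))
  | elect x => exact Or.inr (Or.inr (Or.inr (Or.inr ⟨x, rfl⟩)))

open Classical in
theorem Sound.card_done_le (S : Sound (label ω) t τ L) (hlab : Function.Injective (label ω))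
    (v : V) : ((L v).toFinset.filter fun f => ∃ u ∈ luckyNodes ω, ∃ s,
      f = .done (label ω u) s).card ≤ (luckyNodes ω).card := by
  refine (Finset.card_le_card_of_injOn (t := (luckyNodes ω).image fun u => some (label ω u))
    Rumor.owner ?_ ?_).trans Finset.card_image_le
  · intro f hf
    obtain ⟨-, u, hu, s, rfl⟩ := Finset.mem_filter.1 hf
    exact Finset.mem_image_of_mem _ hu
  · intro f hf g hg h
    obtain ⟨hf, u, -, s, rfl⟩ := Finset.mem_filter.1 hf
    obtain ⟨hg, u', -, s', rfl⟩ := Finset.mem_filter.1 hg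
    rw [hlab (Option.some.inj h)] at hf ⊢
    rw [S.done_unique_of_mem hlab (List.mem_toFinset.1 hf) (List.mem_toFinset.1 hg)]

open Classical in
omit [Fintype V] in
theorem Sound.card_elect_le (S : Sound (label ω) t τ L) (v : V) :
    ((L v).toFinset.filter fun f => ∃ x, f = .elect x).card ≤ 1 := by
  refine Finset.card_le_one.2 fun f hf g hg => ?_
  obtain ⟨hf, x, rfl⟩ := Finset.mem_filter.1 hf
  obtain ⟨hg, y, rfl⟩ := Finset.mem_filter.1 hg
  rw [S.elect_unique v x y (List.mem_toFinset.1 hf) (List.mem_toFinset.1 hg)]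

theorem Sound.length_le (S : Sound (label ω) t τ L) (hlab : Function.Injective (label ω))
    {k U : ℕ} (hk : (luckyNodes ω).card ≤ k) (hU : ∀ u, (hits (label ω) L u u).card ≤ U) (v : V) :
    (L v).length ≤ 1 + k + k * U + k + 1 := by
  classical
  let cands : Finset (Rumor T) := (luckyNodes ω).image fun u => .cand (label ω u)
  let wits : Finset (Rumor T) := (luckyNodes ω).biUnion fun u =>
    (hits (label ω) L u u).image fun z => .wit (label ω u) (label ω z)
  let dones := (L v).toFinset.filter fun f => ∃ u ∈ luckyNodes ω, ∃ s, f = .done (label ω u) s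
  let elects := (L v).toFinset.filter fun f => ∃ x, f = .elect x
  have hcover : (L v).toFinset ⊆ {.hello} ∪ cands ∪ wits ∪ dones ∪ elects := fun f hf => by
    have hcases := S.rumor_cases (List.mem_toFinset.1 hf)
    simp only [cands, wits, dones, elects, Finset.mem_union, Finset.mem_singleton,
      Finset.mem_image, Finset.mem_biUnion, Finset.mem_filter, hf, true_and]
    grind
  have hwits : wits.card ≤ k * U := by
    refine Finset.card_biUnion_le.trans ((Finset.sum_le_card_nsmul _ _ U fun u _ =>
      Finset.card_image_le.trans (hU u)).trans ?_)
    rw [smul_eq_mul]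
    gcongr
  rw [← List.toFinset_card_of_nodup (S.nodup v)]
  calc (L v).toFinset.card ≤ ({.hello} ∪ cands ∪ wits ∪ dones ∪ elects).card :=
        Finset.card_le_card hcover
    _ ≤ ({.hello} : Finset (Rumor T)).card + cands.card + wits.card + dones.card + elects.card := by
        refine (Finset.card_union_le _ _).trans (Nat.add_le_add_right ?_ _)
        refine (Finset.card_union_le _ _).trans (Nat.add_le_add_right ?_ _)
        refine (Finset.card_union_le _ _).trans (Nat.add_le_add_right ?_ _)
        exact Finset.card_union_le _ _
    _ ≤ 1 + k + k * U + k + 1 := by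
        gcongr
        · exact (Finset.card_singleton _).le
        · exact Finset.card_image_le.trans hk
        · exact (S.card_done_le hlab v).trans hk
        · exact S.card_elect_le v

theorem Valid.sent_le {G : SimpleGraph V} [DecidableRel G.Adj]
    {c : (gossip T t τ).Config V} (I : Valid G ω c) {B : ℕ} (hB : ∀ v, (logs c v).length ≤ B) :
    c.sent ≤ 2 * G.edgeFinset.card * B := by
  rw [I.sent_eq, ← G.sum_degrees_eq_twice_card_edges, Finset.sum_mul]
  exact Finset.sum_le_sum fun v _ => Nat.mul_le_mul_left _ (hB v)

end Size

/-! ### The four phases until a leader is elected -/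

section Election

variable {V : Type} {T t τ : ℕ} [Fintype V] {G : SimpleGraph V} [DecidableRel G.Adj]
  {port : V → V → ℕ} {ω : (gossip T t τ).Coins V} {c : (gossip T t τ).Config V} {u v : V}
  {x : Label T}

theorem leaderOf_mem {K : Finset (Label T)} (hK : K.Nonempty) (σ : Label T → ℕ) :
    leaderOf K σ ∈ K :=
  (Classical.epsilon_spec (p := fun x => x ∈ K ∧ ∀ y ∈ K, σ x ≤ σ y)
    (K.exists_min_image σ hK)).1

omit [Fintype V] in
theorem Certified.exists_eq {lab : V → Label T} {L : V → List (Rumor T)}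
    (h : Certified lab L x) : ∃ u, lab u = x := by
  obtain ⟨K, σ, hK, rfl⟩ := h
  obtain ⟨u, -, hu, -⟩ := hK.exists_done _ (leaderOf_mem hK.nonempty σ)
  exact ⟨u, hu⟩

theorem Valid.output_eq (I : Valid G ω c) (hlab : Function.Injective (label ω))
    (hN : NoSplit (label ω) τ (logs c)) (hx : Rumor.elect x ∈ logs c u)
    (hv : ¬ Undecided (logs c v)) {y : (gossip T t τ).Node} (hy : c.node v = some y) :
    (gossip T t τ).output y.state = some (decide (x = label ω v), x) := by
  have hex : ∃ z, Rumor.elect z ∈ GossipState.log y.state := by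
    simpa only [Undecided, not_forall, not_not, logs_of_some hy] using hv
  have hchoose : hex.choose = x :=
    I.sound.certified_unique hlab hN
      (I.sound.elect_spec v _ (by rw [logs_of_some hy]; exact hex.choose_spec))
      (I.sound.elect_spec u x hx)
  simp only [gossip, dif_pos hex, hchoose, (I.node v y hy).me_eq]

theorem Valid.leaderElected (I : Valid G ω c) (hlab : Function.Injective (label ω))
    (hN : NoSplit (label ω) τ (logs c)) [Nonempty V] (h : ∀ v, ¬ Undecided (logs c v)) :
    LeaderElected c := by
  have hdecided : ∀ v, ∃ x, Rumor.elect x ∈ logs c v := by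
    simpa only [Undecided, not_forall, not_not] using h
  have hawake (v : V) : ∃ y, c.node v = some y :=
    Option.ne_none_iff_exists'.1 (awake_of_mem (hdecided v).choose_spec)
  obtain ⟨x, hx⟩ := hdecided (Classical.arbitrary V)
  obtain ⟨u, rfl⟩ := (I.sound.elect_spec _ x hx).exists_eq
  obtain ⟨y, hy⟩ := hawake u
  refine ⟨u, y, hy, ?_, fun v hvu => ?_⟩
  · rw [I.output_eq hlab hN hx (h u) hy, (I.node u y hy).ident_eq, decide_eq_true rfl]
  · obtain ⟨z, hz⟩ := hawake v
    have hne : label ω v ≠ label ω u := fun h => hvu (hlab h)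
    refine ⟨z, hz, ?_, ?_⟩
    · rwa [(I.node u y hy).ident_eq, (I.node v z hz).ident_eq]
    · rw [I.output_eq hlab hN hx (h v) hz, (I.node u y hy).ident_eq, decide_eq_false hne.symm]

theorem Valid.exists_done (I : Valid G ω c) (hcand : Rumor.cand (label ω u) ∈ logs c u)
    (hwits : τ ≤ (wits (label ω u) (logs c u)).card) :
    ∃ s, Rumor.done (label ω u) s ∈ logs c u := by
  by_contra! hno
  exact (I.settled u).1 ⟨hcand, hno, hwits⟩

theorem Valid.someDecided (I : Valid G ω c) (hu : Lucky t (label ω u))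
    (hdone : ∀ v ∈ luckyNodes ω, ∃ s, Rumor.done (label ω v) s ∈ logs c u) : SomeDecided c := by
  refine ⟨u, fun hund => (I.settled u).2 ⟨hund, ⟨label ω u, ?_⟩, fun x hx => ?_⟩⟩
  · obtain ⟨s, hs⟩ := hdone u (mem_luckyNodes.2 hu)
    exact I.sound.cand_of_lucky u (I.hello_mem (awake_of_mem hs)) hu
  · obtain ⟨v, hv, rfl⟩ := I.sound.exists_lucky_of_cand_mem hx
    exact hdone v hv

variable [DecidableEq V] {adv : Adversary (gossip T t τ) V} {s s' : ℝ}
  {X Y : (gossip T t τ).Config V → Prop}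

section Phases

variable (hadv : adv.IsLegal G port) (hlab : Function.Injective (label ω)) (hτ : 1 ≤ τ)

include hadv in
theorem by_awake : By G port adv ω (fun c => ∃ v, c.node v ≠ none) 0 := by
  have hallowed := hadv ω 0
  have hconfig : config G port adv ω 1 = step G port ω ((gossip T t τ).start V)
    (adv (trace G port adv ω 0).1 (trace G port adv ω 0).2) := rfl
  generalize adv (trace G port adv ω 0).1 (trace G port adv ω 0).2 = act at hallowed hconfig
  obtain _ | ⟨s, v | ⟨u, w⟩⟩ := act
  · exact absurd rfl hallowed.1.choose_spec
  · have hs : s = 0 := hallowed.2.1 fun v => rfl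
    refine ⟨1, ⟨v, ?_⟩, ?_⟩
    · rw [hconfig]
      exact node_wakeUp_ne_none (G := G) (c := { (gossip T t τ).start V with now := s })
    · rw [hconfig]
      exact (now_wakeUp.trans hs).le
  · exact absurd rfl hallowed.2.2.2

variable {B : ℕ} (hB : ∀ k v, (logs (config G port adv ω k) v).length ≤ B) (hG : G.Connected)
include hadv hlab hτ hB hG

theorem By.flood (h : By G port adv ω (fun c => X c ∨ SomeDecided c) s) (hs : 0 ≤ s)
    (hXY : ∀ k, X (config G port adv ω k) → ∃ F : V → Finset (Rumor T),
      (∀ w, ∀ f ∈ F w, ∃ u, f ∈ logs (config G port adv ω k) u) ∧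
      ∀ j, (∀ w, ∀ f ∈ F w, f ∈ logs (config G port adv ω j) w) → Y (config G port adv ω j)) :
    By G port adv ω (fun c => Y c ∨ SomeDecided c) (s + B * G.diam) := by
  have hd : 0 ≤ s + B * G.diam := by positivity
  obtain ⟨k, hk | hk, hnow⟩ := h
  · obtain ⟨F, hknown, hY⟩ := hXY k hk
    have hspread (i : Σ w, F w) :
        By G port adv ω (fun c => (i.2 : Rumor T) ∈ logs c i.1 ∨ SomeDecided c)
          (s + B * G.diam) := by
      obtain ⟨u, hu⟩ := hknown i.1 i.2 i.2.2
      exact spread hadv hlab hτ hB hG u ⟨k, Or.inl hu, hnow⟩ i.1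
    exact (by_forall_or_someDecided hadv hlab hτ hd
      (fun i _ _ A h => (A.log i.1).subset h) hspread).mono le_rfl fun j h =>
        h.imp_left fun h => hY j fun w f hf => h ⟨w, f, hf⟩
  · exact ⟨k, Or.inr hk, hnow.trans (le_add_of_nonneg_right (by positivity))⟩

theorem by_hello :
    By G port adv ω (fun c => (∀ v, Rumor.hello ∈ logs c v) ∨ SomeDecided c) (B * G.diam) := by
  rw [← zero_add ((B : ℝ) * G.diam)]
  refine By.flood (X := fun c => ∃ v, c.node v ≠ none) hadv hlab hτ hB hG
    ((by_awake hadv).mono le_rfl fun _ => Or.inl) le_rfl fun k ⟨v, hv⟩ =>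
      ⟨fun _ => {.hello}, fun w f hf => ⟨v, ?_⟩, fun j h w => ?_⟩
  · rw [Finset.mem_singleton.1 hf]
    exact (valid_config hadv hlab hτ k).hello_mem hv
  · exact h w _ (Finset.mem_singleton_self _)

theorem by_cand :
    By G port adv ω (fun c => (∀ v, ∀ u ∈ luckyNodes ω, Rumor.cand (label ω u) ∈ logs c v) ∨
      SomeDecided c) (2 * (B * G.diam)) := by
  classical
  rw [two_mul]
  refine By.flood hadv hlab hτ hB hG (by_hello hadv hlab hτ hB hG) (by positivity)
    fun k hk => ⟨fun _ => (luckyNodes ω).image fun u => .cand (label ω u), fun w f hf => ?_,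
      fun j h w u hu => h w _ (Finset.mem_image_of_mem _ hu)⟩
  obtain ⟨u, hu, rfl⟩ := Finset.mem_image.1 hf
  exact ⟨u, (valid_config hadv hlab hτ k).sound.cand_of_lucky u (hk u) (mem_luckyNodes.1 hu)⟩

variable (hhit : ∀ k u,
  (∀ z, z ≠ u → z ∈ draws (label ω) (logs (config G port adv ω k)) u u) →
    τ ≤ (hits (label ω) (logs (config G port adv ω k)) u u).card)
include hhit

theorem by_done :
    By G port adv ω (fun c => (∀ u ∈ luckyNodes ω, ∃ s, Rumor.done (label ω u) s ∈ logs c u) ∨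
      SomeDecided c) (3 * (B * G.diam)) := by
  classical
  rw [show 3 * ((B : ℝ) * G.diam) = 2 * (B * G.diam) + B * G.diam by ring]
  refine By.flood hadv hlab hτ hB hG (by_cand hadv hlab hτ hB hG) (by positivity) fun k hk =>
    ⟨fun u => if u ∈ luckyNodes ω then insert (.cand (label ω u))
      ((hits (label ω) (logs (config G port adv ω k)) u u).image
        fun z => .wit (label ω u) (label ω z)) else ∅, fun u f hf => ?_, fun j h u hu => ?_⟩
  · by_cases hu : u ∈ luckyNodes ω
    · simp only [if_pos hu, Finset.mem_insert, Finset.mem_image] at hf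
      obtain rfl | ⟨z, hz, rfl⟩ := hf
      · exact ⟨u, hk u u hu⟩
      · exact ⟨z, (mem_hits.1 hz).2⟩
    · simp [if_neg hu] at hf
  · specialize h u
    simp only [if_pos hu, Finset.forall_mem_insert, Finset.forall_mem_image] at h
    refine (valid_config hadv hlab hτ j).exists_done h.1 ((hhit k u fun z hz =>
      mem_draws.2 ⟨hz, hk z u hu, Precedes.irrefl⟩).trans ?_)
    rw [← Finset.card_image_of_injective _ hlab]
    refine Finset.card_le_card fun w hw => ?_
    obtain ⟨z, hz, rfl⟩ := Finset.mem_image.1 hw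
    exact mem_wits.2 (h.2 hz)

theorem by_someDecided (hcand : ∃ u, Lucky t (label ω u)) :
    By G port adv ω SomeDecided (4 * (B * G.diam)) := by
  classical
  obtain ⟨u, hu⟩ := hcand
  rw [show 4 * ((B : ℝ) * G.diam) = 3 * (B * G.diam) + B * G.diam by ring]
  refine (By.flood (Y := SomeDecided) hadv hlab hτ hB hG (by_done hadv hlab hτ hB hG hhit)
    (by positivity) fun k hk => ?_).mono le_rfl fun _ => or_self_iff.1
  choose! s hs using hk
  refine ⟨fun _ => (luckyNodes ω).image fun v => .done (label ω v) (s v), fun w f hf => ?_,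
    fun j h => (valid_config hadv hlab hτ j).someDecided hu fun v hv =>
      ⟨s v, h u _ (Finset.mem_image_of_mem _ hv)⟩⟩
  obtain ⟨v, hv, rfl⟩ := Finset.mem_image.1 hf
  exact ⟨v, hs v hv⟩

theorem solvesWithin (hcand : ∃ u, Lucky t (label ω u))
    (hN : ∀ k, NoSplit (label ω) τ (logs (config G port adv ω k))) :
    SolvesWithin G port adv ω (5 * (B * G.diam)) := by
  have := hG.nonempty
  have hdecided (w : V) :
      By G port adv ω (fun c => ¬ Undecided (logs c w)) (5 * (B * G.diam)) :=
    (not_undecided_of_someDecided hadv hlab hτ hB hG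
      (by_someDecided hadv hlab hτ hB hG hhit hcand) w).mono (by linarith) fun _ h => h
  obtain ⟨k, hk, hnow⟩ := by_forall (X := fun w c => ¬ Undecided (logs c w)) hadv hlab hτ
    (by positivity) (fun _ _ _ A => A.not_undecided) hdecided
  exact ⟨k, (valid_config hadv hlab hτ k).leaderElected hlab (hN k) hk, hnow⟩

end Phases
end Election

/-! ### Executions depend only on the coins that have been flipped -/

section Locality

variable {P : Protocol} {V : Type}

/-- The coins that have been flipped in the configuration `c`. -/
def flipped (c : P.Config V) : Set (V × ℕ × Fin P.coins) :=
  {p | p.2.1 < flipCount c p.1}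

variable [Fintype V] [DecidableEq V] (G : SimpleGraph V) [DecidableRel G.Adj] (port : V → V → ℕ)
  (adv : Adversary P V) {ω ω' : P.Coins V} {c : P.Config V}

theorem flipCount_wakeUp_mem_Icc (ω : P.Coins V) (c : P.Config V) (v a : V) :
    flipCount (wakeUp G port ω c v) a ∈ Set.Icc (flipCount c a) (flipCount c a + 1) := by
  by_cases ha : a = v
  · subst ha
    cases h : c.node a with
    | none => simp [wakeUp, emit, flipCount, h]
    | some x => simp [wakeUp, h]
  · simp [flipCount, node_wakeUp_of_ne ha]

theorem flipCount_accept_mem_Icc (ω : P.Coins V) (c : P.Config V) (u w : V) (M : P.Msg) (a : V) :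
    flipCount (accept G port ω c u w M) a ∈ Set.Icc (flipCount c a) (flipCount c a + 1) := by
  by_cases ha : a = w
  · subst ha
    cases h : c.node a with
    | none => simp [accept, h]
    | some x =>
      by_cases hout : (P.output x.state).isSome = true
      · simp [accept, h, hout]
      · simp [accept, h, hout, emit, flipCount]
  · simp [flipCount, node_accept_of_ne ha]

theorem wakeUp_congr {v : V} (h : Set.EqOn ω ω' (flipped (wakeUp G port ω c v))) :
    wakeUp G port ω' c v = wakeUp G port ω c v := by
  by_cases hv : c.node v = none
  · have hblock : (fun i => ω' (v, 0, i)) = fun i => ω (v, 0, i) := by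
      funext i
      refine (h ?_).symm
      simp [flipped, wakeUp, hv, emit, flipCount]
    simp only [wakeUp, hv, hblock]
  · rw [wakeUp_of_awake hv, wakeUp_of_awake hv]

theorem accept_congr {u w : V} {M : P.Msg}
    (h : Set.EqOn ω ω' (flipped (accept G port ω c u w M))) :
    accept G port ω' c u w M = accept G port ω c u w M := by
  cases hw : c.node w with
  | none => simp only [accept, hw]
  | some x =>
    by_cases hout : (P.output x.state).isSome = true
    · simp only [accept, hw, if_pos hout]
    · have hblock : (fun i => ω' (w, x.flips.length, i)) = fun i => ω (w, x.flips.length, i) := by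
        funext i
        refine (h ?_).symm
        simp [flipped, accept, hw, hout, emit, flipCount]
      simp only [accept, hw, if_neg hout, hblock]

theorem arrive_of_queue_eq_nil {u w : V} (h : c.queue u w = []) : arrive G port ω c u w = c := by
  rw [arrive, h]

theorem arrive_of_queue_eq_cons {u w : V} {M : P.Msg} {r : List P.Msg} (h : c.queue u w = M :: r) :
    arrive G port ω c u w = accept G port ω (wakeUp G port ω (pop c u w r) w) u w M := by
  rw [arrive, h]
  rfl

theorem flipCount_step_mem_Icc (ω : P.Coins V) (c : P.Config V) (act : Option (ℝ × Action V))
    (a : V) : flipCount (step G port ω c act) a ∈ Set.Icc (flipCount c a) (flipCount c a + 2) := by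
  obtain _ | ⟨s, v | ⟨u, w⟩⟩ := act
  · simp [step]
  · have hwake := flipCount_wakeUp_mem_Icc G port ω { c with now := s } v a
    exact ⟨hwake.1, hwake.2.trans (Nat.le_succ _)⟩
  · cases hq : c.queue u w with
    | nil => simp [step, arrive_of_queue_eq_nil (c := { c with now := s }) G port hq, flipCount]
    | cons M r =>
      rw [step, arrive_of_queue_eq_cons (c := { c with now := s }) G port hq]
      have hwake := flipCount_wakeUp_mem_Icc G port ω (pop { c with now := s } u w r) w a
      have haccept := flipCount_accept_mem_Icc G port ω
        (wakeUp G port ω (pop { c with now := s } u w r) w) u w M a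
      exact ⟨hwake.1.trans haccept.1, haccept.2.trans (Nat.succ_le_succ hwake.2)⟩

theorem step_congr {act : Option (ℝ × Action V)}
    (h : Set.EqOn ω ω' (flipped (step G port ω c act))) :
    step G port ω' c act = step G port ω c act := by
  obtain _ | ⟨s, v | ⟨u, w⟩⟩ := act
  · rfl
  · exact wakeUp_congr G port h
  · cases hq : c.queue u w with
    | nil => simp only [step, arrive_of_queue_eq_nil (c := { c with now := s }) G port hq]
    | cons M r =>
      rw [step, arrive_of_queue_eq_cons (c := { c with now := s }) G port hq] at h
      rw [step, step, arrive_of_queue_eq_cons (c := { c with now := s }) G port hq,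
        arrive_of_queue_eq_cons (c := { c with now := s }) G port hq,
        wakeUp_congr G port (h.mono fun p hp => ?_), accept_congr G port h]
      exact hp.trans_le (flipCount_accept_mem_Icc G port ω _ u w M p.1).1

theorem flipCount_config_le (ω : P.Coins V) (k : ℕ) (v : V) :
    flipCount (config G port adv ω k) v ≤ 2 * k := by
  induction k with
  | zero => exact Nat.le_refl 0
  | succ k ih =>
    exact (flipCount_step_mem_Icc G port ω (config G port adv ω k) _ v).2.trans
      (Nat.add_le_add_right ih 2)

theorem trace_congr (k : ℕ) (h : Set.EqOn ω ω' (flipped (config G port adv ω k))) :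
    trace G port adv ω' k = trace G port adv ω k := by
  induction k with
  | zero => rfl
  | succ k ih =>
    have htrace := ih (h.mono fun p hp =>
      hp.trans_le (flipCount_step_mem_Icc G port ω (config G port adv ω k) _ p.1).1)
    rw [trace, trace, htrace]
    exact Prod.ext rfl (step_congr G port h)

end Locality

/-! ### Which coins decide whether a node becomes a witness -/

section Ask

variable {V : Type} {T t τ : ℕ} [Fintype V] [DecidableEq V] {G : SimpleGraph V}
  [DecidableRel G.Adj] {port : V → V → ℕ} {ω : (gossip T t τ).Coins V}
  {c : (gossip T t τ).Config V} {a u v w : V} {f : Rumor T} {r : List (Rumor T)}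

open Classical in
theorem logs_wakeUp_self (ω : (gossip T t τ).Coins V) (c : (gossip T t τ).Config V) (w : V) :
    logs (wakeUp G port ω c w) w =
      if c.node w = none then initLog t (label ω w) else logs c w := by
  split_ifs with h
  · rw [(effect_wakeUp h).logs, pushLog_self, logs_of_none h, List.nil_append]
  · rw [wakeUp_of_awake h]

theorem Valid.flipCount_wakeUp_self (I : Valid G ω c) (w : V) :
    flipCount (Protocol.wakeUp G port ω c w) w = max 1 (flipCount c w) := by
  cases h : c.node w with
  | none => rw [flipCount_of_some (node_wakeUp h), flipCount_of_none h]; rfl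
  | some x =>
    rw [wakeUp_of_awake (by simp [h]), flipCount_of_some h, max_eq_right (I.node w x h).flips_pos]

theorem draws_wakeUp (hlab : Function.Injective (label ω)) (w u v : V) :
    draws (label ω) (logs (wakeUp G port ω c w)) u v = draws (label ω) (logs c) u v := by
  by_cases h : c.node w = none
  · rw [(effect_wakeUp h).logs, draws_initLog hlab (logs_of_none h)]
  · rw [wakeUp_of_awake h]

theorem hits_wakeUp (hlab : Function.Injective (label ω)) (w u v : V) :
    hits (label ω) (logs (wakeUp G port ω c w)) u v = hits (label ω) (logs c) u v := by
  by_cases h : c.node w = none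
  · rw [(effect_wakeUp h).logs, hits_initLog hlab (logs_of_none h)]
  · rw [wakeUp_of_awake h]

theorem Valid.logs_arrive (I : Valid G ω c) (hlab : Function.Injective (label ω)) (hτ : 1 ≤ τ)
    (hq : c.queue a w = f :: r) :
    logs (arrive G port ω c a w) = pushLog (logs (Protocol.wakeUp G port ω c w)) w
      (arrivalNews ω (Protocol.wakeUp G port ω c w) w f) := by
  have hne : a ≠ w := (I.fifo.adj a w (by simp [hq])).ne
  obtain ⟨x, hx⟩ := Option.ne_none_iff_exists'.1
    (node_wakeUp_ne_none (G := G) (port := port) (ω := ω) (c := c) (v := w))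
  rw [arrive_eq hq hne, ((I.wakeUp hlab hτ w).effect_accept_pop hx hne f r).logs]

theorem Valid.draws_arrive_of_samples (I : Valid G ω c) (hlab : Function.Injective (label ω))
    (hτ : 1 ≤ τ) (hq : c.queue a w = f :: r)
    (hund : Undecided (logs (Protocol.wakeUp G port ω c w) w))
    (h : Samples (label ω) (logs (Protocol.wakeUp G port ω c w) w) u v w f) :
    (draws (label ω) (logs (arrive G port ω c a w)) u v).card =
      (draws (label ω) (logs c) u v).card + 1 := by
  rw [I.logs_arrive hlab hτ hq, arrivalNews, if_pos hund, h.draws_news,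
    Finset.card_insert_of_notMem h.notMem_draws, draws_wakeUp hlab]

open Classical in
theorem Valid.hits_arrive_of_samples (I : Valid G ω c) (hlab : Function.Injective (label ω))
    (hτ : 1 ≤ τ) (hq : c.queue a w = f :: r)
    (hund : Undecided (logs (Protocol.wakeUp G port ω c w) w))
    (h : Samples (label ω) (logs (Protocol.wakeUp G port ω c w) w) u v w f) :
    (hits (label ω) (logs (arrive G port ω c a w)) u v).card =
      (hits (label ω) (logs c) u v).card +
        if Lucky t (block ω w (flipCount (Protocol.wakeUp G port ω c w) w)) then 1 else 0 := by
  rw [I.logs_arrive hlab hτ hq, arrivalNews, if_pos hund,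
    h.hits_news (I.wakeUp hlab hτ w).sound]
  split_ifs
  · rw [Finset.card_insert_of_notMem h.notMem_hits, hits_wakeUp hlab]
  · rw [hits_wakeUp hlab, add_zero]

theorem Valid.arrive_of_not_samples (I : Valid G ω c) (hlab : Function.Injective (label ω))
    (hτ : 1 ≤ τ) (hq : c.queue a w = f :: r)
    (h : ¬ (Undecided (logs (Protocol.wakeUp G port ω c w) w) ∧
      Samples (label ω) (logs (Protocol.wakeUp G port ω c w) w) u v w f)) :
    draws (label ω) (logs (arrive G port ω c a w)) u v = draws (label ω) (logs c) u v ∧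
      hits (label ω) (logs (arrive G port ω c a w)) u v = hits (label ω) (logs c) u v := by
  rw [I.logs_arrive hlab hτ hq, ← draws_wakeUp (G := G) (port := port) hlab w,
    ← hits_wakeUp (G := G) (port := port) hlab w, arrivalNews]
  split_ifs with hund
  · have I₁ := I.wakeUp (port := port) hlab hτ w
    have hq₁ : (Protocol.wakeUp G port ω c w).queue a w ≠ [] :=
      queue_wakeUp_ne_nil (by simp [hq])
    have hf : f ∈ logs (Protocol.wakeUp G port ω c w) a := I₁.fifo.mem_sender (r := r) <|
      (queue_wakeUp_of_ne (I₁.fifo.adj a w hq₁).ne).trans hq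
    have hS := fun hS => h ⟨hund, hS⟩
    exact ⟨draws_news_of_not_samples hS, hits_news_of_not_samples I₁.sound hlab hf hS⟩
  · rw [pushLog_nil]
    exact ⟨rfl, rfl⟩

open Classical in
/-- The node and the block of coins that are used if, in the configuration `c`, the action `act`
makes a node that has not heard of `v` sample whether to become a witness for `u`. -/
noncomputable def askAt (lab : V → Label T) (u v : V) (c : (gossip T t τ).Config V) :
    Option (ℝ × Action V) → Option (V × ℕ)
  | some (_, .deliver a w) =>
    match c.queue a w with
    | [] => none
    | f :: _ =>
      let l := if c.node w = none then initLog t (lab w) else logs c w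
      if Undecided l ∧ Samples lab l u v w f then some (w, max 1 (flipCount c w)) else none
  | _ => none

omit [Fintype V] [DecidableEq V] in
theorem snd_of_askAt_eq_some {lab : V → Label T} {act : Option (ℝ × Action V)} {j : ℕ}
    (h : askAt lab u v c act = some (w, j)) : j = max 1 (flipCount c w) := by
  unfold askAt at h
  split at h
  · split at h
    · cases h
    · obtain ⟨-, h⟩ := Option.ite_none_right_eq_some.1 h
      obtain ⟨rfl, rfl⟩ := Prod.mk.inj (Option.some.inj h)
      rfl
  · cases h

open Classical in
theorem Valid.askAt_deliver (I : Valid G ω c) (hq : c.queue a w = f :: r) (s : ℝ) :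
    askAt (label ω) u v c (some (s, .deliver a w)) =
      if Undecided (logs (Protocol.wakeUp G port ω c w) w) ∧
        Samples (label ω) (logs (Protocol.wakeUp G port ω c w) w) u v w f then
        some (w, flipCount (Protocol.wakeUp G port ω c w) w) else none := by
  rw [logs_wakeUp_self, I.flipCount_wakeUp_self]
  simp only [askAt, hq]

theorem Valid.step_of_askAt_eq_none (I : Valid G ω c) (hlab : Function.Injective (label ω))
    (hτ : 1 ≤ τ) {act : Option (ℝ × Action V)} (hact : Allowed c act)
    (h : askAt (label ω) u v c act = none) :
    draws (label ω) (logs (Protocol.step G port ω c act)) u v = draws (label ω) (logs c) u v ∧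
      hits (label ω) (logs (Protocol.step G port ω c act)) u v = hits (label ω) (logs c) u v := by
  obtain _ | ⟨s, b | ⟨a, w⟩⟩ := act
  · exact ⟨rfl, rfl⟩
  · exact ⟨draws_wakeUp (c := { c with now := s }) hlab b u v,
      hits_wakeUp (c := { c with now := s }) hlab b u v⟩
  · obtain ⟨f, r, hq⟩ := List.exists_cons_of_ne_nil hact.2.2.2
    have I₀ := I.tick hact.1
    refine I₀.arrive_of_not_samples hlab hτ hq fun hS => ?_
    have hask := (I₀.askAt_deliver (port := port) hq s).symm.trans h
    simp [hS] at hask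

open Classical in
theorem Valid.step_of_askAt_eq_some (I : Valid G ω c) (hlab : Function.Injective (label ω))
    (hτ : 1 ≤ τ) {act : Option (ℝ × Action V)} (hact : Allowed c act) {j : ℕ}
    (h : askAt (label ω) u v c act = some (w, j)) :
    (draws (label ω) (logs (Protocol.step G port ω c act)) u v).card =
        (draws (label ω) (logs c) u v).card + 1 ∧
      (hits (label ω) (logs (Protocol.step G port ω c act)) u v).card =
        (hits (label ω) (logs c) u v).card + if Lucky t (block ω w j) then 1 else 0 := by
  obtain _ | ⟨s, b | ⟨a, b⟩⟩ := act
  · simp [askAt] at h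
  · simp [askAt] at h
  · obtain ⟨f, r, hq⟩ := List.exists_cons_of_ne_nil hact.2.2.2
    have I₀ := I.tick hact.1
    have hask := (I₀.askAt_deliver (port := port) hq s).symm.trans h
    obtain ⟨⟨hund, hS⟩, hwj⟩ := Option.ite_none_right_eq_some.1 hask
    obtain ⟨rfl, rfl⟩ := Prod.mk.inj (Option.some.inj hwj)
    exact ⟨I₀.draws_arrive_of_samples hlab hτ hq hund hS,
      I₀.hits_arrive_of_samples hlab hτ hq hund hS⟩

end Ask

/-! ### The witnesses as an adaptive sample -/

section Bits

variable {V : Type} {T t τ : ℕ} {u v w : V} {j : ℕ} {N : V → ℕ}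

/-- The first `t` coins in the `j`-th block of the node `v`. -/
def bits (T t : ℕ) (v : V) (j : ℕ) : Finset (V × ℕ × Fin T) :=
  {v} ×ˢ ({j} ×ˢ Finset.univ.filter fun i : Fin T => i.val < t)

theorem mem_bits {p : V × ℕ × Fin T} :
    p ∈ bits T t v j ↔ p.1 = v ∧ p.2.1 = j ∧ p.2.2.val < t := by
  obtain ⟨a, b, i⟩ := p
  simp only [bits, Finset.mem_product, Finset.mem_singleton, Finset.mem_filter_univ]

theorem card_bits (ht : t ≤ T) (v : V) (j : ℕ) : (bits T t v j).card = t := by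
  simp [bits, Fin.card_filter_val_lt, ht]

theorem disjoint_bits (huv : u ≠ v) (i j : ℕ) : Disjoint (bits T t u i) (bits T t v j) :=
  Finset.disjoint_left.2 fun _ h h' => huv ((mem_bits.1 h).1.symm.trans (mem_bits.1 h').1)

theorem mem_shows_bits {ω : (gossip T t τ).Coins V} :
    ω ∈ Shows (bits T t v j) (fun _ => true) ↔ Lucky t (block ω v j) := by
  constructor
  · exact fun h i hi => h (v, j, i) (mem_bits.2 ⟨rfl, rfl, hi⟩)
  · rintro h ⟨a, b, i⟩ hp
    obtain ⟨rfl, rfl, hi⟩ := mem_bits.1 hp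
    exact h i hi

theorem fairCoins_label_eq_le (huv : u ≠ v) :
    fairCoins (V × ℕ × Fin T) {ω | ∀ i, ω (u, 0, i) = ω (v, 0, i)} ≤ 2⁻¹ ^ T := by
  let both (b : Label T) : Set (V × ℕ × Fin T → Bool) :=
    Shows (bits T T u 0) (fun p => b p.2.2) ∩ Shows (bits T T v 0) (fun p => b p.2.2)
  have hsub : {ω : V × ℕ × Fin T → Bool | ∀ i, ω (u, 0, i) = ω (v, 0, i)} ⊆
      {ω | ∃ b, ω ∈ both b} := by
    refine fun ω hω => ⟨fun i => ω (u, 0, i), ?_, ?_⟩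
    · rintro ⟨a, j, i⟩ hp
      obtain ⟨rfl, rfl, -⟩ := mem_bits.1 hp
      rfl
    · rintro ⟨a, j, i⟩ hp
      obtain ⟨rfl, rfl, -⟩ := mem_bits.1 hp
      exact (hω i).symm
  have hboth (b : Label T) : fairCoins _ (both b) = 2⁻¹ ^ T * 2⁻¹ ^ T := by
    rw [fairCoins_inter_shows (dependsOn_shows _ _) (disjoint_bits huv 0 0), fairCoins_shows,
      card_bits le_rfl, card_bits le_rfl]
  calc fairCoins _ {ω | ∀ i, ω (u, 0, i) = ω (v, 0, i)}
      ≤ Fintype.card (Label T) * (2⁻¹ ^ T * 2⁻¹ ^ T) :=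
        (measure_mono hsub).trans (measure_exists_le_card_mul _ fun b => (hboth b).le)
    _ = (2 * 2⁻¹) ^ T * 2⁻¹ ^ T := by
        simp [mul_pow, mul_assoc]
    _ = 2⁻¹ ^ T := by rw [ENNReal.mul_inv_cancel (by simp) (by simp), one_pow, one_mul]

variable [Fintype V]

/-- The coins in the first `N v` blocks of each node `v`. -/
def blocksBelow (T : ℕ) (N : V → ℕ) : Finset (V × ℕ × Fin T) :=
  (Finset.univ.sigma fun v => Finset.range (N v) ×ˢ Finset.univ).map
    (Equiv.sigmaEquivProd V (ℕ × Fin T)).toEmbedding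

theorem mem_blocksBelow {p : V × ℕ × Fin T} : p ∈ blocksBelow T N ↔ p.2.1 < N p.1 := by
  simp [blocksBelow, Finset.mem_map_equiv]

theorem block_eq_of_blocksBelow {ω ω' : (gossip T t τ).Coins V}
    (h : ∀ p ∈ blocksBelow T N, ω p = ω' p) (hj : j < N v) : block ω v j = block ω' v j :=
  funext fun i => h (v, j, i) (mem_blocksBelow.2 hj)

theorem disjoint_blocksBelow_bits (h : N v ≤ j) : Disjoint (blocksBelow T N) (bits T t v j) := by
  refine Finset.disjoint_left.2 fun p hp hp' => ?_
  obtain ⟨hv, hj, -⟩ := mem_bits.1 hp'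
  rw [mem_blocksBelow, hv, hj] at hp
  exact absurd hp h.not_gt

end Bits

section WitnessSampling

variable {V : Type} {T t τ : ℕ} [Fintype V] [DecidableEq V] {G : SimpleGraph V}
  [DecidableRel G.Adj] {port : V → V → ℕ} {adv : Adversary (gossip T t τ) V}
  {ω ω' : (gossip T t τ).Coins V} {N : V → ℕ}

/-- The labels and the course of the execution up to step `k`. -/
noncomputable def history (G : SimpleGraph V) [DecidableRel G.Adj] (port : V → V → ℕ)
    (adv : Adversary (gossip T t τ) V) (k : ℕ) (ω : (gossip T t τ).Coins V) :
    (V → Label T) × List ((gossip T t τ).Config V) × (gossip T t τ).Config V :=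
  (label ω, trace G port adv ω k)

theorem label_eq_of_history_eq {k : ℕ} (h : history G port adv k ω = history G port adv k ω') :
    label ω = label ω' :=
  congrArg Prod.fst h

theorem trace_eq_of_history_eq {k : ℕ} (h : history G port adv k ω = history G port adv k ω') :
    trace G port adv ω k = trace G port adv ω' k :=
  congrArg Prod.snd h

theorem history_congr {k : ℕ} (hpos : ∀ v, 0 < N v)
    (hN : ∀ v, flipCount (config G port adv ω k) v ≤ N v)
    (h : ∀ p ∈ blocksBelow T N, ω p = ω' p) : history G port adv k ω' = history G port adv k ω :=
  Prod.ext (funext fun v => (block_eq_of_blocksBelow h (hpos v)).symm)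
    (trace_congr G port adv k fun p hp => h p (mem_blocksBelow.2 (hp.trans_le (hN p.1))))

/-- The set of coins that are inspected in step `k` to decide whether a node that has not heard of
`v` becomes a witness for `u`. -/
noncomputable def askedBits (G : SimpleGraph V) [DecidableRel G.Adj] (port : V → V → ℕ)
    (adv : Adversary (gossip T t τ) V) (u v : V) (k : ℕ) (ω : (gossip T t τ).Coins V) :
    Option (Finset (V × ℕ × Fin T)) :=
  (askAt (label ω) u v (config G port adv ω k)
    (adv (trace G port adv ω k).1 (config G port adv ω k))).map fun p => bits T t p.1 p.2

theorem draws_config_zero (u v : V) :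
    draws (label ω) (logs (config G port adv ω 0)) u v = ∅ := by
  have hlogs (z : V) : logs (config G port adv ω 0) z = [] := rfl
  simp [draws, hlogs]

/-- The sampling of witnesses for `u` at nodes that have not heard of `v`. -/
noncomputable def witnessSampling (ht : t ≤ T) (hτ : 1 ≤ τ) (hadv : adv.IsLegal G port) (u v : V) :
    AdaptiveSampling (V × ℕ × Fin T)
      ((V → Label T) × List ((gossip T t τ).Config V) × (gossip T t τ).Config V) t where
  hist := history G port adv
  bound k := blocksBelow T fun _ => 2 * k + 1
  dependsOn_hist k ω ω' h := (history_congr (fun _ => Nat.succ_pos _)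
    (fun v => (flipCount_config_le G port adv ω k v).trans (Nat.le_succ _)) h).symm
  seen k ω := blocksBelow T fun a => max 1 (flipCount (config G port adv ω k) a)
  hist_eq_of_seen k ω ω' h := history_congr (fun _ => by simp) (fun _ => le_max_right _ _) h
  seen_congr k ω ω' h := by
    simp only [config, trace_eq_of_history_eq h]
  ask := askedBits G port adv u v
  ask_congr k ω ω' h := by
    rw [askedBits, askedBits, config, config, label_eq_of_history_eq h, trace_eq_of_history_eq h]
  disjoint_ask k ω B h := by
    obtain ⟨⟨w, j⟩, hwj, rfl⟩ := Option.map_eq_some_iff.1 h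
    exact disjoint_blocksBelow_bits (snd_of_askAt_eq_some hwj).ge
  card_ask k ω B h := by
    obtain ⟨⟨w, j⟩, -, rfl⟩ := Option.map_eq_some_iff.1 h
    exact card_bits ht w j
  good := {ω | Function.Injective (label ω)}
  good_congr k ω ω' h := congrArg Function.Injective (label_eq_of_history_eq h)
  tries k ω := (draws (label ω) (logs (config G port adv ω k)) u v).card
  tries_congr k ω ω' h := by
    simp only [config, label_eq_of_history_eq h, trace_eq_of_history_eq h]
  hits k ω := (hits (label ω) (logs (config G port adv ω k)) u v).card
  hits_congr k ω ω' h := by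
    simp only [config, label_eq_of_history_eq h, trace_eq_of_history_eq h]
  tries_zero ω := by rw [draws_config_zero, Finset.card_empty]
  hits_zero ω := by rw [hits, draws_config_zero, Finset.filter_empty, Finset.card_empty]
  tries_of_idle k ω hω h := congrArg Finset.card
    ((valid_config hadv hω hτ k).step_of_askAt_eq_none hω hτ (hadv ω k)
      (Option.map_eq_none_iff.1 h)).1
  hits_of_idle k ω hω h := congrArg Finset.card
    ((valid_config hadv hω hτ k).step_of_askAt_eq_none hω hτ (hadv ω k)
      (Option.map_eq_none_iff.1 h)).2
  tries_of_ask k ω B hω h := by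
    obtain ⟨⟨w, j⟩, hwj, rfl⟩ := Option.map_eq_some_iff.1 h
    exact ((valid_config hadv hω hτ k).step_of_askAt_eq_some hω hτ (hadv ω k) hwj).1
  hits_of_heads k ω B hω h hB := by
    obtain ⟨⟨w, j⟩, hwj, rfl⟩ := Option.map_eq_some_iff.1 h
    exact ((valid_config hadv hω hτ k).step_of_askAt_eq_some hω hτ (hadv ω k) hwj).2.trans
      (by rw [if_pos (mem_shows_bits.1 hB)])
  hits_of_not_heads k ω B hω h hB := by
    obtain ⟨⟨w, j⟩, hwj, rfl⟩ := Option.map_eq_some_iff.1 h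
    exact ((valid_config hadv hω hτ k).step_of_askAt_eq_some hω hτ (hadv ω k) hwj).2.trans
      (by rw [if_neg fun hl => hB (mem_shows_bits.2 hl), add_zero])

end WitnessSampling

/-! ### Bad luck is rare -/

section Rates

/-- The expected number of lucky nodes among `n` nodes. -/
noncomputable def rate (n t : ℕ) : ℝ := 2⁻¹ ^ t * n

theorem rate_nonneg (n t : ℕ) : 0 ≤ rate n t := by
  unfold rate
  positivity

theorem two_fifths_le_log : (2 / 5 : ℝ) ≤ Real.log (3 / 2) := by
  have hexp : Real.exp 2 ≤ (3 / 2) ^ 5 := by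
    have hsq : Real.exp 2 = Real.exp 1 ^ 2 := by rw [Real.exp_one_pow, Nat.cast_ofNat]
    nlinarith [Real.exp_one_lt_d9, Real.exp_pos 1]
  have hlog := (Real.le_log_iff_exp_le (by norm_num)).2 hexp
  rw [Real.log_pow] at hlog
  norm_num at hlog
  linarith

theorem neg_three_tenths_le_log : -(3 / 10 : ℝ) ≤ Real.log (3 / 4) := by
  rw [Real.le_log_iff_exp_le (by norm_num), Real.exp_neg, inv_le_comm₀ (Real.exp_pos _)
    (by norm_num)]
  linarith [Real.quadratic_le_exp_of_nonneg (x := 3 / 10) (by norm_num)]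

variable {n t h r : ℕ}

theorem two_inv_pow_mul_le_rate (hr : r ≤ n) : 2⁻¹ ^ t * (r : ℝ) ≤ rate n t := by
  unfold rate
  gcongr

theorem rate_div_le_of_few_tries (hh : 3 / 4 * rate n t ≤ h) (hr : 2 * r ≤ n) :
    rate n t / 50 ≤ Real.log (3 / 2) * h - 2⁻¹ ^ t * (3 / 2 - 1) * r := by
  have htries : 2⁻¹ ^ t * ((2 * r : ℕ) : ℝ) ≤ rate n t := two_inv_pow_mul_le_rate hr
  have hhits : (2 / 5 : ℝ) * h ≤ Real.log (3 / 2) * h := by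
    gcongr
    exact two_fifths_le_log
  push_cast at htries
  linarith [rate_nonneg n t]

theorem rate_div_le_of_many_hits (hh : 3 * rate n t ≤ h) (hr : r ≤ n) :
    rate n t / 50 ≤ Real.log 2 * h - 2⁻¹ ^ t * (2 - 1) * r := by
  have htries := two_inv_pow_mul_le_rate (t := t) hr
  have hhits : 0.6931471803 * (h : ℝ) ≤ Real.log 2 * h := by
    gcongr
    exact Real.log_two_gt_d9.le
  linarith [rate_nonneg n t]

theorem rate_div_le_of_few_hits (hh : h ≤ 3 / 4 * rate n t) (hr : n ≤ r + 1) (hn : 50 ≤ n) :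
    rate n t / 50 ≤ Real.log (3 / 4) * h - 2⁻¹ ^ t * (3 / 4 - 1) * r := by
  have htries : rate n t ≤ 2⁻¹ ^ t * ((r + 1 : ℕ) : ℝ) := by
    unfold rate
    gcongr
  have hone : 2⁻¹ ^ t * ((50 : ℕ) : ℝ) ≤ rate n t := two_inv_pow_mul_le_rate hn
  have hhits : -(3 / 10 : ℝ) * h ≤ Real.log (3 / 4) * h := by
    gcongr
    exact neg_three_tenths_le_log
  push_cast at htries hone
  linarith

end Rates

section Tails

variable {V : Type} {T t τ : ℕ} [Fintype V]

theorem card_draws_lt (lab : V → Label T) (L : V → List (Rumor T)) (u v : V) :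
    (draws lab L u v).card + 1 ≤ Fintype.card V :=
  Finset.card_lt_univ_of_notMem fun hu => (mem_draws.1 hu).1 rfl

variable (V τ) in
theorem measure_not_injective_label_le :
    (gossip T t τ).coinMeasure V {ω | ¬ Function.Injective (label ω)} ≤
      Fintype.card V ^ 2 * 2⁻¹ ^ T := by
  have hsub : {ω : (gossip T t τ).Coins V | ¬ Function.Injective (label ω)} ⊆
      {ω | ∃ p : V × V, p.1 ≠ p.2 ∧ ∀ i, ω (p.1, 0, i) = ω (p.2, 0, i)} := fun ω hω => by
    simp only [Set.mem_ofPred_eq, Function.Injective, not_forall] at hω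
    obtain ⟨u, v, huv, hne⟩ := hω
    exact ⟨(u, v), hne, congrFun huv⟩
  rw [sq, ← Nat.cast_mul, ← Fintype.card_prod]
  refine (measure_mono hsub).trans (measure_exists_le_card_mul _ fun p => ?_)
  by_cases hp : p.1 = p.2
  · simp [hp]
  · exact (measure_mono fun ω h => h.2).trans (fairCoins_label_eq_le hp)

section Candidates

variable (ht : t ≤ T)
include ht

theorem measure_luckyNodes_le_exp_neg {a : ℝ} (ha : 0 < a) (δ : ℝ) :
    (gossip T t τ).coinMeasure V {ω | δ ≤ Real.log a * (luckyNodes ω).card -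
      2⁻¹ ^ t * (a - 1) * Fintype.card V} ≤ ENNReal.ofReal (Real.exp (-δ)) := by
  classical
  have h := fairCoins_card_heads_le_exp_neg (B := fun v : V => bits T t v 0) (card_bits ht · 0)
    (fun _ _ huv => disjoint_bits huv 0 0) ha δ
  have hlucky (ω : (gossip T t τ).Coins V) : luckyNodes ω =
      Finset.univ.filter fun v => ω ∈ Shows (bits T t v 0) fun _ => true := by
    ext v
    rw [mem_luckyNodes, Finset.mem_filter_univ, mem_shows_bits]
    rfl
  simp only [hlucky]
  exact h

theorem measure_many_lucky_le {U : ℕ} (hU : 3 * rate (Fintype.card V) t ≤ U) :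
    (gossip T t τ).coinMeasure V {ω | U < (luckyNodes ω).card} ≤
      ENNReal.ofReal (Real.exp (-(rate (Fintype.card V) t / 50))) :=
  (measure_mono fun ω (hω : U < (luckyNodes ω).card) => rate_div_le_of_many_hits
    (hU.trans (by exact_mod_cast hω.le)) le_rfl).trans (measure_luckyNodes_le_exp_neg ht two_pos _)

theorem measure_no_lucky_le :
    (gossip T t τ).coinMeasure V {ω | luckyNodes ω = ∅} ≤
      ENNReal.ofReal (Real.exp (-(rate (Fintype.card V) t / 50))) := by
  refine (measure_mono fun ω (hω : luckyNodes ω = ∅) => ?_).trans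
    (measure_luckyNodes_le_exp_neg ht (a := 1 / 2) (by norm_num) _)
  simp only [Set.mem_ofPred_eq, hω, Finset.card_empty, Nat.cast_zero, mul_zero]
  linarith [rate_nonneg (Fintype.card V) t,
    show rate (Fintype.card V) t = 2⁻¹ ^ t * Fintype.card V from rfl]

end Candidates

section Witnesses

variable [DecidableEq V] {G : SimpleGraph V} [DecidableRel G.Adj] {port : V → V → ℕ}
  {adv : Adversary (gossip T t τ) V} (ht : t ≤ T) (hτ : 1 ≤ τ) (hadv : adv.IsLegal G port)
include ht hτ hadv

/-- The two sets of draws are disjoint, so one of them has at most half of the nodes. -/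
theorem measure_split_le (hrate : 3 / 4 * rate (Fintype.card V) t ≤ τ) {u v : V} (huv : u ≠ v) :
    (gossip T t τ).coinMeasure V {ω | ∃ k, Function.Injective (label ω) ∧
      τ ≤ (hits (label ω) (logs (config G port adv ω k)) u v).card ∧
      τ ≤ (hits (label ω) (logs (config G port adv ω k)) v u).card} ≤
    2 * ENNReal.ofReal (Real.exp (-(rate (Fintype.card V) t / 50))) := by
  let X := witnessSampling ht hτ hadv u v
  let Y := witnessSampling ht hτ hadv v u
  refine measure_exists_le_of_forall_succ _ (fun k ω ⟨hlab, hX, hY⟩ =>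
    ⟨hlab, hX.trans (X.hits_mono hlab k.le_succ), hY.trans (Y.hits_mono hlab k.le_succ)⟩)
    fun k => ?_
  have hsub : {ω : (gossip T t τ).Coins V |
      Function.Injective (label ω) ∧ τ ≤ X.hits k ω ∧ τ ≤ Y.hits k ω} ⊆
      (X.good ∩ {ω | rate (Fintype.card V) t / 50 ≤
        Real.log (3 / 2) * X.hits k ω - 2⁻¹ ^ t * (3 / 2 - 1) * X.tries k ω}) ∪
      (Y.good ∩ {ω | rate (Fintype.card V) t / 50 ≤
        Real.log (3 / 2) * Y.hits k ω - 2⁻¹ ^ t * (3 / 2 - 1) * Y.tries k ω}) := by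
    rintro ω ⟨hlab, hX, hY⟩
    have hcard : X.tries k ω + Y.tries k ω ≤ Fintype.card V :=
      (Finset.card_union_of_disjoint (disjoint_draws hlab huv)).ge.trans (Finset.card_le_univ _)
    obtain hr | hr : 2 * X.tries k ω ≤ Fintype.card V ∨
        2 * Y.tries k ω ≤ Fintype.card V := by omega
    · exact Or.inl ⟨hlab, rate_div_le_of_few_tries (hrate.trans (by exact_mod_cast hX)) hr⟩
    · exact Or.inr ⟨hlab, rate_div_le_of_few_tries (hrate.trans (by exact_mod_cast hY)) hr⟩
  rw [two_mul]
  exact (measure_mono hsub).trans <| (measure_union_le _ _).trans <| add_le_add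
    (X.measure_le_exp_neg (by norm_num) _ k) (Y.measure_le_exp_neg (by norm_num) _ k)

theorem measure_many_hits_le {U : ℕ} (hU : 3 * rate (Fintype.card V) t ≤ U) (u : V) :
    (gossip T t τ).coinMeasure V {ω | ∃ k, Function.Injective (label ω) ∧
      U < (hits (label ω) (logs (config G port adv ω k)) u u).card} ≤
    ENNReal.ofReal (Real.exp (-(rate (Fintype.card V) t / 50))) := by
  let X := witnessSampling ht hτ hadv u u
  refine measure_exists_le_of_forall_succ _ (fun k ω ⟨hlab, hX⟩ =>
    ⟨hlab, hX.trans_le (X.hits_mono hlab k.le_succ)⟩) fun k => ?_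
  refine (measure_mono fun ω h => ?_).trans (X.measure_le_exp_neg two_pos _ k)
  exact ⟨h.1, rate_div_le_of_many_hits (hU.trans (by exact_mod_cast h.2.le))
    (Finset.card_le_univ _)⟩

theorem measure_few_hits_le (hrate : τ = ⌈3 / 4 * rate (Fintype.card V) t⌉₊)
    (hV : 50 ≤ Fintype.card V) (u : V) :
    (gossip T t τ).coinMeasure V {ω | ∃ k, Function.Injective (label ω) ∧
      Fintype.card V ≤ (draws (label ω) (logs (config G port adv ω k)) u u).card + 1 ∧
      (hits (label ω) (logs (config G port adv ω k)) u u).card < τ} ≤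
    ENNReal.ofReal (Real.exp (-(rate (Fintype.card V) t / 50))) := by
  let X := witnessSampling ht hτ hadv u u
  have htries (k ω) : X.tries k ω + 1 ≤ Fintype.card V := card_draws_lt _ _ _ _
  refine measure_exists_le_of_forall_succ _ (fun k ω ⟨hlab, hall, hX⟩ => ?succ) fun k => ?_
  case succ =>
    obtain ⟨htries', hhits'⟩ | ⟨htries', -⟩ := X.tries_and_hits_succ hlab k
    · exact ⟨hlab, hall.trans_eq (congrArg (· + 1) htries'.symm), hhits'.trans_lt hX⟩
    · exact absurd (htries'.symm.trans_lt (htries (k + 1) ω)) hall.not_gt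
  refine (measure_mono fun ω h => ?_).trans (X.measure_le_exp_neg (a := 3 / 4) (by norm_num) _ k)
  obtain ⟨hlab, hall, hX⟩ := h
  exact ⟨hlab, rate_div_le_of_few_hits (Nat.lt_ceil.1 (hX.trans_eq hrate)).le hall hV⟩

end Witnesses

end Tails

/-! ### Success with high probability -/

section Good

variable {V : Type} {T t τ : ℕ} [Fintype V] [DecidableEq V]

/-- The outcomes of the coin flips for which the election works. -/
structure Good (G : SimpleGraph V) [DecidableRel G.Adj] (port : V → V → ℕ)
    (adv : Adversary (gossip T t τ) V) (U : ℕ) (ω : (gossip T t τ).Coins V) : Prop where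
  injective : Function.Injective (label ω)
  nonempty : luckyNodes ω ≠ ∅
  card_le : (luckyNodes ω).card ≤ U
  noSplit : ∀ k, NoSplit (label ω) τ (logs (config G port adv ω k))
  hits_le : ∀ k u, (hits (label ω) (logs (config G port adv ω k)) u u).card ≤ U
  le_hits : ∀ k u, (∀ z, z ≠ u → z ∈ draws (label ω) (logs (config G port adv ω k)) u u) →
    τ ≤ (hits (label ω) (logs (config G port adv ω k)) u u).card

variable {G : SimpleGraph V} [DecidableRel G.Adj] {port : V → V → ℕ}
  {adv : Adversary (gossip T t τ) V} {U : ℕ}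

theorem Good.succeeds {ω : (gossip T t τ).Coins V} (h : Good G port adv U ω)
    (hadv : adv.IsLegal G port) (hτ : 1 ≤ τ) (hG : G.Connected) (hU : 1 ≤ U) {S : ℝ}
    (hS : 25 * (U : ℝ) ^ 2 ≤ S) : SolvesWithin G port adv ω (S * G.diam) ∧
      SendsAtMost G port adv ω (S * G.edgeFinset.card) := by
  have hvalid (k : ℕ) : Valid G ω (config G port adv ω k) := valid_config hadv h.injective hτ k
  have hlength (k v) : (logs (config G port adv ω k) v).length ≤ 1 + U + U * U + U + 1 :=
    (hvalid k).sound.length_le h.injective h.card_le (h.hits_le k) v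
  have hBS : 5 * ((1 + U + U * U + U + 1 : ℕ) : ℝ) ≤ S := by
    have hU' : (1 : ℝ) ≤ U := by exact_mod_cast hU
    push_cast
    nlinarith
  generalize 1 + U + U * U + U + 1 = B at hlength hBS
  constructor
  · obtain ⟨u, hu⟩ := Finset.nonempty_iff_ne_empty.2 h.nonempty
    obtain ⟨k, hk, hnow⟩ := solvesWithin hadv h.injective hτ hlength hG h.le_hits
      ⟨u, mem_luckyNodes.1 hu⟩ h.noSplit
    refine ⟨k, hk, hnow.trans ?_⟩
    rw [← mul_assoc]
    gcongr
  · intro k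
    have hsent : ((config G port adv ω k).sent : ℝ) ≤ 2 * G.edgeFinset.card * B := by
      exact_mod_cast (hvalid k).sent_le (hlength k)
    calc ((config G port adv ω k).sent : ℝ) ≤ 2 * B * G.edgeFinset.card := by linarith
      _ ≤ S * G.edgeFinset.card := by gcongr; linarith [B.cast_nonneg (α := ℝ)]

theorem not_good_cases {ω : (gossip T t τ).Coins V} (h : ¬ Good G port adv U ω) :
    ¬ Function.Injective (label ω) ∨
    (∃ p : V × V, p.1 ≠ p.2 ∧ ∃ k, Function.Injective (label ω) ∧
      τ ≤ (hits (label ω) (logs (config G port adv ω k)) p.1 p.2).card ∧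
      τ ≤ (hits (label ω) (logs (config G port adv ω k)) p.2 p.1).card) ∨
    (∃ u k, Function.Injective (label ω) ∧
      U < (hits (label ω) (logs (config G port adv ω k)) u u).card) ∨
    (∃ u k, Function.Injective (label ω) ∧
      Fintype.card V ≤ (draws (label ω) (logs (config G port adv ω k)) u u).card + 1 ∧
      (hits (label ω) (logs (config G port adv ω k)) u u).card < τ) ∨
    U < (luckyNodes ω).card ∨ luckyNodes ω = ∅ := by
  contrapose! h
  obtain ⟨hinj, hsplit, hmany, hfew, hcard, hne⟩ := h
  refine ⟨hinj, hne.ne_empty, hcard, fun k u v huv h => ?_, fun k u => hmany u k hinj,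
    fun k u hall => hfew u k hinj ?_⟩
  · exact (hsplit (u, v) huv k hinj h.1).not_ge h.2
  · rw [← Finset.card_univ, ← Finset.card_erase_add_one (Finset.mem_univ u)]
    exact Nat.succ_le_succ (Finset.card_le_card fun z hz => hall z (Finset.mem_erase.1 hz).1)

theorem six_terms_le {n b : ℝ≥0∞} (hn : 1 ≤ n) :
    n ^ 2 * (2 * b) + (n * b + (n * b + (b + b))) ≤ 6 * n ^ 2 * b := by
  have hle : n ≤ n ^ 2 := le_self_pow₀ hn two_ne_zero
  have hone : b ≤ n ^ 2 * b := le_mul_of_one_le_left' (hn.trans hle)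
  calc n ^ 2 * (2 * b) + (n * b + (n * b + (b + b)))
      ≤ n ^ 2 * (2 * b) + (n ^ 2 * b + (n ^ 2 * b + (n ^ 2 * b + n ^ 2 * b))) := by gcongr
    _ = 6 * n ^ 2 * b := by ring

theorem measure_not_good_le (ht : t ≤ T) (hτ : 1 ≤ τ) (hadv : adv.IsLegal G port)
    (hrate : τ = ⌈3 / 4 * rate (Fintype.card V) t⌉₊) (hV : 50 ≤ Fintype.card V)
    (hU : 3 * rate (Fintype.card V) t ≤ U) :
    (gossip T t τ).coinMeasure V {ω | ¬ Good G port adv U ω} ≤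
      Fintype.card V ^ 2 * 2⁻¹ ^ T + 6 * Fintype.card V ^ 2 *
        ENNReal.ofReal (Real.exp (-(rate (Fintype.card V) t / 50))) := by
  have hsplit := measure_exists_le_card_mul ((gossip T t τ).coinMeasure V)
    (p := fun (p : V × V) ω => p.1 ≠ p.2 ∧ ∃ k, Function.Injective (label ω) ∧
      τ ≤ (hits (label ω) (logs (config G port adv ω k)) p.1 p.2).card ∧
      τ ≤ (hits (label ω) (logs (config G port adv ω k)) p.2 p.1).card) fun p => by
    by_cases hp : p.1 = p.2
    · simp [hp]
    · exact (measure_mono fun _ h => h.2).trans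
        (measure_split_le ht hτ hadv (hrate ▸ Nat.le_ceil _) hp)
  have hmany := measure_exists_le_card_mul _ (measure_many_hits_le ht hτ hadv hU)
  have hfew := measure_exists_le_card_mul _ (measure_few_hits_le ht hτ hadv hrate hV)
  have hcard := measure_many_lucky_le (τ := τ) ht hU
  have hempty := measure_no_lucky_le (V := V) (τ := τ) ht
  rw [Fintype.card_prod, Nat.cast_mul, ← sq] at hsplit
  refine (measure_mono fun ω h => not_good_cases h).trans <| (measure_union_le _ _).trans <|
    add_le_add (measure_not_injective_label_le V τ) ?_
  refine ((measure_union_le _ _).trans <| add_le_add hsplit <|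
    (measure_union_le _ _).trans <| add_le_add hmany <|
    (measure_union_le _ _).trans <| add_le_add hfew <|
    (measure_union_le _ _).trans <| add_le_add hcard hempty).trans (six_terms_le ?_)
  exact_mod_cast (show 1 ≤ 50 by norm_num).trans hV

end Good

/-! ### The choice of the parameters -/

section Parameters

theorem cast_le_two_pow_log_succ (n : ℕ) : (n : ℝ) ≤ 2 ^ (Nat.log 2 n + 1) := by
  exact_mod_cast (Nat.lt_pow_succ_log_self one_lt_two n).le

theorem two_inv_pow_le_inv_pow {n m T : ℕ} (hn : n ≠ 0) (hT : m * (Nat.log 2 n + 1) ≤ T) :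
    (2⁻¹ : ℝ) ^ T ≤ ((n : ℝ) ^ m)⁻¹ := by
  rw [inv_pow]
  refine inv_anti₀ (by positivity) ?_
  calc (n : ℝ) ^ m ≤ (2 ^ (Nat.log 2 n + 1)) ^ m := by gcongr; exact cast_le_two_pow_log_succ n
    _ = 2 ^ (m * (Nat.log 2 n + 1)) := by rw [← pow_mul, mul_comm]
    _ ≤ 2 ^ T := pow_le_pow_right₀ one_le_two hT

theorem exp_neg_le_inv_pow {n m : ℕ} {x : ℝ} (hn : n ≠ 0) (hx : m * (Nat.log 2 n + 1) ≤ x) :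
    Real.exp (-x) ≤ ((n : ℝ) ^ m)⁻¹ := by
  have htwo : (2 : ℝ) ≤ Real.exp 1 := by linarith [Real.add_one_le_exp 1]
  rw [Real.exp_neg]
  refine inv_anti₀ (by positivity) ?_
  calc (n : ℝ) ^ m ≤ (2 ^ (Nat.log 2 n + 1)) ^ m := by gcongr; exact cast_le_two_pow_log_succ n
    _ ≤ (Real.exp 1 ^ (Nat.log 2 n + 1)) ^ m := by gcongr
    _ = Real.exp (m * (Nat.log 2 n + 1)) := by
      rw [← pow_mul, Real.exp_one_pow]
      push_cast
      rw [mul_comm]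
    _ ≤ Real.exp x := Real.exp_le_exp.2 hx

theorem failure_le {n C : ℕ} {c p q : ℝ} (hn : 7 ≤ n) (hc : c ≤ C)
    (hp : p ≤ ((n : ℝ) ^ (C + 3))⁻¹) (hq : q ≤ ((n : ℝ) ^ (C + 3))⁻¹) :
    (n : ℝ) ^ 2 * p + 6 * (n : ℝ) ^ 2 * q ≤ 1 / (n : ℝ) ^ c := by
  have hn' : (7 : ℝ) ≤ n := by exact_mod_cast hn
  have hpos : (0 : ℝ) < n := by linarith
  calc (n : ℝ) ^ 2 * p + 6 * (n : ℝ) ^ 2 * q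
      ≤ (n : ℝ) ^ 2 * ((n : ℝ) ^ (C + 3))⁻¹ + 6 * (n : ℝ) ^ 2 * ((n : ℝ) ^ (C + 3))⁻¹ := by gcongr
    _ = 1 / (n : ℝ) ^ C * (7 / n) := by
      field_simp
      ring
    _ ≤ 1 / (n : ℝ) ^ C := mul_le_of_le_one_right (by positivity) ((div_le_one hpos).2 hn')
    _ ≤ 1 / (n : ℝ) ^ c := by
      rw [← Real.rpow_natCast]
      gcongr
      linarith

theorem sq_le_two_pow {l : ℕ} (h : 4 ≤ l) : l ^ 2 ≤ 2 ^ l := by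
  induction l, h using Nat.le_induction with
  | base => norm_num
  | succ l h ih => rw [pow_succ 2 l]; nlinarith

theorem log_le_two_mul_log (n : ℕ) : (Nat.log 2 n : ℝ) ≤ 2 * Real.log n := by
  have hlogb : (Nat.log 2 n : ℝ) ≤ Real.log n / Real.log 2 := Real.natLog_le_logb n 2
  have htwo := Real.log_two_gt_d9
  rw [le_div_iff₀ (by linarith)] at hlogb
  nlinarith [(Nat.log 2 n).cast_nonneg (α := ℝ)]

/-- An exponent `t` for which the expected number of lucky nodes is between `a` and `2 * a`. -/
def luckExponent (a n : ℕ) : ℕ := Nat.log 2 (n / a)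

theorem luckExponent_le (a n : ℕ) : luckExponent a n ≤ Nat.log 2 n :=
  Nat.log_mono_right (Nat.div_le_self n a)

section LuckExponent

variable {a n : ℕ} (ha : 0 < a)
include ha

theorem le_rate_luckExponent (h : a ≤ n) : (a : ℝ) ≤ rate n (luckExponent a n) := by
  have hle : 2 ^ luckExponent a n * a ≤ n :=
    (Nat.le_div_iff_mul_le ha).1 (Nat.pow_log_le_self 2 (Nat.div_pos h ha).ne')
  rw [rate, inv_pow, inv_mul_eq_div, le_div_iff₀ (by positivity), mul_comm]
  exact_mod_cast hle

theorem rate_luckExponent_le (n : ℕ) : rate n (luckExponent a n) ≤ 2 * a := by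
  have hlt : n < 2 ^ (luckExponent a n + 1) * a :=
    (Nat.div_lt_iff_lt_mul ha).1 (Nat.lt_pow_succ_log_self one_lt_two _)
  rw [rate, inv_pow, inv_mul_eq_div, div_le_iff₀ (by positivity), mul_assoc,
    mul_comm (a : ℝ), ← mul_assoc, ← pow_succ']
  exact_mod_cast hlt.le

end LuckExponent

/-- The length of the labels. -/
def labelLength (C n : ℕ) : ℕ := (C + 3) * (Nat.log 2 n + 1)

/-- The number of lucky nodes aimed at. -/
def target (C n : ℕ) : ℕ := 100 * (C + 3) * Nat.log 2 n

/-- The gossip protocol for `n` nodes, with failure probability at most `1 / n ^ C`. -/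
noncomputable abbrev electionProtocol (C n : ℕ) : Protocol :=
  gossip (labelLength C n) (luckExponent (target C n) n)
    ⌈3 / 4 * rate n (luckExponent (target C n) n)⌉₊

theorem luckExponent_le_labelLength (C n : ℕ) : luckExponent (target C n) n ≤ labelLength C n :=
  ((luckExponent_le _ n).trans (Nat.le_succ _)).trans (Nat.le_mul_of_pos_left _ (Nat.succ_pos _))

theorem card_label_le (T : ℕ) : Fintype.card (Label T) ≤ Fintype.card (Rumor T) :=
  Fintype.card_le_of_injective Rumor.cand fun _ _ h => Rumor.cand.inj h

theorem target_sq_le (C n : ℕ) : 25 * ((6 * target C n : ℕ) : ℝ) ^ 2 ≤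
    3600 * (100 * (C + 3)) ^ 2 * Real.log n ^ 2 := by
  have htarget : ((6 * target C n : ℕ) : ℝ) = 600 * (C + 3) * Nat.log 2 n := by
    rw [target]
    push_cast
    ring
  calc 25 * ((6 * target C n : ℕ) : ℝ) ^ 2
      ≤ 25 * (600 * (C + 3) * (2 * Real.log n)) ^ 2 := by
        rw [htarget]
        gcongr
        exact log_le_two_mul_log n
    _ = 3600 * (100 * (C + 3)) ^ 2 * Real.log n ^ 2 := by ring

variable {C n : ℕ} (hn : 100 * (C + 3) ≤ Nat.log 2 n)
include hn

theorem log_sq_le_self : Nat.log 2 n ^ 2 ≤ n :=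
  (sq_le_two_pow (by omega)).trans (Nat.pow_log_le_self 2 fun h => by simp [h] at hn)

theorem target_pos : 0 < target C n := Nat.mul_pos (by omega) (by omega)

theorem target_le : target C n ≤ n :=
  (Nat.mul_le_mul_right _ hn).trans ((sq _).symm.trans_le (log_sq_le_self hn))

theorem card_rumor_le : Fintype.card (Rumor (labelLength C n)) ≤ n ^ (6 * (C + 3) + 1) := by
  have hten : 10 ≤ n := by nlinarith [log_sq_le_self hn]
  have hpow : 2 ^ labelLength C n ≤ n ^ (2 * (C + 3)) :=
    calc 2 ^ labelLength C n ≤ 2 ^ (Nat.log 2 n * (2 * (C + 3))) :=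
          Nat.pow_le_pow_right two_pos (by rw [labelLength]; nlinarith)
      _ = (2 ^ Nat.log 2 n) ^ (2 * (C + 3)) := pow_mul _ _ _
      _ ≤ n ^ (2 * (C + 3)) := Nat.pow_le_pow_left (Nat.pow_log_le_self 2 (by omega)) _
  have hone : 1 ≤ n ^ (2 * (C + 3)) := Nat.one_le_pow _ _ (by omega)
  calc Fintype.card (Rumor (labelLength C n))
      ≤ 5 * (n ^ (2 * (C + 3)) * (n ^ (2 * (C + 3)) * (n ^ (2 * (C + 3)) + n ^ (2 * (C + 3))))) :=
        Rumor.card_le.trans (by gcongr)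
    _ = 10 * n ^ (6 * (C + 3)) := by ring
    _ ≤ n * n ^ (6 * (C + 3)) := by gcongr
    _ = n ^ (6 * (C + 3) + 1) := (pow_succ' _ _).symm

theorem threshold_pos : 1 ≤ ⌈3 / 4 * rate n (luckExponent (target C n) n)⌉₊ := by
  have hpos : (0 : ℝ) < target C n := by exact_mod_cast target_pos hn
  have hrate := le_rate_luckExponent (target_pos hn) (target_le hn)
  exact Nat.one_le_ceil_iff.2 (by linarith)

theorem mul_log_le_rate_div : ((C + 3 : ℕ) : ℝ) * (Nat.log 2 n + 1) ≤
    rate n (luckExponent (target C n) n) / 50 := by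
  have htarget : 50 * ((C + 3) * (Nat.log 2 n + 1)) ≤ target C n := by
    rw [target]
    nlinarith [show 1 ≤ Nat.log 2 n by omega]
  have hcast : (50 : ℝ) * ((C + 3 : ℕ) * (Nat.log 2 n + 1)) ≤ target C n := by
    exact_mod_cast htarget
  linarith [le_rate_luckExponent (target_pos hn) (target_le hn)]

variable {V : Type} [Fintype V] [DecidableEq V] {G : SimpleGraph V} [DecidableRel G.Adj]
  {port : V → V → ℕ} {adv : Adversary (electionProtocol C n) V}

theorem measure_not_good_le_inv_rpow (hV : Fintype.card V = n) (hadv : adv.IsLegal G port)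
    {c : ℝ} (hc : c ≤ C) :
    (electionProtocol C n).coinMeasure V {ω | ¬ Good G port adv (6 * target C n) ω} ≤
      ENNReal.ofReal (1 / (n : ℝ) ^ c) := by
  subst hV
  have hlarge : 50 ≤ Fintype.card V := by nlinarith [log_sq_le_self hn]
  have hne : Fintype.card V ≠ 0 := by omega
  have hU : 3 * rate (Fintype.card V) (luckExponent (target C (Fintype.card V))
      (Fintype.card V)) ≤ (6 * target C (Fintype.card V) : ℕ) := by
    push_cast
    linarith [rate_luckExponent_le (target_pos hn) (Fintype.card V)]
  refine (measure_not_good_le (luckExponent_le_labelLength C _) (threshold_pos hn) hadv rfl hlarge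
    hU).trans ?_
  refine le_trans (le_of_eq ?_) <| ENNReal.ofReal_le_ofReal <| failure_le (by omega) hc
    (two_inv_pow_le_inv_pow hne le_rfl) (exp_neg_le_inv_pow hne (mul_log_le_rate_div hn))
  rw [ENNReal.ofReal_add (by positivity) (by positivity), ENNReal.ofReal_mul (by positivity),
    ENNReal.ofReal_mul (by positivity), ENNReal.ofReal_mul (by positivity),
    ENNReal.ofReal_pow (by positivity), ENNReal.ofReal_natCast, ENNReal.ofReal_ofNat,
    two_inv_pow_eq_ofReal, labelLength]

end Parameters

end Gossip

theorem mainTheorem2 (c : ℝ) (hc : 0 < c) :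
    ∃ (P : ℕ → Protocol) (κ n₀ : ℕ) (K : ℝ), ∀ n : ℕ, n₀ ≤ n →
      Fintype.card (P n).Msg ≤ n ^ κ ∧ Fintype.card (P n).Ident ≤ n ^ κ ∧
      ∀ (V : Type) [Fintype V] [DecidableEq V] (G : SimpleGraph V) [DecidableRel G.Adj]
        (port : V → V → ℕ) (adv : Protocol.Adversary (P n) V),
        Fintype.card V = n → G.Connected → IsPortNumbering G port → adv.IsLegal G port →
        (P n).coinMeasure V
            {ω | ¬ (Protocol.SolvesWithin G port adv ω (K * G.diam * Real.log n ^ 2) ∧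
              Protocol.SendsAtMost G port adv ω (K * G.edgeFinset.card * Real.log n ^ 2))} ≤
          ENNReal.ofReal (1 / (n : ℝ) ^ c) := by
  refine ⟨Gossip.electionProtocol ⌈c⌉₊, 6 * (⌈c⌉₊ + 3) + 1, 2 ^ (100 * (⌈c⌉₊ + 3)),
    3600 * (100 * (⌈c⌉₊ + 3)) ^ 2, fun n hn₀ => ?_⟩
  have hn : 100 * (⌈c⌉₊ + 3) ≤ Nat.log 2 n := Nat.le_log_of_pow_le one_lt_two hn₀
  refine ⟨Gossip.card_rumor_le hn, (Gossip.card_label_le _).trans (Gossip.card_rumor_le hn), ?_⟩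
  intro V _ _ G _ port adv hV hG _ hadv
  refine (measure_mono (Set.compl_subset_compl.2 fun ω hgood => ?_)).trans
    (Gossip.measure_not_good_le_inv_rpow hn hV hadv (Nat.le_ceil c))
  have hU : 1 ≤ 6 * Gossip.target ⌈c⌉₊ n := Nat.mul_pos (by norm_num) (Gossip.target_pos hn)
  rw [mul_right_comm, mul_right_comm _ (G.edgeFinset.card : ℝ)]
  exact Gossip.Good.succeeds hgood hadv (Gossip.threshold_pos hn) hG hU (Gossip.target_sq_le _ n)
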